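/- \textbf{Corollary (Biadjoint Triangle).} Conventions: $\mathrm{Cat}$ is the $2$-category of (small) categories, all $2$-categories have hom-categories in $\mathrm{Cat}$, and $[\mathcal S,\mathrm{Cat}]_{PS}$ denotes the $2$-category of pseudofunctors $\mathcal S\to\mathrm{Cat}$, pseudonatural transformations and modifications. For a small $2$-category $\mathcal S$ and a pseudofunctor $\mathcal W:\mathcal S\to\mathrm{Cat}$: the weighted bilimit of $\mathcal D:\mathcal S\to\mathcal K$ is an object $\{\mathcal W,\mathcal D\}_{bi}$ with an equivalence $\mathcal K(X,\{\mathcal W,\mathcal D\}_{bi})\simeq[\mathcal S,\mathrm{Cat}]_{PS}(\mathcal W,\mathcal K(X,\mathcal D-))$ pseudonatural in $X$; the weighted bicolimit of $\mathcal A:\mathcal S^{op}\to\mathcal K$ is an object $\mathcal W *_{bi}\mathcal A$ with an equivalence $\mathcal K(\mathcal W *_{bi}\mathcal A,X)\simeq[\mathcal S,\mathrm{Cat}]_{PS}(\mathcal W,\mathcal K(\mathcal A-,X))$ pseudonatural in $X$. A pseudofunctor $R:\mathcal A\to\mathcal B$ is right biadjoint to $E:\mathcal B\to\mathcal A$ if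 there are pseudonatural transformations $\rho:\mathrm{Id}\to RE$, $\varepsilon:ER\to\mathrm{Id}$ and invertible modifications $\mathrm{id}_E\Rightarrow(\varepsilon E)(E\rho)$, $(R\varepsilon)(\rho R)\Rightarrow\mathrm{id}_R$ satisfying the two coherence (swallowtail) axioms; it is right biadjoint if such an $E$ exists. Let $\mathcal S$ be a small $2$-category, $\mathcal W:\mathcal S\to\mathrm{Cat}$ a pseudofunctor, and let $\mathcal A,\mathcal B,\mathcal C,\mathcal C'$ be $2$-categories. Let $R:\mathcal A\to\mathcal B$, $J:\mathcal A\to\mathcal C'$, $U:\mathcal C'\to\mathcal B$ and $V:\mathcal C'\to\mathcal C$ be pseudofunctors such that $R$ is right biadjoint and $U\circ J=R$. Suppose that for each object $y$ of $\mathcal C$ there is given a pseudofunctor $\mathcal D_y:\mathcal S\times\mathcal C'\to\mathrm{Cat}$ such that: \begin{itemize} \item the restriction $|\mathcal D_y|$ of $\mathcal D_y$ to $\mathcal S_0\times\mathcal C'$, where $\mathcal S_0$ is the discrete $2$-category of objects of $\mathcal S$, factorizes through $U^*:=\mathcal B(-,U-):\mathcal B^{op}\times\mathcal C'\to\mathrm{Cat}$;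 that is, there are a pseudofunctor $\mathcal D_y':\mathcal S_0\to\mathcal B^{op}$ and a pseudonatural equivalence $|\mathcal D_y|\simeq U^*\circ(\mathcal D_y'\times\mathrm{Id}_{\mathcal C'})$; \item $\{\mathcal W,\mathcal D_y(-,x)\}_{bi}\simeq\mathcal C(y,Vx)$ in $\mathrm{Cat}$, pseudonaturally in $x\in\mathcal C'$; that is, there are equivalences $\mathrm{Cat}(X,\mathcal C(y,Vx))\simeq[\mathcal S,\mathrm{Cat}]_{PS}(\mathcal W,\mathrm{Cat}(X,\mathcal D_y(-,x)))$ pseudonatural in $X\in\mathrm{Cat}$ and $x\in\mathcal C'$. \end{itemize} Then for each object $y$ of $\mathcal C$ there is a pseudofunctor $\mathcal A_y:\mathcal S^{op}\to\mathcal A$ with a pseudonatural equivalence $\mathcal D_y(-,J-)\simeq\mathcal A(\mathcal A_y-,-)$ of pseudofunctors $\mathcal S\times\mathcal A\to\mathrm{Cat}$. Moreover, for any such family $(\mathcal A_y)_y$, the pseudofunctor $V\circ J$ is right biadjoint if and only if for every object $y$ of $\mathcal C$ the weighted bicolimit $\mathcal W *_{bi}\mathcal A_y$ exists in $\mathcal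 A$. In this case $V\circ J$ is right biadjoint to $G$, defined by $Gy=\mathcal W *_{bi}\mathcal A_y$: for every choice of the weighted bicolimits there is a pseudofunctor $G:\mathcal C\to\mathcal A$ with the chosen values on objects which is left biadjoint to $V\circ J$. -/

import Mathlib

open CategoryTheory Bicategory Opposite
open scoped CategoryTheory.Pseudofunctor.StrongTrans

universe w w₁ w₂ w₃ w₄ v v₁ v₂ v₃ v₄ u u₁ u₂ u₃ u₄

/-!
Bicategories `B` with `Bicategory.Strict B` are 2-categories; `B ⥤ᵖ C` is the type of
pseudofunctors, and (with the scoped instances opened above) it is itself a bicategory, with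
pseudonatural transformations as 1-cells and modifications as 2-cells.  Composition is written in
diagrammatic order: `F.comp G` is `G ∘ F`.
-/

namespace BiTri

section Basic

variable {B : Type u₁} [Bicategory.{w₁, v₁} B] {B' : Type u₂} [Bicategory.{w₂, v₂} B']
  {C : Type u₃} [Bicategory.{w₃, v₃} C] {C' : Type u₄} [Bicategory.{w₄, v₄} C']

/-- The product `F × G` of two pseudofunctors. -/
def prodPF (F : B ⥤ᵖ B') (G : C ⥤ᵖ C') : (B × C) ⥤ᵖ (B' × C') where
  obj X := (F.obj X.1, G.obj X.2)
  map f := (F.map f.1, G.map f.2)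
  map₂ η := (F.map₂ η.1, G.map₂ η.2)
  mapId X := Iso.prod (F.mapId X.1) (G.mapId X.2)
  mapComp f g := Iso.prod (F.mapComp f.1 g.1) (G.mapComp f.2 g.2)

/-- A pseudofunctor `F : Bᵒᵖ → C` regarded as a pseudofunctor `Fᵒᵖ : B → Cᵒᵖ`. -/
def leftOpPF (F : Bᵒᵖ ⥤ᵖ C) : B ⥤ᵖ Cᵒᵖ where
  obj X := op (F.obj (op X))
  map f := (F.map f.op).op
  map₂ η := Bicategory.Opposite.op2 (F.map₂ (Bicategory.Opposite.op2 η))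
  mapId X := (F.mapId (op X)).op2
  mapComp f g := (F.mapComp g.op f.op).op2
  map₂_associator f g h := by
    have := F.map₂_associator h.op g.op f.op
    have h2 : F.map₂ (α_ h.op g.op f.op).inv = _ := (F.map₂Iso_inv _).symm.trans
      (congrArg Iso.inv (Iso.ext (F.map₂_associator h.op g.op f.op) : F.map₂Iso (α_ h.op g.op f.op) =
        F.mapComp (h.op ≫ g.op) f.op ≪≫ whiskerRightIso (F.mapComp h.op g.op) (F.map f.op) ≪≫
          α_ _ _ _ ≪≫ whiskerLeftIso (F.map h.op) (F.mapComp g.op f.op).symm ≪≫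
          (F.mapComp h.op (g.op ≫ f.op)).symm))
    refine (congrArg Bicategory.Opposite.op2 h2).trans ?_
    apply congrArg Bicategory.Opposite.Hom2.op2'
    simp

end Basic

/-- The inclusion `S₀ → S` of the discrete 2-category `S₀` of objects of `S`. -/
def discIncl (S : Type u) [Bicategory.{w, v} S] : LocallyDiscrete (Discrete S) ⥤ᵖ S :=
  pseudofunctorOfIsLocallyDiscrete (fun s => s.as.as)
    (fun f => eqToHom (Discrete.eq_of_hom f.as))
    (fun _ => Iso.refl _)
    (fun f g => (eqToHomTransIso (Discrete.eq_of_hom f.as) (Discrete.eq_of_hom g.as)))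
    (by rintro ⟨⟨a⟩⟩ ⟨⟨b⟩⟩ ⟨⟨c⟩⟩ ⟨⟨d⟩⟩ ⟨⟨⟨e⟩⟩⟩ ⟨⟨⟨e'⟩⟩⟩ ⟨⟨⟨e''⟩⟩⟩
        cases e
        cases e'
        cases e''
        simp
        rfl)
    (by rintro ⟨⟨a⟩⟩ ⟨⟨b⟩⟩ ⟨⟨⟨e⟩⟩⟩
        cases e
        simp
        rfl)
    (by rintro ⟨⟨a⟩⟩ ⟨⟨b⟩⟩ ⟨⟨⟨e⟩⟩⟩
        cases e
        simp
        rfl)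

/-- The symmetry `S × (X × E) → X × (S × E)`. -/
def shuffle (S : Type u₁) [Bicategory.{w₁, v₁} S] (X : Type u₂) [Bicategory.{w₂, v₂} X]
    (E : Type u₃) [Bicategory.{w₃, v₃} E] : (S × (X × E)) ⥤ᵖ (X × (S × E)) where
  obj p := (p.2.1, (p.1, p.2.2))
  map f := (f.2.1, (f.1, f.2.2))
  map₂ η := (η.2.1, (η.1, η.2.2))
  mapId _ := Iso.refl _
  mapComp _ _ := Iso.refl _

/-- The covariant representable pseudofunctor `K(X, -) : K → Cat`. -/
def homFrom {K : Type u} [Bicategory.{w, v} K] (X : K) : K ⥤ᵖ Cat.{w, v} where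
  obj Y := Cat.of (X ⟶ Y)
  map g := (postcomp X g).toCatHom
  map₂ η := NatTrans.toCatHom₂ ((postcomposing X _ _).map η)
  mapId Y := Cat.Hom.isoMk (NatIso.ofComponents (fun h => ρ_ h) (by
    intro h k θ
    change θ ▷ 𝟙 Y ≫ (ρ_ k).hom = (ρ_ h).hom ≫ θ
    simp))
  mapComp {a b c} f g := Cat.Hom.isoMk (NatIso.ofComponents (fun h => (α_ h f g).symm) (by
    intro h k θ
    change θ ▷ (f ≫ g) ≫ (α_ k f g).inv = (α_ h f g).inv ≫ (θ ▷ f) ▷ g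
    simp))
  map₂_id {a b} f := by
    refine Cat.Hom₂.ext (NatTrans.ext (funext fun (x : X ⟶ a) => ?_))
    exact whiskerLeft_id _ _
  map₂_comp {a b f g k} η θ := by
    refine Cat.Hom₂.ext (NatTrans.ext (funext fun (x : X ⟶ a) => ?_))
    exact whiskerLeft_comp _ _ _
  map₂_whisker_left {a b c} f {g h} η := by
    refine Cat.Hom₂.ext (NatTrans.ext (funext fun (x : X ⟶ a) => ?_))
    change x ◁ f ◁ η = (α_ x f g).inv ≫ ((x ≫ f) ◁ η) ≫ (α_ x f h).hom
    simp
  map₂_whisker_right {a b c f g} η h := by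
    refine Cat.Hom₂.ext (NatTrans.ext (funext fun (x : X ⟶ a) => ?_))
    change x ◁ η ▷ h = (α_ x f h).inv ≫ ((x ◁ η) ▷ h) ≫ (α_ x g h).hom
    simp
  map₂_associator {a b c d} f g h := by
    refine Cat.Hom₂.ext (NatTrans.ext (funext fun (x : X ⟶ a) => ?_))
    change x ◁ (α_ f g h).hom = (α_ x (f ≫ g) h).inv ≫ (α_ x f g).inv ▷ h ≫
      𝟙 _ ≫ (α_ (x ≫ f) g h).hom ≫ (α_ x f (g ≫ h)).hom
    simp
  map₂_left_unitor {a b} f := by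
    refine Cat.Hom₂.ext (NatTrans.ext (funext fun (x : X ⟶ a) => ?_))
    change x ◁ (λ_ f).hom = (α_ x (𝟙 a) f).inv ≫ (ρ_ x).hom ▷ f ≫ 𝟙 _
    simp
  map₂_right_unitor {a b} f := by
    refine Cat.Hom₂.ext (NatTrans.ext (funext fun (x : X ⟶ a) => ?_))
    change x ◁ (ρ_ f).hom = (α_ x f (𝟙 b)).inv ≫ (ρ_ (x ≫ f)).hom ≫ 𝟙 _
    simp

/-- The hom pseudofunctor `K(-, -) : Kᵒᵖ × K → Cat`; a pair `(f, g)` acts by `h ↦ f ≫ h ≫ g`. -/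
def homPF (K : Type u) [Bicategory.{w, v} K] : (Kᵒᵖ × K) ⥤ᵖ Cat.{w, v} where
  obj p := Cat.of (p.1.unop ⟶ p.2)
  map {p q} f := Functor.toCatHom
    { obj := fun h => f.1.unop ≫ h ≫ f.2
      map := fun η => f.1.unop ◁ η ▷ f.2
      map_id := by intros; simp
      map_comp := by intros; simp }
  map₂ {p q f g} η := NatTrans.toCatHom₂
    { app := fun h => η.1.unop2 ▷ (h ≫ f.2) ≫ g.1.unop ◁ h ◁ η.2
      naturality := fun h k θ => by
        change (f.1.unop ◁ θ ▷ f.2) ≫ (η.1.unop2 ▷ (k ≫ f.2) ≫ g.1.unop ◁ k ◁ η.2) =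
          (η.1.unop2 ▷ (h ≫ f.2) ≫ g.1.unop ◁ h ◁ η.2) ≫ g.1.unop ◁ θ ▷ g.2
        rw [whisker_exchange_assoc, Category.assoc, ← whiskerLeft_comp, ← whiskerLeft_comp,
          whisker_exchange] }
  mapId p := Cat.Hom.isoMk (NatIso.ofComponents (fun h => λ_ _ ≪≫ ρ_ h) (by
    intro h k θ
    change (𝟙 p.1.unop ◁ θ ▷ 𝟙 p.2) ≫ (λ_ _).hom ≫ (ρ_ _).hom = ((λ_ _).hom ≫ (ρ_ _).hom) ≫ θ
    rw [leftUnitor_naturality_assoc, rightUnitor_naturality, Category.assoc]))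
  mapComp {p q r} f g := Cat.Hom.isoMk (NatIso.ofComponents (fun h =>
      (α_ g.1.unop f.1.unop (h ≫ f.2 ≫ g.2)) ≪≫
        whiskerLeftIso g.1.unop (whiskerLeftIso f.1.unop (α_ h f.2 g.2).symm ≪≫
          (α_ f.1.unop (h ≫ f.2) g.2).symm)) (by
    intro h k θ
    change ((g.1.unop ≫ f.1.unop) ◁ θ ▷ (f.2 ≫ g.2)) ≫ (α_ g.1.unop f.1.unop (k ≫ f.2 ≫ g.2)).hom ≫
        g.1.unop ◁ (f.1.unop ◁ (α_ k f.2 g.2).inv ≫ (α_ f.1.unop (k ≫ f.2) g.2).inv) =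
      ((α_ g.1.unop f.1.unop (h ≫ f.2 ≫ g.2)).hom ≫
        g.1.unop ◁ (f.1.unop ◁ (α_ h f.2 g.2).inv ≫ (α_ f.1.unop (h ≫ f.2) g.2).inv)) ≫
          g.1.unop ◁ (f.1.unop ◁ θ ▷ f.2) ▷ g.2
    simp))
  map₂_id {p q} f := by
    refine Cat.Hom₂.ext (NatTrans.ext (funext fun (h : p.1.unop ⟶ p.2) => ?_))
    change (𝟙 f.1.unop) ▷ (h ≫ f.2) ≫ f.1.unop ◁ h ◁ (𝟙 f.2) = 𝟙 _
    simp
  map₂_comp {p q f g k} η θ := by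
    refine Cat.Hom₂.ext (NatTrans.ext (funext fun (h : p.1.unop ⟶ p.2) => ?_))
    change (η.1.unop2 ≫ θ.1.unop2) ▷ (h ≫ f.2) ≫ k.1.unop ◁ h ◁ (η.2 ≫ θ.2) =
      (η.1.unop2 ▷ (h ≫ f.2) ≫ g.1.unop ◁ h ◁ η.2) ≫
        (θ.1.unop2 ▷ (h ≫ g.2) ≫ k.1.unop ◁ h ◁ θ.2)
    simp only [comp_whiskerRight, whiskerLeft_comp, Category.assoc]
    rw [whisker_exchange_assoc]
  map₂_whisker_left {p q r} f g k η := by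
    refine Cat.Hom₂.ext (NatTrans.ext (funext fun (h : p.1.unop ⟶ p.2) => ?_))
    change (η.1.unop2 ▷ f.1.unop) ▷ (h ≫ f.2 ≫ g.2) ≫ (k.1.unop ≫ f.1.unop) ◁ h ◁ f.2 ◁ η.2 =
      ((α_ g.1.unop f.1.unop (h ≫ f.2 ≫ g.2)).hom ≫
        g.1.unop ◁ (f.1.unop ◁ (α_ h f.2 g.2).inv ≫ (α_ f.1.unop (h ≫ f.2) g.2).inv)) ≫
      (η.1.unop2 ▷ ((f.1.unop ≫ h ≫ f.2) ≫ g.2) ≫ k.1.unop ◁ (f.1.unop ≫ h ≫ f.2) ◁ η.2) ≫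
      (k.1.unop ◁ ((α_ f.1.unop (h ≫ f.2) k.2).hom ≫ f.1.unop ◁ (α_ h f.2 k.2).hom) ≫
        (α_ k.1.unop f.1.unop (h ≫ f.2 ≫ k.2)).inv)
    bicategory
  map₂_whisker_right {p q r f g} η k := by
    refine Cat.Hom₂.ext (NatTrans.ext (funext fun (h : p.1.unop ⟶ p.2) => ?_))
    change (k.1.unop ◁ η.1.unop2) ▷ (h ≫ f.2 ≫ k.2) ≫ (k.1.unop ≫ g.1.unop) ◁ h ◁ η.2 ▷ k.2 =
      ((α_ k.1.unop f.1.unop (h ≫ f.2 ≫ k.2)).hom ≫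
        k.1.unop ◁ (f.1.unop ◁ (α_ h f.2 k.2).inv ≫ (α_ f.1.unop (h ≫ f.2) k.2).inv)) ≫
      (k.1.unop ◁ (η.1.unop2 ▷ (h ≫ f.2) ≫ g.1.unop ◁ h ◁ η.2) ▷ k.2) ≫
      (k.1.unop ◁ ((α_ g.1.unop (h ≫ g.2) k.2).hom ≫ g.1.unop ◁ (α_ h g.2 k.2).hom) ≫
        (α_ k.1.unop g.1.unop (h ≫ g.2 ≫ k.2)).inv)
    bicategory
  map₂_associator {p q r s} f g k := by
    refine Cat.Hom₂.ext (NatTrans.ext (funext fun (h : p.1.unop ⟶ p.2) => ?_))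
    change (α_ k.1.unop g.1.unop f.1.unop).inv ▷ (h ≫ (f.2 ≫ g.2) ≫ k.2) ≫
        ((k.1.unop ≫ g.1.unop) ≫ f.1.unop) ◁ h ◁ (α_ f.2 g.2 k.2).hom =
      ((α_ k.1.unop (g.1.unop ≫ f.1.unop) (h ≫ (f.2 ≫ g.2) ≫ k.2)).hom ≫
        k.1.unop ◁ ((g.1.unop ≫ f.1.unop) ◁ (α_ h (f.2 ≫ g.2) k.2).inv ≫
          (α_ (g.1.unop ≫ f.1.unop) (h ≫ f.2 ≫ g.2) k.2).inv)) ≫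
      (k.1.unop ◁ ((α_ g.1.unop f.1.unop (h ≫ f.2 ≫ g.2)).hom ≫
        g.1.unop ◁ (f.1.unop ◁ (α_ h f.2 g.2).inv ≫ (α_ f.1.unop (h ≫ f.2) g.2).inv)) ▷ k.2) ≫
      𝟙 _ ≫
      (k.1.unop ◁ ((α_ g.1.unop ((f.1.unop ≫ h ≫ f.2) ≫ g.2) k.2).hom ≫
         g.1.unop ◁ (α_ (f.1.unop ≫ h ≫ f.2) g.2 k.2).hom) ≫
        (α_ k.1.unop g.1.unop ((f.1.unop ≫ h ≫ f.2) ≫ g.2 ≫ k.2)).inv) ≫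
      ((k.1.unop ≫ g.1.unop) ◁ ((α_ f.1.unop (h ≫ f.2) (g.2 ≫ k.2)).hom ≫
         f.1.unop ◁ (α_ h f.2 (g.2 ≫ k.2)).hom) ≫
        (α_ (k.1.unop ≫ g.1.unop) f.1.unop (h ≫ f.2 ≫ g.2 ≫ k.2)).inv)
    rw [Category.id_comp]
    bicategory
  map₂_left_unitor {p q} f := by
    refine Cat.Hom₂.ext (NatTrans.ext (funext fun (h : p.1.unop ⟶ p.2) => ?_))
    change (ρ_ f.1.unop).hom ▷ (h ≫ 𝟙 p.2 ≫ f.2) ≫ f.1.unop ◁ h ◁ (λ_ f.2).hom =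
      ((α_ f.1.unop (𝟙 p.1.unop) (h ≫ 𝟙 p.2 ≫ f.2)).hom ≫
        f.1.unop ◁ (𝟙 p.1.unop ◁ (α_ h (𝟙 p.2) f.2).inv ≫ (α_ (𝟙 p.1.unop) (h ≫ 𝟙 p.2) f.2).inv)) ≫
      (f.1.unop ◁ ((λ_ (h ≫ 𝟙 p.2)).hom ≫ (ρ_ h).hom) ▷ f.2) ≫ 𝟙 _
    rw [Category.comp_id]
    bicategory
  map₂_right_unitor {p q} f := by
    refine Cat.Hom₂.ext (NatTrans.ext (funext fun (h : p.1.unop ⟶ p.2) => ?_))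
    change (λ_ f.1.unop).hom ▷ (h ≫ f.2 ≫ 𝟙 q.2) ≫ f.1.unop ◁ h ◁ (ρ_ f.2).hom =
      ((α_ (𝟙 q.1.unop) f.1.unop (h ≫ f.2 ≫ 𝟙 q.2)).hom ≫
        𝟙 q.1.unop ◁ (f.1.unop ◁ (α_ h f.2 (𝟙 q.2)).inv ≫ (α_ f.1.unop (h ≫ f.2) (𝟙 q.2)).inv)) ≫
      ((λ_ ((f.1.unop ≫ h ≫ f.2) ≫ 𝟙 q.2)).hom ≫ (ρ_ (f.1.unop ≫ h ≫ f.2)).hom) ≫ 𝟙 _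
    rw [Category.comp_id]
    bicategory

section Postcomposition

variable {S : Type u₁} [Bicategory.{w₁, v₁} S] {X : Type u₂} [Bicategory.{w₂, v₂} X]
  {K : Type u₃} [Bicategory.{w₃, v₃} K]

theorem map₂_ρ_inv (D : X ⥤ᵖ K) {a b : X} (f : a ⟶ b) :
    D.map₂ (ρ_ f).inv = (ρ_ (D.map f)).inv ≫ D.map f ◁ (D.mapId b).inv ≫
      (D.mapComp f (𝟙 b)).inv := by
  rw [← cancel_epi (D.map₂ (ρ_ f).hom), ← D.map₂_comp]
  simp

theorem map₂_α_inv (D : X ⥤ᵖ K) {a b c d : X} (f : a ⟶ b) (g : b ⟶ c) (h : c ⟶ d) :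
    D.map₂ (α_ f g h).inv = (D.mapComp f (g ≫ h)).hom ≫ D.map f ◁ (D.mapComp g h).hom ≫
      (α_ (D.map f) (D.map g) (D.map h)).inv ≫ (D.mapComp f g).inv ▷ D.map h ≫
      (D.mapComp (f ≫ g) h).inv := by
  rw [← cancel_epi (D.map₂ (α_ f g h).hom), ← D.map₂_comp]
  simp

/-- The whiskering `Dτ : DF ⟶ DG` of a pseudonatural transformation `τ : F ⟶ G` with a
pseudofunctor `D`. -/
def whiskerRightST {F G : S ⥤ᵖ X} (τ : F ⟶ G) (D : X ⥤ᵖ K) : F.comp D ⟶ G.comp D where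
  app a := D.map (τ.app a)
  naturality {a b} f := (D.mapComp (F.map f) (τ.app b)).symm ≪≫ D.map₂Iso (τ.naturality f) ≪≫
    D.mapComp (τ.app a) (G.map f)
  naturality_naturality {a b f g} η := by
    have h := congrArg D.map₂ (τ.naturality_naturality η)
    simp only [D.map₂_comp, D.map₂_whisker_right, D.map₂_whisker_left, Category.assoc] at h
    change D.map₂ (F.map₂ η) ▷ D.map (τ.app b) ≫ (D.mapComp (F.map g) (τ.app b)).inv ≫
        D.map₂ (τ.naturality g).hom ≫ (D.mapComp (τ.app a) (G.map g)).hom =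
      ((D.mapComp (F.map f) (τ.app b)).inv ≫ D.map₂ (τ.naturality f).hom ≫
        (D.mapComp (τ.app a) (G.map f)).hom) ≫ D.map (τ.app a) ◁ D.map₂ (G.map₂ η)
    rw [← cancel_epi (D.mapComp (F.map f) (τ.app b)).hom, reassoc_of% h]
    simp
  naturality_id a := by
    have h := congrArg D.map₂ (τ.naturality_id a)
    simp only [D.map₂_comp, D.map₂_whisker_right, D.map₂_whisker_left, D.map₂_left_unitor,
      map₂_ρ_inv, Category.assoc] at h
    change ((D.mapComp (F.map (𝟙 a)) (τ.app a)).inv ≫ D.map₂ (τ.naturality (𝟙 a)).hom ≫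
        (D.mapComp (τ.app a) (G.map (𝟙 a))).hom) ≫
        D.map (τ.app a) ◁ (D.map₂ (G.mapId a).hom ≫ (D.mapId (G.obj a)).hom) =
      (D.map₂ (F.mapId a).hom ≫ (D.mapId (F.obj a)).hom) ▷ D.map (τ.app a) ≫
        (λ_ (D.map (τ.app a))).hom ≫ (ρ_ (D.map (τ.app a))).inv
    rw [← cancel_epi (D.mapComp (F.map (𝟙 a)) (τ.app a)).hom]
    have h' := h =≫ ((D.mapComp (τ.app a) (𝟙 (G.obj a))).hom ≫
      D.map (τ.app a) ◁ (D.mapId (G.obj a)).hom)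
    simp only [Category.assoc, Iso.inv_hom_id_assoc] at h'
    simp only [Category.assoc, Iso.hom_inv_id_assoc, whiskerLeft_comp, comp_whiskerRight]
    rw [h']
    simp
  naturality_comp {a b c} f g := by
    have h := congrArg D.map₂ (τ.naturality_comp f g)
    simp only [D.map₂_comp, D.map₂_whisker_right, D.map₂_whisker_left, D.map₂_associator,
      map₂_α_inv, Category.assoc] at h
    change ((D.mapComp (F.map (f ≫ g)) (τ.app c)).inv ≫ D.map₂ (τ.naturality (f ≫ g)).hom ≫
        (D.mapComp (τ.app a) (G.map (f ≫ g))).hom) ≫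
        D.map (τ.app a) ◁ (D.map₂ (G.mapComp f g).hom ≫ (D.mapComp (G.map f) (G.map g)).hom) =
      (D.map₂ (F.mapComp f g).hom ≫ (D.mapComp (F.map f) (F.map g)).hom) ▷ D.map (τ.app c) ≫
        (α_ _ _ _).hom ≫
        D.map (F.map f) ◁ ((D.mapComp (F.map g) (τ.app c)).inv ≫ D.map₂ (τ.naturality g).hom ≫
          (D.mapComp (τ.app b) (G.map g)).hom) ≫ (α_ _ _ _).inv ≫
        ((D.mapComp (F.map f) (τ.app b)).inv ≫ D.map₂ (τ.naturality f).hom ≫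
          (D.mapComp (τ.app a) (G.map f)).hom) ▷ D.map (G.map g) ≫ (α_ _ _ _).hom
    rw [← cancel_epi (D.mapComp (F.map (f ≫ g)) (τ.app c)).hom]
    have h' := h =≫ ((D.mapComp (τ.app a) (G.map f ≫ G.map g)).hom ≫
      D.map (τ.app a) ◁ (D.mapComp (G.map f) (G.map g)).hom)
    simp only [Category.assoc, Iso.inv_hom_id_assoc] at h'
    simp only [Category.assoc, Iso.hom_inv_id_assoc, whiskerLeft_comp, comp_whiskerRight]
    rw [h']
    simp

/-- Postcomposition with `D : X → K`, as a pseudofunctor `[S, X]_PS → [S, K]_PS`. -/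
def postcompPF (S : Type u₁) [Bicategory.{w₁, v₁} S] (D : X ⥤ᵖ K) :
    (S ⥤ᵖ X) ⥤ᵖ (S ⥤ᵖ K) where
  obj F := F.comp D
  map τ := whiskerRightST τ D
  map₂ {F G σ τ} Γ := ⟨
    { app := fun a => D.map₂ (Γ.as.app a)
      naturality := fun {a b} f => by
        have h := congrArg D.map₂ (Γ.as.naturality f)
        simp only [D.map₂_comp, D.map₂_whisker_right, D.map₂_whisker_left, Category.assoc] at h
        have h' := h =≫ (D.mapComp (τ.app a) (G.map f)).hom
        simp only [Category.assoc, Iso.inv_hom_id, Category.comp_id] at h'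
        change D.map (F.map f) ◁ D.map₂ (Γ.as.app b) ≫
            ((D.mapComp (F.map f) (τ.app b)).inv ≫ D.map₂ (τ.naturality f).hom ≫
              (D.mapComp (τ.app a) (G.map f)).hom) =
          ((D.mapComp (F.map f) (σ.app b)).inv ≫ D.map₂ (σ.naturality f).hom ≫
              (D.mapComp (σ.app a) (G.map f)).hom) ≫ D.map₂ (Γ.as.app a) ▷ D.map (G.map f)
        rw [← cancel_epi (D.mapComp (F.map f) (σ.app b)).hom, h']
        simp }⟩
  mapId F := Pseudofunctor.StrongTrans.isoMk (fun a => D.mapId (F.obj a)) (by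
    intro a b f
    change D.map (F.map f) ◁ (D.mapId (F.obj b)).hom ≫ (ρ_ (D.map (F.map f))).hom ≫
        (λ_ (D.map (F.map f))).inv =
      ((D.mapComp (F.map f) (𝟙 (F.obj b))).inv ≫ D.map₂ ((ρ_ (F.map f)).hom ≫ (λ_ (F.map f)).inv) ≫
        (D.mapComp (𝟙 (F.obj a)) (F.map f)).hom) ≫ (D.mapId (F.obj a)).hom ▷ D.map (F.map f)
    simp only [D.map₂_comp, D.map₂_right_unitor, Category.assoc]
    have hl : D.map₂ (λ_ (F.map f)).inv = (λ_ (D.map (F.map f))).inv ≫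
        (D.mapId (F.obj a)).inv ▷ D.map (F.map f) ≫ (D.mapComp (𝟙 (F.obj a)) (F.map f)).inv := by
      rw [← cancel_epi (D.map₂ (λ_ (F.map f)).hom), ← D.map₂_comp]
      simp
    rw [hl]
    simp)
  mapComp {F G H} σ τ := Pseudofunctor.StrongTrans.isoMk
    (fun a => D.mapComp (σ.app a) (τ.app a)) (by
    intro a b f
    change D.map (F.map f) ◁ (D.mapComp (σ.app b) (τ.app b)).hom ≫
        (α_ _ _ _).inv ≫
          ((D.mapComp (F.map f) (σ.app b)).inv ≫ D.map₂ (σ.naturality f).hom ≫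
              (D.mapComp (σ.app a) (G.map f)).hom) ▷ D.map (τ.app b) ≫ (α_ _ _ _).hom ≫
          D.map (σ.app a) ◁ ((D.mapComp (G.map f) (τ.app b)).inv ≫ D.map₂ (τ.naturality f).hom ≫
              (D.mapComp (τ.app a) (H.map f)).hom) ≫ (α_ _ _ _).inv =
      ((D.mapComp (F.map f) (σ.app b ≫ τ.app b)).inv ≫
        D.map₂ ((α_ _ _ _).inv ≫ (σ.naturality f).hom ▷ τ.app b ≫ (α_ _ _ _).hom ≫
          σ.app a ◁ (τ.naturality f).hom ≫ (α_ _ _ _).inv) ≫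
        (D.mapComp (σ.app a ≫ τ.app a) (H.map f)).hom) ≫
        (D.mapComp (σ.app a) (τ.app a)).hom ▷ D.map (H.map f)
    simp only [D.map₂_comp, D.map₂_whisker_right, D.map₂_whisker_left, D.map₂_associator,
      map₂_α_inv, Category.assoc]
    simp)
  map₂_id σ := by
    ext a
    exact D.map₂_id _
  map₂_comp Γ Γ' := by
    ext a
    exact D.map₂_comp _ _
  map₂_whisker_left σ _ _ Γ := by
    ext a
    exact D.map₂_whisker_left _ _
  map₂_whisker_right Γ τ := by
    ext a
    exact D.map₂_whisker_right _ _
  map₂_associator σ τ ι := by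
    ext a
    exact D.map₂_associator _ _ _
  map₂_left_unitor σ := by
    ext a
    exact D.map₂_left_unitor _
  map₂_right_unitor σ := by
    ext a
    exact D.map₂_right_unitor _

end Postcomposition

/-- The pseudofunctor `(-, e) : S → S × E`. -/
def sectPF (S : Type u₁) [Bicategory.{w₁, v₁} S] {E : Type u₂} [Bicategory.{w₂, v₂} E] (e : E) :
    S ⥤ᵖ (S × E) where
  obj s := (s, e)
  map f := (f, 𝟙 e)
  map₂ η := (η, 𝟙 (𝟙 e))
  mapId s := Iso.refl _
  mapComp f g := Iso.prod (Iso.refl (f ≫ g)) (λ_ (𝟙 e)).symm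

/-- The pseudofunctor `E → [S, S × E]_PS` that sends `e` to `(-, e)`. -/
def sectionsPF (S : Type u₁) [Bicategory.{w₁, v₁} S] (E : Type u₂) [Bicategory.{w₂, v₂} E] :
    E ⥤ᵖ (S ⥤ᵖ (S × E)) where
  obj e := sectPF S e
  map {e e'} k :=
    { app := fun s => (𝟙 s, k)
      naturality := fun f => Iso.prod (ρ_ f ≪≫ (λ_ f).symm) (λ_ k ≪≫ (ρ_ k).symm)
      naturality_naturality := fun {a b f g} η => by
        refine Prod.ext ?_ ?_
        · change η ▷ 𝟙 b ≫ (ρ_ g).hom ≫ (λ_ g).inv = ((ρ_ f).hom ≫ (λ_ f).inv) ≫ 𝟙 a ◁ η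
          simp
        · change 𝟙 (𝟙 e) ▷ k ≫ (λ_ k).hom ≫ (ρ_ k).inv =
            ((λ_ k).hom ≫ (ρ_ k).inv) ≫ k ◁ 𝟙 (𝟙 e')
          simp
      naturality_id := fun s => by
        refine Prod.ext ?_ ?_
        · change ((ρ_ (𝟙 s)).hom ≫ (λ_ (𝟙 s)).inv) ≫ 𝟙 s ◁ 𝟙 (𝟙 s) =
            𝟙 (𝟙 s) ▷ 𝟙 s ≫ (λ_ (𝟙 s)).hom ≫ (ρ_ (𝟙 s)).inv
          bicategory
        · change ((λ_ k).hom ≫ (ρ_ k).inv) ≫ k ◁ 𝟙 (𝟙 e') =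
            𝟙 (𝟙 e) ▷ k ≫ (λ_ k).hom ≫ (ρ_ k).inv
          bicategory
      naturality_comp := fun {a b c} f g => by
        refine Prod.ext ?_ ?_
        · change ((ρ_ (f ≫ g)).hom ≫ (λ_ (f ≫ g)).inv) ≫ 𝟙 a ◁ 𝟙 (f ≫ g) =
            𝟙 (f ≫ g) ▷ 𝟙 c ≫ (α_ f g (𝟙 c)).hom ≫ f ◁ ((ρ_ g).hom ≫ (λ_ g).inv) ≫
              (α_ f (𝟙 b) g).inv ≫ ((ρ_ f).hom ≫ (λ_ f).inv) ▷ g ≫ (α_ (𝟙 a) f g).hom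
          bicategory
        · change ((λ_ k).hom ≫ (ρ_ k).inv) ≫ k ◁ (λ_ (𝟙 e')).inv =
            (λ_ (𝟙 e)).inv ▷ k ≫ (α_ (𝟙 e) (𝟙 e) k).hom ≫ 𝟙 e ◁ ((λ_ k).hom ≫ (ρ_ k).inv) ≫
              (α_ (𝟙 e) k (𝟙 e')).inv ≫ ((λ_ k).hom ≫ (ρ_ k).inv) ▷ 𝟙 e' ≫
              (α_ k (𝟙 e') (𝟙 e')).hom
          bicategory }
  map₂ {e e' k l} η := ⟨
    { app := fun s => (𝟙 (𝟙 s), η)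
      naturality := fun {a b} f => by
        refine Prod.ext ?_ ?_
        · change f ◁ 𝟙 (𝟙 b) ≫ (ρ_ f).hom ≫ (λ_ f).inv =
            ((ρ_ f).hom ≫ (λ_ f).inv) ≫ 𝟙 (𝟙 a) ▷ f
          bicategory
        · change 𝟙 e ◁ η ≫ (λ_ l).hom ≫ (ρ_ l).inv =
            ((λ_ k).hom ≫ (ρ_ k).inv) ≫ η ▷ 𝟙 e'
          simp }⟩
  mapId e := Pseudofunctor.StrongTrans.isoMk (fun s => Iso.refl _) (by
    intro a b f
    refine Prod.ext ?_ ?_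
    · change f ◁ 𝟙 (𝟙 b) ≫ (ρ_ f).hom ≫ (λ_ f).inv = ((ρ_ f).hom ≫ (λ_ f).inv) ≫ 𝟙 (𝟙 a) ▷ f
      bicategory
    · change 𝟙 e ◁ 𝟙 (𝟙 e) ≫ (ρ_ (𝟙 e)).hom ≫ (λ_ (𝟙 e)).inv =
        ((λ_ (𝟙 e)).hom ≫ (ρ_ (𝟙 e)).inv) ≫ 𝟙 (𝟙 e) ▷ 𝟙 e
      bicategory)
  mapComp {e₀ e₁ e₂} k l := Pseudofunctor.StrongTrans.isoMk
    (fun s => Iso.prod (λ_ (𝟙 s)).symm (Iso.refl (k ≫ l))) (by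
    intro a b f
    refine Prod.ext ?_ ?_
    · change f ◁ (λ_ (𝟙 b)).inv ≫ (α_ f (𝟙 b) (𝟙 b)).inv ≫ ((ρ_ f).hom ≫ (λ_ f).inv) ▷ 𝟙 b ≫
          (α_ (𝟙 a) f (𝟙 b)).hom ≫ 𝟙 a ◁ ((ρ_ f).hom ≫ (λ_ f).inv) ≫ (α_ (𝟙 a) (𝟙 a) f).inv =
        ((ρ_ f).hom ≫ (λ_ f).inv) ≫ (λ_ (𝟙 a)).inv ▷ f
      bicategory
    · change 𝟙 e₀ ◁ 𝟙 (k ≫ l) ≫ (α_ (𝟙 e₀) k l).inv ≫ ((λ_ k).hom ≫ (ρ_ k).inv) ▷ l ≫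
          (α_ k (𝟙 e₁) l).hom ≫ k ◁ ((λ_ l).hom ≫ (ρ_ l).inv) ≫ (α_ k l (𝟙 e₂)).inv =
        ((λ_ (k ≫ l)).hom ≫ (ρ_ (k ≫ l)).inv) ≫ 𝟙 (k ≫ l) ▷ 𝟙 e₂
      bicategory)
  map₂_id _ := by
    ext a
    rfl
  map₂_comp η θ := by
    ext a
    refine Prod.ext ?_ ?_
    · change 𝟙 (𝟙 a) = 𝟙 (𝟙 a) ≫ 𝟙 (𝟙 a)
      simp
    · rfl
  map₂_whisker_left k l m η := by
    ext a
    refine Prod.ext ?_ ?_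
    · change 𝟙 (𝟙 a) = (λ_ (𝟙 a)).inv ≫ 𝟙 a ◁ 𝟙 (𝟙 a) ≫ (λ_ (𝟙 a)).hom
      simp
    · change k ◁ η = 𝟙 (k ≫ l) ≫ k ◁ η ≫ 𝟙 (k ≫ m)
      simp
  map₂_whisker_right {_ _ _ k l} η m := by
    ext a
    refine Prod.ext ?_ ?_
    · change 𝟙 (𝟙 a) = (λ_ (𝟙 a)).inv ≫ 𝟙 (𝟙 a) ▷ 𝟙 a ≫ (λ_ (𝟙 a)).hom
      simp
    · change η ▷ m = 𝟙 (k ≫ m) ≫ η ▷ m ≫ 𝟙 (l ≫ m)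
      simp
  map₂_associator k l m := by
    ext a
    refine Prod.ext ?_ ?_
    · change 𝟙 (𝟙 a) = (λ_ (𝟙 a)).inv ≫ (λ_ (𝟙 a)).inv ▷ 𝟙 a ≫ (α_ (𝟙 a) (𝟙 a) (𝟙 a)).hom ≫
        𝟙 a ◁ (λ_ (𝟙 a)).hom ≫ (λ_ (𝟙 a)).hom
      bicategory
    · change (α_ k l m).hom = 𝟙 ((k ≫ l) ≫ m) ≫ 𝟙 (k ≫ l) ▷ m ≫ (α_ k l m).hom ≫
        k ◁ 𝟙 (l ≫ m) ≫ 𝟙 (k ≫ l ≫ m)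
      simp
  map₂_left_unitor {e _} k := by
    ext a
    refine Prod.ext ?_ ?_
    · change 𝟙 (𝟙 a) = (λ_ (𝟙 a)).inv ≫ 𝟙 (𝟙 a) ▷ 𝟙 a ≫ (λ_ (𝟙 a)).hom
      simp
    · change (λ_ k).hom = 𝟙 (𝟙 e ≫ k) ≫ 𝟙 (𝟙 e) ▷ k ≫ (λ_ k).hom
      simp
  map₂_right_unitor {_ e} k := by
    ext a
    refine Prod.ext ?_ ?_
    · change 𝟙 (𝟙 a) = (λ_ (𝟙 a)).inv ≫ 𝟙 a ◁ 𝟙 (𝟙 a) ≫ (ρ_ (𝟙 a)).hom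
      bicategory
    · change (ρ_ k).hom = 𝟙 (k ≫ 𝟙 e) ≫ k ◁ 𝟙 (𝟙 e) ≫ (ρ_ k).hom
      simp

/-- For `D : S × E → K`, the pseudofunctor `E → [S, K]_PS` that sends `e` to `D(-, e)`. -/
def curryPF {S : Type u₁} [Bicategory.{w₁, v₁} S] {E : Type u₂} [Bicategory.{w₂, v₂} E]
    {K : Type u₃} [Bicategory.{w₃, v₃} K] (D : (S × E) ⥤ᵖ K) : E ⥤ᵖ (S ⥤ᵖ K) :=
  (sectionsPF S E).comp (postcompPF S D)

/-- There is a pseudonatural equivalence `F ≃ G` between `Cat`-valued pseudofunctors: a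
pseudonatural transformation all of whose components are equivalences of categories. -/
def PseudonaturalEquiv {X : Type u₁} [Bicategory.{w₁, v₁} X] (F G : X ⥤ᵖ Cat.{v, u}) : Prop :=
  ∃ τ : F ⟶ G, ∀ x : X, (τ.app x).toFunctor.IsEquivalence

section Weighted

variable {S : Type v} [Bicategory.{v, v} S] {E : Type u₁} [Bicategory.{w₁, v₁} E]
  {K : Type u₂} [Bicategory.{v, v} K]

/-- For a weight `W : S → Cat` and `D : S × E → Cat`, the pseudofunctor
`[S, Cat]_PS(W, D(-, ·)) : E → Cat`, which sends `e` to the category of pseudonatural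
transformations `W ⟶ D(-, e)` and modifications. -/
def psHom (W : S ⥤ᵖ Cat.{v, v}) (D : (S × E) ⥤ᵖ Cat.{v, v}) : E ⥤ᵖ Cat.{v, v} :=
  (curryPF D).comp (homFrom W)

/-- For `D : S × E → K`, the pseudofunctor `(s, (X, e)) ↦ K(X, D(s, e))`. -/
def homInto (D : (S × E) ⥤ᵖ K) : (S × (Kᵒᵖ × E)) ⥤ᵖ Cat.{v, v} :=
  (shuffle S Kᵒᵖ E).comp ((prodPF (Pseudofunctor.id Kᵒᵖ) D).comp (homPF K))

/-- `G e` is the weighted bilimit `{W, D(-, e)}_bi` in `K`, pseudonaturally in the parameter `e`: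
there is an equivalence `K(X, G e) ≃ [S, Cat]_PS(W, K(X, D(-, e)))`, pseudonatural in `X` (which
says that each `G e` is the weighted bilimit) and in `e`. -/
def IsWeightedBilimit (W : S ⥤ᵖ Cat.{v, v}) (D : (S × E) ⥤ᵖ K) (G : E ⥤ᵖ K) : Prop :=
  PseudonaturalEquiv ((prodPF (Pseudofunctor.id Kᵒᵖ) G).comp (homPF K)) (psHom W (homInto D))

/-- For `𝒜 : Sᵒᵖ → K`, the pseudofunctor `K(𝒜 -, -) : S × K → Cat`. -/
def homOut (𝒜 : Sᵒᵖ ⥤ᵖ K) : (S × K) ⥤ᵖ Cat.{v, v} :=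
  (prodPF (leftOpPF 𝒜) (Pseudofunctor.id K)).comp (homPF K)

/-- `L` is the weighted bicolimit `W *_bi 𝒜` in `K`: there is an equivalence
`K(L, X) ≃ [S, Cat]_PS(W, K(𝒜 -, X))`, pseudonatural in `X`. -/
def IsWeightedBicolimit (W : S ⥤ᵖ Cat.{v, v}) (𝒜 : Sᵒᵖ ⥤ᵖ K) (L : K) : Prop :=
  PseudonaturalEquiv (homFrom L) (psHom W (homOut 𝒜))

end Weighted

/-- `R^* = B(-, R -) : Bᵒᵖ × A → Cat`, for `R : A → B`. -/
def upperStar {A : Type u₁} [Bicategory.{w₁, v₁} A] {B : Type u₂} [Bicategory.{w, v} B]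
    (R : A ⥤ᵖ B) : (Bᵒᵖ × A) ⥤ᵖ Cat.{w, v} :=
  (prodPF (Pseudofunctor.id Bᵒᵖ) R).comp (homPF B)

/-- The restriction `|D| : S₀ × A → Cat` of `D : S × A → Cat` can be factorized through `R^*`:
there are a pseudofunctor `D' : S₀ → Bᵒᵖ` and a pseudonatural equivalence
`|D| ≃ R^* ∘ (D' × Id)`. -/
def FactorsThroughStar {S : Type u} [Bicategory.{w₃, v₃} S] {A : Type u₁} [Bicategory.{w₁, v₁} A]
    {B : Type u₂} [Bicategory.{w, v} B] (R : A ⥤ᵖ B) (D : (S × A) ⥤ᵖ Cat.{w, v}) : Prop :=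
  ∃ D' : LocallyDiscrete (Discrete S) ⥤ᵖ Bᵒᵖ,
    PseudonaturalEquiv ((prodPF (discIncl S) (Pseudofunctor.id A)).comp D)
      ((prodPF D' (Pseudofunctor.id A)).comp (upperStar R))

section Biadjunction

variable {A : Type u₁} [Bicategory.{w₁, v₁} A] {B : Type u₂} [Bicategory.{w₂, v₂} B]

section Components

variable {E : B ⥤ᵖ A} {R : A ⥤ᵖ B}

/-- The component `ρ_X : X ⟶ RE X`. -/
abbrev unitApp (η : Pseudofunctor.id B ⟶ E.comp R) (X : B) : X ⟶ R.obj (E.obj X) := η.app X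

/-- The invertible 2-cell `ρ_f : f ≫ ρ_Y ≅ ρ_X ≫ RE f`. -/
abbrev unitNat (η : Pseudofunctor.id B ⟶ E.comp R) {X Y : B} (f : X ⟶ Y) :
    f ≫ unitApp η Y ≅ unitApp η X ≫ R.map (E.map f) := η.naturality f

/-- The component `ε_a : ER a ⟶ a`. -/
abbrev counitApp (θ : R.comp E ⟶ Pseudofunctor.id A) (a : A) : E.obj (R.obj a) ⟶ a := θ.app a

/-- The invertible 2-cell `ε_g : ER g ≫ ε_b ≅ ε_a ≫ g`. -/
abbrev counitNat (θ : R.comp E ⟶ Pseudofunctor.id A) {a b : A} (g : a ⟶ b) :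
    E.map (R.map g) ≫ counitApp θ b ≅ counitApp θ a ≫ g := θ.naturality g

end Components

/-- A biadjunction `E ⊣ R` with unit `ρ : Id ⟶ RE`, counit `ε : ER ⟶ Id` and invertible
modifications `v : id_E ⟹ (εE)(Eρ)` and `w : (Rε)(ρR) ⟹ id_R`, subject to the two coherence
(swallowtail) axioms. -/
structure Biadjunction (E : B ⥤ᵖ A) (R : A ⥤ᵖ B) where
  /-- The unit. -/
  unit : Pseudofunctor.id B ⟶ E.comp R
  /-- The counit. -/
  counit : R.comp E ⟶ Pseudofunctor.id A
  /-- The components of the modification `v : id_E ⟹ (εE)(Eρ)`. -/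
  v (X : B) : 𝟙 (E.obj X) ≅ E.map (unitApp unit X) ≫ counitApp counit (E.obj X)
  /-- The modification axiom for `v`. -/
  v_naturality {X Y : B} (f : X ⟶ Y) :
    E.map f ◁ (v Y).hom ≫ (α_ _ _ _).inv ≫
        (E.mapComp f (unitApp unit Y)).inv ▷ counitApp counit (E.obj Y) ≫
        E.map₂ (unitNat unit f).hom ▷ counitApp counit (E.obj Y) ≫
        (E.mapComp (unitApp unit X) (R.map (E.map f))).hom ▷ counitApp counit (E.obj Y) ≫
        (α_ _ _ _).hom ≫ E.map (unitApp unit X) ◁ (counitNat counit (E.map f)).hom ≫ (α_ _ _ _).inv =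
      (ρ_ (E.map f)).hom ≫ (λ_ (E.map f)).inv ≫ (v X).hom ▷ E.map f
  /-- The components of the modification `w : (Rε)(ρR) ⟹ id_R`. -/
  w (a : A) : unitApp unit (R.obj a) ≫ R.map (counitApp counit a) ≅ 𝟙 (R.obj a)
  /-- The modification axiom for `w`. -/
  w_naturality {a b : A} (g : a ⟶ b) :
    R.map g ◁ (w b).hom ≫ (ρ_ (R.map g)).hom ≫ (λ_ (R.map g)).inv =
      (α_ _ _ _).inv ≫ (unitNat unit (R.map g)).hom ▷ R.map (counitApp counit b) ≫ (α_ _ _ _).hom ≫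
        unitApp unit (R.obj a) ◁ ((R.mapComp (E.map (R.map g)) (counitApp counit b)).inv ≫
          R.map₂ (counitNat counit g).hom ≫ (R.mapComp (counitApp counit a) g).hom) ≫
        (α_ _ _ _).inv ≫ (w a).hom ▷ R.map g
  /-- The first coherence axiom: the pasting of `v_X`, `ρ_{ρ_X}` and `w_{E X}` is the identity of
  the component `ρ_X`. -/
  coherence_unit (X : B) :
    (ρ_ (unitApp unit X)).inv ≫
        unitApp unit X ◁ ((R.mapId (E.obj X)).inv ≫ R.map₂ (v X).hom ≫
          (R.mapComp (E.map (unitApp unit X)) (counitApp counit (E.obj X))).hom) ≫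
        (α_ _ _ _).inv ≫
        (unitNat unit (unitApp unit X)).inv ▷ R.map (counitApp counit (E.obj X)) ≫
        (α_ _ _ _).hom ≫ unitApp unit X ◁ (w (E.obj X)).hom ≫ (ρ_ (unitApp unit X)).hom =
      𝟙 (unitApp unit X)
  /-- The second coherence axiom: the pasting of `v_{R a}`, `ε_{ε_a}` and `w_a` is the identity of
  the component `ε_a`. -/
  coherence_counit (a : A) :
    (λ_ (counitApp counit a)).inv ≫ (v (R.obj a)).hom ▷ counitApp counit a ≫ (α_ _ _ _).hom ≫
        E.map (unitApp unit (R.obj a)) ◁ (counitNat counit (counitApp counit a)).inv ≫ (α_ _ _ _).inv ≫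
        ((E.mapComp (unitApp unit (R.obj a)) (R.map (counitApp counit a))).inv ≫ E.map₂ (w a).hom ≫
          (E.mapId (R.obj a)).hom) ▷ counitApp counit a ≫ (λ_ (counitApp counit a)).hom =
      𝟙 (counitApp counit a)

/-- `R` is right biadjoint: it has a left biadjoint. -/
def IsRightBiadjoint (R : A ⥤ᵖ B) : Prop := ∃ E : B ⥤ᵖ A, Nonempty (Biadjunction E R)

end Biadjunction

end BiTri

open BiTri

/-!
A biadjunction is the same thing as a biuniversal arrow `η y : y ⟶ R (L y)` for every object `y`,
and biuniversal arrows are birepresentations: they are the universal elements of `C(y, R -)`.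
Everything else compares universal elements of `Cat`-valued pseudofunctors.

If `E` is left biadjoint to `R`, then `D_y(s, J -) ≃ B(D'_y s, R -) ≃ A(E (D'_y s), -)`, so each
`D_y(s, J -)` has a universal element, and a choice of these makes their representing objects into a
pseudofunctor `𝒜_y` on `Sᵒᵖ`.

Evaluating the bilimit hypothesis at the terminal category and using `D_y(-, J -) ≃ A(𝒜_y -, -)`,
the categories `C(y, V J a)` and `[S, Cat](W, A(𝒜_y -, a))` become equivalent, naturally in `a` up
to isomorphism. No coherence in `a` is needed to transport universal elements, and those of the
second family are the bicolimits of `𝒜_y` weighted by `W`.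
-/

namespace BiTri

section CatValued

variable {B : Type u₁} [Bicategory.{w₁, v₁} B]

/-- The action of a 1-cell on a `Cat`-valued pseudofunctor, as a functor. -/
abbrev act (F : B ⥤ᵖ Cat.{v, u}) {a b : B} (f : a ⟶ b) : F.obj a ⥤ F.obj b := (F.map f).toFunctor

/-- The action of a 2-cell on a `Cat`-valued pseudofunctor, at an element. -/
abbrev act₂ (F : B ⥤ᵖ Cat.{v, u}) {a b : B} {f g : a ⟶ b} (α : f ⟶ g) (x : F.obj a) :
    (act F f).obj x ⟶ (act F g).obj x := (F.map₂ α).toNatTrans.app x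

/-- The unit constraint of a `Cat`-valued pseudofunctor, at an element. -/
def actId (F : B ⥤ᵖ Cat.{v, u}) (a : B) (x : F.obj a) : (act F (𝟙 a)).obj x ≅ x :=
  (Cat.Hom.toNatIso (F.mapId a)).app x

/-- The composition constraint of a `Cat`-valued pseudofunctor, at an element. -/
def actComp (F : B ⥤ᵖ Cat.{v, u}) {a b c : B} (f : a ⟶ b) (g : b ⟶ c) (x : F.obj a) :
    (act F (f ≫ g)).obj x ≅ (act F g).obj ((act F f).obj x) :=
  (Cat.Hom.toNatIso (F.mapComp f g)).app x

/-- The naturality constraint of a pseudonatural transformation of `Cat`-valued pseudofunctors, at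
an element. -/
def natAt {F G : B ⥤ᵖ Cat.{v, u}} (τ : F ⟶ G) {a b : B} (f : a ⟶ b) (x : F.obj a) :
    (τ.app b).toFunctor.obj ((act F f).obj x) ≅ (act G f).obj ((τ.app a).toFunctor.obj x) :=
  (Cat.Hom.toNatIso (τ.naturality f)).app x

section Laws

variable (F : B ⥤ᵖ Cat.{v, u}) {a b c d : B}

@[simp]
theorem act₂_id (f : a ⟶ b) (x : F.obj a) : act₂ F (𝟙 f) x = 𝟙 _ := by
  simp [act₂]

theorem act₂_comp {f g h : a ⟶ b} (α : f ⟶ g) (β : g ⟶ h) (x : F.obj a) :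
    act₂ F (α ≫ β) x = act₂ F α x ≫ act₂ F β x := by
  simp [act₂]

theorem act₂_naturality {f g : a ⟶ b} (α : f ⟶ g) {x y : F.obj a} (φ : x ⟶ y) :
    (act F f).map φ ≫ act₂ F α y = act₂ F α x ≫ (act F g).map φ :=
  (F.map₂ α).toNatTrans.naturality φ

theorem actId_naturality {x y : F.obj a} (φ : x ⟶ y) :
    (act F (𝟙 a)).map φ ≫ (actId F a y).hom = (actId F a x).hom ≫ φ :=
  (F.mapId a).hom.toNatTrans.naturality φ

theorem actComp_naturality (f : a ⟶ b) (g : b ⟶ c) {x y : F.obj a} (φ : x ⟶ y) :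
    (act F (f ≫ g)).map φ ≫ (actComp F f g y).hom =
      (actComp F f g x).hom ≫ (act F g).map ((act F f).map φ) :=
  (F.mapComp f g).hom.toNatTrans.naturality φ

theorem actComp_whiskerLeft (f : a ⟶ b) {g g' : b ⟶ c} (β : g ⟶ g') (x : F.obj a) :
    act₂ F (f ◁ β) x ≫ (actComp F f g' x).hom =
      (actComp F f g x).hom ≫ act₂ F β ((act F f).obj x) := by
  have e : F.map₂ (f ◁ β) ≫ (F.mapComp f g').hom = (F.mapComp f g).hom ≫ F.map f ◁ F.map₂ β := by
    simp
  exact congr(($e).toNatTrans.app x)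

theorem actComp_whiskerRight {f f' : a ⟶ b} (α : f ⟶ f') (g : b ⟶ c) (x : F.obj a) :
    act₂ F (α ▷ g) x ≫ (actComp F f' g x).hom =
      (actComp F f g x).hom ≫ (act F g).map (act₂ F α x) := by
  have e : F.map₂ (α ▷ g) ≫ (F.mapComp f' g).hom = (F.mapComp f g).hom ≫ F.map₂ α ▷ F.map g := by
    simp
  exact congr(($e).toNatTrans.app x)

theorem actComp_associator (f : a ⟶ b) (g : b ⟶ c) (h : c ⟶ d) (x : F.obj a) :
    act₂ F (α_ f g h).hom x ≫ (actComp F f (g ≫ h) x).hom ≫ (actComp F g h ((act F f).obj x)).hom =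
      (actComp F (f ≫ g) h x).hom ≫ (act F h).map (actComp F f g x).hom := by
  have e : F.map₂ (α_ f g h).hom ≫ (F.mapComp f (g ≫ h)).hom ≫ F.map f ◁ (F.mapComp g h).hom =
    (F.mapComp (f ≫ g) h).hom ≫ (F.mapComp f g).hom ▷ F.map h ≫ (α_ _ _ _).hom := by
    simp
  have e' := congr(($e).toNatTrans.app x)
  exact e'.trans (congrArg ((actComp F (f ≫ g) h x).hom ≫ ·) (Category.comp_id _))

theorem actComp_rightUnitor (f : a ⟶ b) (x : F.obj a) :
    (actComp F f (𝟙 b) x).hom ≫ (actId F b ((act F f).obj x)).hom = act₂ F (ρ_ f).hom x := by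
  have e := F.map₂_right_unitor f
  have e' := congr(($e).toNatTrans.app x)
  exact (e'.trans (congrArg ((actComp F f (𝟙 b) x).hom ≫ ·) (Category.comp_id _))).symm

variable {F} {G : B ⥤ᵖ Cat.{v, u}} (τ : F ⟶ G)

theorem natAt_naturality (f : a ⟶ b) {x y : F.obj a} (φ : x ⟶ y) :
    (τ.app b).toFunctor.map ((act F f).map φ) ≫ (natAt τ f y).hom =
      (natAt τ f x).hom ≫ (act G f).map ((τ.app a).toFunctor.map φ) :=
  (τ.naturality f).hom.toNatTrans.naturality φ

theorem natAt_map₂ {f g : a ⟶ b} (α : f ⟶ g) (x : F.obj a) :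
    (τ.app b).toFunctor.map (act₂ F α x) ≫ (natAt τ g x).hom =
      (natAt τ f x).hom ≫ act₂ G α ((τ.app a).toFunctor.obj x) := by
  have e := τ.naturality_naturality α
  exact congr(($e).toNatTrans.app x)

theorem natAt_id (a : B) (x : F.obj a) :
    (natAt τ (𝟙 a) x).hom ≫ (actId G a ((τ.app a).toFunctor.obj x)).hom =
      (τ.app a).toFunctor.map (actId F a x).hom := by
  have e := τ.naturality_id a
  have e' := congr(($e).toNatTrans.app x)
  refine e'.trans ?_
  change (τ.app a).toFunctor.map (actId F a x).hom ≫ 𝟙 _ ≫ 𝟙 _ = _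
  rw [Category.comp_id, Category.comp_id]

theorem natAt_comp (f : a ⟶ b) (g : b ⟶ c) (x : F.obj a) :
    (natAt τ (f ≫ g) x).hom ≫ (actComp G f g ((τ.app a).toFunctor.obj x)).hom =
      (τ.app c).toFunctor.map (actComp F f g x).hom ≫ (natAt τ g ((act F f).obj x)).hom ≫
        (act G g).map (natAt τ f x).hom := by
  have e := τ.naturality_comp f g
  have e' := congr(($e).toNatTrans.app x)
  refine e'.trans ?_
  change (τ.app c).toFunctor.map (actComp F f g x).hom ≫ 𝟙 _ ≫
    (natAt τ g ((act F f).obj x)).hom ≫ 𝟙 _ ≫ (act G g).map (natAt τ f x).hom ≫ 𝟙 _ = _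
  simp only [Category.comp_id, Category.id_comp]

end Laws

/-- A pseudonatural transformation of `Cat`-valued pseudofunctors, from elementwise data. -/
def transOfElements {F G : B ⥤ᵖ Cat.{v, u}} (app : ∀ a, F.obj a ⥤ G.obj a)
    (nat : ∀ {a b : B} (f : a ⟶ b) (x : F.obj a),
      (app b).obj ((act F f).obj x) ≅ (act G f).obj ((app a).obj x))
    (nat_naturality : ∀ {a b : B} (f : a ⟶ b) {x y : F.obj a} (φ : x ⟶ y),
      (app b).map ((act F f).map φ) ≫ (nat f y).hom =
        (nat f x).hom ≫ (act G f).map ((app a).map φ))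
    (nat_map₂ : ∀ {a b : B} {f g : a ⟶ b} (α : f ⟶ g) (x : F.obj a),
      (app b).map (act₂ F α x) ≫ (nat g x).hom = (nat f x).hom ≫ act₂ G α ((app a).obj x))
    (nat_id : ∀ (a : B) (x : F.obj a),
      (nat (𝟙 a) x).hom ≫ (actId G a ((app a).obj x)).hom = (app a).map (actId F a x).hom)
    (nat_comp : ∀ {a b c : B} (f : a ⟶ b) (g : b ⟶ c) (x : F.obj a),
      (nat (f ≫ g) x).hom ≫ (actComp G f g ((app a).obj x)).hom =
        (app c).map (actComp F f g x).hom ≫ (nat g ((act F f).obj x)).hom ≫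
          (act G g).map (nat f x).hom) : F ⟶ G where
  app a := (app a).toCatHom
  naturality {a b} f := Cat.Hom.isoMk (F := (act F f) ⋙ app b) (G := app a ⋙ act G f)
    (NatIso.ofComponents (fun x => nat f x) (fun φ => nat_naturality f φ))
  naturality_naturality {a b f g} α :=
    Cat.Hom₂.ext (NatTrans.ext (funext fun x => nat_map₂ α x))
  naturality_id a := by
    refine Cat.Hom₂.ext (NatTrans.ext (funext fun x => (nat_id a x).trans ?_))
    change _ = (app a).map (actId F a x).hom ≫ 𝟙 _ ≫ 𝟙 _
    rw [Category.comp_id, Category.comp_id]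
  naturality_comp {a b c} f g := by
    refine Cat.Hom₂.ext (NatTrans.ext (funext fun x => (nat_comp f g x).trans ?_))
    change _ = (app c).map (actComp F f g x).hom ≫ 𝟙 _ ≫ (nat g ((act F f).obj x)).hom ≫ 𝟙 _ ≫
      (act G g).map (nat f x).hom ≫ 𝟙 _
    simp only [Category.comp_id, Category.id_comp]

section Modifications

variable {F G H : B ⥤ᵖ Cat.{v, u}} {σ τ : F ⟶ G}

/-- The component of a modification between pseudonatural transformations of `Cat`-valued
pseudofunctors, at an element. -/
abbrev modAt (Γ : σ ⟶ τ) (a : B) (x : F.obj a) :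
    (σ.app a).toFunctor.obj x ⟶ (τ.app a).toFunctor.obj x :=
  (Γ.as.app a).toNatTrans.app x

theorem modAt_naturality (Γ : σ ⟶ τ) (a : B) {x y : F.obj a} (φ : x ⟶ y) :
    (σ.app a).toFunctor.map φ ≫ modAt Γ a y = modAt Γ a x ≫ (τ.app a).toFunctor.map φ :=
  (Γ.as.app a).toNatTrans.naturality φ

theorem modAt_natAt (Γ : σ ⟶ τ) {a b : B} (f : a ⟶ b) (x : F.obj a) :
    modAt Γ b ((act F f).obj x) ≫ (natAt τ f x).hom =
      (natAt σ f x).hom ≫ (act G f).map (modAt Γ a x) :=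
  congr(($(Γ.as.naturality f)).toNatTrans.app x)

theorem mod_ext {Γ Γ' : σ ⟶ τ} (e : ∀ a x, modAt Γ a x = modAt Γ' a x) : Γ = Γ' :=
  Pseudofunctor.StrongTrans.homCategory.ext fun a =>
    Cat.Hom₂.ext (NatTrans.ext (funext (e a)))

/-- A modification between pseudonatural transformations of `Cat`-valued pseudofunctors, from
elementwise data. -/
def modOfElements (φ : ∀ a (x : F.obj a), (σ.app a).toFunctor.obj x ⟶ (τ.app a).toFunctor.obj x)
    (naturality : ∀ a {x y : F.obj a} (p : x ⟶ y),
      (σ.app a).toFunctor.map p ≫ φ a y = φ a x ≫ (τ.app a).toFunctor.map p)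
    (natAt_comm : ∀ {a b : B} (f : a ⟶ b) (x : F.obj a),
      φ b ((act F f).obj x) ≫ (natAt τ f x).hom =
        (natAt σ f x).hom ≫ (act G f).map (φ a x)) : σ ⟶ τ :=
  ⟨⟨fun a => ⟨{ app := φ a, naturality := fun _ _ p => naturality a p }⟩,
    fun f => Cat.Hom₂.ext (NatTrans.ext (funext fun x => natAt_comm f x))⟩⟩

/-- An invertible modification between pseudonatural transformations of `Cat`-valued
pseudofunctors, from elementwise data. -/
def isoOfElements (φ : ∀ a (x : F.obj a), (σ.app a).toFunctor.obj x ≅ (τ.app a).toFunctor.obj x)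
    (naturality : ∀ a {x y : F.obj a} (p : x ⟶ y),
      (σ.app a).toFunctor.map p ≫ (φ a y).hom = (φ a x).hom ≫ (τ.app a).toFunctor.map p)
    (natAt_comm : ∀ {a b : B} (f : a ⟶ b) (x : F.obj a),
      (φ b ((act F f).obj x)).hom ≫ (natAt τ f x).hom =
        (natAt σ f x).hom ≫ (act G f).map (φ a x).hom) : σ ≅ τ :=
  Pseudofunctor.StrongTrans.isoMk
    (fun a => Cat.Hom.isoMk (NatIso.ofComponents (φ a) (naturality a)))
    (fun f => Cat.Hom₂.ext (NatTrans.ext (funext fun x => natAt_comm f x)))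

theorem natAt_idTrans {a b : B} (f : a ⟶ b) (x : F.obj a) :
    (natAt (𝟙 F) f x).hom = 𝟙 _ := by
  change 𝟙 _ ≫ 𝟙 _ = 𝟙 _
  simp

theorem natAt_trans (σ : F ⟶ G) (τ : G ⟶ H) {a b : B} (f : a ⟶ b) (x : F.obj a) :
    (natAt (σ ≫ τ) f x).hom = (τ.app b).toFunctor.map (natAt σ f x).hom ≫
      (natAt τ f ((σ.app a).toFunctor.obj x)).hom := by
  change 𝟙 _ ≫ (τ.app b).toFunctor.map (natAt σ f x).hom ≫ 𝟙 _ ≫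
      (natAt τ f ((σ.app a).toFunctor.obj x)).hom ≫ 𝟙 _ = _
  simp only [Category.id_comp, Category.comp_id]

/-- The version of `isoOfElements` for composite transformations. -/
def compIsoOfElements {G' : B ⥤ᵖ Cat.{v, u}} {σ : F ⟶ G} {τ : G ⟶ H} {σ' : F ⟶ G'} {τ' : G' ⟶ H}
    (φ : ∀ a (x : F.obj a), (τ.app a).toFunctor.obj ((σ.app a).toFunctor.obj x) ≅
      (τ'.app a).toFunctor.obj ((σ'.app a).toFunctor.obj x))
    (naturality : ∀ a {x y : F.obj a} (p : x ⟶ y),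
      (τ.app a).toFunctor.map ((σ.app a).toFunctor.map p) ≫ (φ a y).hom =
        (φ a x).hom ≫ (τ'.app a).toFunctor.map ((σ'.app a).toFunctor.map p))
    (natAt_comm : ∀ {a b : B} (f : a ⟶ b) (x : F.obj a),
      (φ b ((act F f).obj x)).hom ≫ (τ'.app b).toFunctor.map (natAt σ' f x).hom ≫
          (natAt τ' f ((σ'.app a).toFunctor.obj x)).hom =
        ((τ.app b).toFunctor.map (natAt σ f x).hom ≫
          (natAt τ f ((σ.app a).toFunctor.obj x)).hom) ≫ (act H f).map (φ a x).hom) :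
    σ ≫ τ ≅ σ' ≫ τ' :=
  isoOfElements φ naturality (fun f x => by
    rw [natAt_trans, natAt_trans]
    exact natAt_comm f x)

end Modifications

section Inverse

variable {F G : B ⥤ᵖ Cat.{v, u}} (τ : F ⟶ G) (h : ∀ x, (τ.app x).toFunctor.IsEquivalence)

/-- The components of a pseudonatural equivalence, as equivalences of categories. -/
noncomputable def appEquivalence (a : B) : CategoryTheory.Equivalence (F.obj a) (G.obj a) :=
  haveI := h a
  (τ.app a).toFunctor.asEquivalence

/-- The components of the inverse of a pseudonatural equivalence. -/
noncomputable def inverseApp (a : B) : G.obj a ⥤ F.obj a := (appEquivalence τ h a).inverse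

/-- The counit of the components of a pseudonatural equivalence. -/
noncomputable def inverseCounit (a : B) (x : G.obj a) :
    (τ.app a).toFunctor.obj ((inverseApp τ h a).obj x) ≅ x :=
  (appEquivalence τ h a).counitIso.app x

theorem inverseCounit_naturality {a : B} {x y : G.obj a} (φ : x ⟶ y) :
    (τ.app a).toFunctor.map ((inverseApp τ h a).map φ) ≫ (inverseCounit τ h a y).hom =
      (inverseCounit τ h a x).hom ≫ φ :=
  (appEquivalence τ h a).counitIso.hom.naturality φ

/-- The naturality constraint of the inverse of a pseudonatural equivalence. -/
noncomputable def inverseNat {a b : B} (f : a ⟶ b) (x : G.obj a) :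
    (inverseApp τ h b).obj ((act G f).obj x) ≅ (act F f).obj ((inverseApp τ h a).obj x) :=
  haveI := h b
  (τ.app b).toFunctor.preimageIso (inverseCounit τ h b _ ≪≫
    (act G f).mapIso (inverseCounit τ h a x).symm ≪≫ (natAt τ f ((inverseApp τ h a).obj x)).symm)

theorem map_inverseNat {a b : B} (f : a ⟶ b) (x : G.obj a) :
    (τ.app b).toFunctor.map (inverseNat τ h f x).hom ≫
      (natAt τ f ((inverseApp τ h a).obj x)).hom ≫ (act G f).map (inverseCounit τ h a x).hom =
      (inverseCounit τ h b _).hom := by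
  simp [inverseNat, ← Functor.map_comp]

include h in
theorem inverse_hom_ext {a b : B} {f : a ⟶ b} {x : G.obj a} {y : F.obj b}
    {φ ψ : y ⟶ (act F f).obj ((inverseApp τ h a).obj x)}
    (e : (τ.app b).toFunctor.map φ ≫
      (natAt τ f ((inverseApp τ h a).obj x)).hom ≫ (act G f).map (inverseCounit τ h a x).hom =
      (τ.app b).toFunctor.map ψ ≫
      (natAt τ f ((inverseApp τ h a).obj x)).hom ≫ (act G f).map (inverseCounit τ h a x).hom) :
    φ = ψ :=
  haveI := h b
  (τ.app b).toFunctor.map_injective ((cancel_mono _).1 e)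

/-- The inverse of a pseudonatural equivalence. -/
noncomputable def inverseTrans : G ⟶ F :=
  transOfElements (inverseApp τ h) (inverseNat τ h)
    (fun f x y φ => by
      apply inverse_hom_ext
      simp only [Functor.map_comp, Category.assoc, map_inverseNat, inverseCounit_naturality,
        reassoc_of% @natAt_naturality]
      simp only [← Functor.map_comp, inverseCounit_naturality]
      simp only [Functor.map_comp, reassoc_of% @map_inverseNat])
    (fun {a b f g} α x => by
      apply inverse_hom_ext
      simp only [Functor.map_comp, Category.assoc, map_inverseNat, inverseCounit_naturality,
        reassoc_of% @natAt_map₂]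
      rw [← act₂_naturality, reassoc_of% @map_inverseNat])
    (fun a x => by
      have := h a
      apply (τ.app a).toFunctor.map_injective
      rw [← cancel_mono (inverseCounit τ h a x).hom, inverseCounit_naturality, Functor.map_comp,
        ← natAt_id, Category.assoc, Category.assoc, ← actId_naturality,
        reassoc_of% @map_inverseNat])
    (fun {a b c} f g x => by
      have := h c
      apply (τ.app c).toFunctor.map_injective
      rw [← cancel_mono (natAt τ g _).hom, ← cancel_mono ((act G g).map (natAt τ f _).hom),
        ← cancel_mono ((act G g).map ((act G f).map (inverseCounit τ h a x).hom))]
      simp only [Functor.map_comp, Category.assoc]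
      rw [← reassoc_of% @natAt_comp, ← actComp_naturality, reassoc_of% @map_inverseNat,
        reassoc_of% @natAt_naturality]
      simp only [← Functor.map_comp]
      rw [map_inverseNat, map_inverseNat, inverseCounit_naturality])

theorem inverseTrans_isEquivalence (a : B) : ((inverseTrans τ h).app a).toFunctor.IsEquivalence :=
  (appEquivalence τ h a).isEquivalence_inverse

/-- The composite of a pseudonatural equivalence after its inverse is the identity, up to an
invertible modification. -/
noncomputable def inverseTransComp : inverseTrans τ h ≫ τ ≅ 𝟙 G :=
  isoOfElements (fun a x => inverseCounit τ h a x)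
    (fun _ _ _ φ => inverseCounit_naturality τ h φ)
    (fun f x => by
      refine (congrArg _ (natAt_idTrans f x)).trans ((Category.comp_id _).trans ?_)
      refine Eq.trans ?_ (congrArg (· ≫ _) (natAt_trans (inverseTrans τ h) τ f x)).symm
      exact (map_inverseNat τ h f x).symm.trans (Category.assoc _ _ _).symm)

end Inverse

section Postcomposition

variable {F G : B ⥤ᵖ Cat.{v, u}} (W : B ⥤ᵖ Cat.{v, u}) (τ : F ⟶ G)

theorem postcomp_faithful (h : ∀ a, (τ.app a).toFunctor.Faithful) : (postcomp W τ).Faithful where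
  map_injective {_ _} _ _ e := mod_ext fun a x =>
    (h a).map_injective (congr((modAt $e a x)))

theorem postcomp_full (hfaithful : ∀ a, (τ.app a).toFunctor.Faithful)
    (hfull : ∀ a, (τ.app a).toFunctor.Full) : (postcomp W τ).Full where
  map_surjective {σ σ'} (Γ : σ ≫ τ ⟶ σ' ≫ τ) := by
    have lift (a : B) (x : W.obj a) : ∃ φ : (σ.app a).toFunctor.obj x ⟶ (σ'.app a).toFunctor.obj x,
        (τ.app a).toFunctor.map φ = modAt Γ a x := (hfull a).map_surjective _
    choose φ hφ using lift
    refine ⟨modOfElements φ (fun a x y p => (τ.app a).toFunctor.map_injective ?_)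
      (fun {a b} f x => (τ.app b).toFunctor.map_injective ?_), mod_ext hφ⟩
    · rw [Functor.map_comp, Functor.map_comp, hφ, hφ]
      exact modAt_naturality Γ a p
    · have e := modAt_natAt Γ f x
      rw [natAt_trans, natAt_trans] at e
      rw [← cancel_mono (natAt τ f _).hom]
      simp only [Functor.map_comp, Category.assoc, natAt_naturality, hφ]
      exact (Category.assoc _ _ _).trans (e.trans (Category.assoc _ _ _))

theorem postcomp_isEquivalence (h : ∀ a, (τ.app a).toFunctor.IsEquivalence) :
    (postcomp W τ).IsEquivalence where
  faithful := postcomp_faithful W τ fun a => (h a).faithful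
  full := postcomp_full W τ (fun a => (h a).faithful) (fun a => (h a).full)
  essSurj := ⟨fun σ => ⟨σ ≫ inverseTrans τ h,
    ⟨α_ _ _ _ ≪≫ whiskerLeftIso σ (inverseTransComp τ h) ≪≫ ρ_ σ⟩⟩⟩

end Postcomposition

end CatValued

section UniversalElements

variable {A : Type u₁} [Bicategory.{w₁, v₁} A] {F G : A ⥤ᵖ Cat.{v, u}}

/-- For an element `x : F l`, the functor `f ↦ F f x` from `A(l, a)` to `F a`. -/
def evalAt (F : A ⥤ᵖ Cat.{v, u}) {l : A} (x : F.obj l) (a : A) : (l ⟶ a) ⥤ F.obj a where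
  obj f := (act F f).obj x
  map α := act₂ F α x
  map_id f := act₂_id F f x
  map_comp α β := act₂_comp F α β x

/-- An element `x : F l` is universal (in the bicategorical sense) if `f ↦ F f x` is an equivalence
`A(l, a) ≃ F a` for each `a`. -/
def IsUniversalElement (F : A ⥤ᵖ Cat.{v, u}) {l : A} (x : F.obj l) : Prop :=
  ∀ a, (evalAt F x a).IsEquivalence

namespace IsUniversalElement

section API

variable {l : A} {x : F.obj l} (h : IsUniversalElement F x) {a : A}
include h

theorem hom_ext {f g : l ⟶ a} {α β : f ⟶ g} (e : act₂ F α x = act₂ F β x) : α = β :=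
  haveI := h a
  (evalAt F x a).map_injective e

/-- The 1-cell out of the object carrying a universal element that corresponds to an element. -/
noncomputable def desc (y : F.obj a) : l ⟶ a :=
  haveI := h a
  (evalAt F x a).objPreimage y

/-- The defining isomorphism of `IsUniversalElement.desc`. -/
noncomputable def fac (y : F.obj a) : (act F (h.desc y)).obj x ≅ y :=
  haveI := h a
  (evalAt F x a).objObjPreimageIso y

/-- The 2-cell that corresponds to a morphism between values of a universal element. -/
noncomputable def lift {f g : l ⟶ a} (θ : (act F f).obj x ⟶ (act F g).obj x) : f ⟶ g :=
  haveI := h a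
  (evalAt F x a).preimage θ

theorem act₂_lift {f g : l ⟶ a} (θ : (act F f).obj x ⟶ (act F g).obj x) :
    act₂ F (h.lift θ) x = θ :=
  haveI := h a
  (evalAt F x a).map_preimage θ

/-- The invertible 2-cell that corresponds to an isomorphism between values of a universal
element. -/
noncomputable def liftIso {f g : l ⟶ a} (θ : (act F f).obj x ≅ (act F g).obj x) : f ≅ g :=
  haveI := h a
  (evalAt F x a).preimageIso θ

theorem act₂_liftIso_hom {f g : l ⟶ a} (θ : (act F f).obj x ≅ (act F g).obj x) :
    act₂ F (h.liftIso θ).hom x = θ.hom :=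
  haveI := h a
  (evalAt F x a).map_preimage θ.hom

end API

end IsUniversalElement

theorem isEquivalence_iff_of_comp_iso {X Y Z : Type*} [Category* X] [Category* Y] [Category* Z]
    {P : X ⥤ Y} {E : Y ⥤ Z} [E.IsEquivalence] {Q : X ⥤ Z} (i : P ⋙ E ≅ Q) :
    P.IsEquivalence ↔ Q.IsEquivalence :=
  ⟨fun _ => Functor.isEquivalence_of_iso i, fun _ =>
    haveI : (P ⋙ E).IsEquivalence := Functor.isEquivalence_of_iso i.symm
    Functor.isEquivalence_of_comp_right P E⟩

/-- Pseudonatural transformations commute with evaluation at an element. -/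
def evalAtCompIso (τ : F ⟶ G) {l : A} (x : F.obj l) (a : A) :
    evalAt F x a ⋙ (τ.app a).toFunctor ≅ evalAt G ((τ.app l).toFunctor.obj x) a :=
  NatIso.ofComponents (fun f => natAt τ f x) (fun α => natAt_map₂ τ α x)

theorem IsUniversalElement.of_iso {l : A} {x y : F.obj l} (i : x ≅ y)
    (h : IsUniversalElement F x) : IsUniversalElement F y := fun a =>
  haveI := h a
  Functor.isEquivalence_of_iso (F := evalAt F x a)
    (NatIso.ofComponents (fun f => (act F f).mapIso i) (fun α => (act₂_naturality F α i.hom).symm))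

theorem isUniversalElement_iff_of_trans (τ : F ⟶ G) (h : ∀ a, (τ.app a).toFunctor.IsEquivalence)
    {l : A} (x : F.obj l) :
    IsUniversalElement F x ↔ IsUniversalElement G ((τ.app l).toFunctor.obj x) :=
  forall_congr' fun a =>
    haveI := h a
    isEquivalence_iff_of_comp_iso (evalAtCompIso τ x a)

theorem isUniversalElement_id (l : A) : IsUniversalElement (homFrom l) (𝟙 l) := fun a =>
  Functor.isEquivalence_of_iso (F := 𝟭 (l ⟶ a))
    (NatIso.ofComponents (fun f => (λ_ f).symm) (fun α => leftUnitor_inv_naturality α))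

end UniversalElements

section Representability

variable {A : Type u₁} [Bicategory.{w, v} A] {F : A ⥤ᵖ Cat.{w, v}}

/-- The pseudonatural transformation `A(l, -) ⟶ F` determined by an element of `F l`. -/
def evalTrans {l : A} (x : F.obj l) : homFrom l ⟶ F :=
  transOfElements (evalAt F x) (fun f g => actComp F g f x)
    (fun {a b} f g g' φ => actComp_whiskerRight F φ f x)
    (fun {a b f g} α k => actComp_whiskerLeft F k α x)
    (fun a g => actComp_rightUnitor F g x)
    (fun {a b c} f g (k : l ⟶ a) => by
      change (actComp F k (f ≫ g) x).hom ≫ (actComp F f g ((act F k).obj x)).hom =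
        act₂ F (α_ k f g).inv x ≫ (actComp F (k ≫ f) g x).hom ≫ (act F g).map (actComp F k f x).hom
      rw [← actComp_associator, ← reassoc_of% @act₂_comp, Iso.inv_hom_id, act₂_id,
        Category.id_comp])

theorem pseudonaturalEquiv_homFrom_iff (l : A) :
    PseudonaturalEquiv (homFrom l) F ↔ ∃ x : F.obj l, IsUniversalElement F x :=
  ⟨fun ⟨τ, h⟩ => ⟨_, (isUniversalElement_iff_of_trans τ h (𝟙 l)).1 (isUniversalElement_id l)⟩,
    fun ⟨x, hx⟩ => ⟨evalTrans x, hx⟩⟩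

end Representability

section Whiskering

variable {B : Type u₁} [Bicategory.{w₁, v₁} B] (F : B ⥤ᵖ Cat.{v, u})

/-- The whiskering of a morphism `F k x ⟶ F l y` with a 1-cell. -/
def whiskerAct {p p' q r : B} {k : p ⟶ q} {l : p' ⟶ q} {x : F.obj p} {y : F.obj p'}
    (φ : (act F k).obj x ⟶ (act F l).obj y) (g : q ⟶ r) :
    (act F (k ≫ g)).obj x ⟶ (act F (l ≫ g)).obj y :=
  (actComp F k g x).hom ≫ (act F g).map φ ≫ (actComp F l g y).inv

/-- The isomorphism `F k x ≅ F l x` induced by an invertible 2-cell. -/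
@[simps]
def act₂Iso {p q : B} {k l : p ⟶ q} (α : k ≅ l) (x : F.obj p) :
    (act F k).obj x ≅ (act F l).obj x where
  hom := act₂ F α.hom x
  inv := act₂ F α.inv x
  hom_inv_id := by rw [← act₂_comp, Iso.hom_inv_id, act₂_id]
  inv_hom_id := by rw [← act₂_comp, Iso.inv_hom_id, act₂_id]

section

variable {F} {p p' p'' q r t : B} {k : p ⟶ q} {l : p' ⟶ q} {m : p'' ⟶ q} {x : F.obj p}
  {y : F.obj p'} {z : F.obj p''}

theorem whiskerAct_comp (φ : (act F k).obj x ⟶ (act F l).obj y)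
    (ψ : (act F l).obj y ⟶ (act F m).obj z) (g : q ⟶ r) :
    whiskerAct F (φ ≫ ψ) g = whiskerAct F φ g ≫ whiskerAct F ψ g := by
  simp [whiskerAct]

theorem whiskerAct_act₂ {k k' : p ⟶ q} (α : k ⟶ k') (g : q ⟶ r) :
    whiskerAct F (act₂ F α x) g = act₂ F (α ▷ g) x := by
  rw [whiskerAct, ← reassoc_of% @actComp_whiskerRight, Iso.hom_inv_id, Category.comp_id]

theorem whiskerAct_naturality (φ : (act F k).obj x ⟶ (act F l).obj y) {g g' : q ⟶ r} (β : g ⟶ g') :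
    act₂ F (k ◁ β) x ≫ whiskerAct F φ g' = whiskerAct F φ g ≫ act₂ F (l ◁ β) y := by
  rw [whiskerAct, reassoc_of% @actComp_whiskerLeft, ← reassoc_of% @act₂_naturality, whiskerAct,
    Category.assoc, Category.assoc]
  congr 2
  rw [Iso.eq_inv_comp, ← reassoc_of% @actComp_whiskerLeft, Iso.hom_inv_id, Category.comp_id]

theorem whiskerAct_congr (φ : (act F k).obj x ⟶ (act F l).obj y) {g g' : q ⟶ r} (β : g ≅ g') :
    whiskerAct F φ g = act₂ F (k ◁ β.hom) x ≫ whiskerAct F φ g' ≫ act₂ F (l ◁ β.inv) y := by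
  rw [reassoc_of% @whiskerAct_naturality, ← act₂_comp, ← whiskerLeft_comp, Iso.hom_inv_id,
    whiskerLeft_id, act₂_id, Category.comp_id]

theorem whiskerAct_whiskerAct (φ : (act F k).obj x ⟶ (act F l).obj y) (g : q ⟶ r) (h : r ⟶ t) :
    whiskerAct F (whiskerAct F φ g) h =
      act₂ F (α_ k g h).hom x ≫ whiskerAct F φ (g ≫ h) ≫ act₂ F (α_ l g h).inv y := by
  rw [← cancel_mono (act₂Iso F (α_ l g h) y).hom,
    ← cancel_mono (actComp F l (g ≫ h) y).hom, ← cancel_mono (actComp F g h _).hom]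
  simp only [Category.assoc, act₂Iso_hom]
  rw [← reassoc_of% @act₂_comp, Iso.inv_hom_id, act₂_id, Category.id_comp, actComp_associator]
  simp only [whiskerAct, Category.assoc, Functor.map_comp, Iso.inv_hom_id_assoc]
  rw [actComp_naturality, reassoc_of% @actComp_associator]
  simp [← Functor.map_comp]

theorem whiskerAct_id (φ : (act F k).obj x ⟶ (act F l).obj y) :
    whiskerAct F φ (𝟙 q) = act₂ F (ρ_ k).hom x ≫ φ ≫ act₂ F (ρ_ l).inv y := by
  rw [← cancel_mono (act₂Iso F (ρ_ l) y).hom]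
  simp only [Category.assoc, act₂Iso_hom]
  rw [← act₂_comp, Iso.inv_hom_id, act₂_id, Category.comp_id, ← actComp_rightUnitor,
    ← actComp_rightUnitor, Category.assoc, ← actId_naturality]
  simp [whiskerAct]

theorem whiskerAct_actComp (φ : (act F k).obj x ⟶ (act F l).obj y) (g : q ⟶ r) :
    whiskerAct F φ g ≫ (actComp F l g y).hom = (actComp F k g x).hom ≫ (act F g).map φ := by
  simp [whiskerAct]

/-- The whiskering of an isomorphism `F k x ≅ F l y` with a 1-cell. -/
def whiskerActIso (φ : (act F k).obj x ≅ (act F l).obj y) (g : q ⟶ r) :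
    (act F (k ≫ g)).obj x ≅ (act F (l ≫ g)).obj y where
  hom := whiskerAct F φ.hom g
  inv := whiskerAct F φ.inv g
  hom_inv_id := by simp [whiskerAct]
  inv_hom_id := by simp [whiskerAct]

end

end Whiskering

section Squares

variable {S : Type u₁} [Bicategory.{w₁, v₁} S] {A : Type u₂} [Bicategory.{w₂, v₂} A]

/-- The 1-cell `(𝟙, f)` of a product. -/
abbrev sectR (s : S) {a b : A} (f : a ⟶ b) : (s, a) ⟶ (s, b) := (𝟙 s, f)

/-- The 1-cell `(u, 𝟙)` of a product. -/
abbrev sectL {s t : S} (u : s ⟶ t) (a : A) : (s, a) ⟶ (t, a) := (u, 𝟙 a)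

/-- The 2-cell `(𝟙, α)` of a product. -/
abbrev sectR₂ (s : S) {a b : A} {f g : a ⟶ b} (α : f ⟶ g) : sectR s f ⟶ sectR s g := (𝟙 (𝟙 s), α)

/-- The 2-cell `(θ, 𝟙)` of a product. -/
abbrev sectL₂ {s t : S} {u u' : s ⟶ t} (θ : u ⟶ u') (a : A) : sectL u a ⟶ sectL u' a :=
  (θ, 𝟙 (𝟙 a))

/-- `(𝟙, f ≫ g) ≅ (𝟙, f) ≫ (𝟙, g)`. -/
def sectRComp (s : S) {a b c : A} (f : a ⟶ b) (g : b ⟶ c) :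
    sectR s (f ≫ g) ≅ sectR s f ≫ sectR s g :=
  Iso.prod (λ_ (𝟙 s)).symm (Iso.refl _)

/-- `(u ≫ v, 𝟙) ≅ (u, 𝟙) ≫ (v, 𝟙)`. -/
def sectLComp {s t r : S} (u : s ⟶ t) (v : t ⟶ r) (a : A) :
    sectL (u ≫ v) a ≅ sectL u a ≫ sectL v a :=
  Iso.prod (Iso.refl _) (λ_ (𝟙 a)).symm

/-- `(u, 𝟙) ≫ (𝟙, f) ≅ (𝟙, f) ≫ (u, 𝟙)`. -/
def exchangeIso {s t : S} (u : s ⟶ t) {a b : A} (f : a ⟶ b) :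
    sectL u a ≫ sectR t f ≅ sectR s f ≫ sectL u b :=
  Iso.prod (ρ_ u ≪≫ (λ_ u).symm) (λ_ f ≪≫ (ρ_ f).symm)

variable (F : (S × A) ⥤ᵖ Cat.{v, u})

/-- A square over `u` and `f`: a morphism `F (𝟙, f) y ⟶ F (u, 𝟙) x`. -/
abbrev SquareOver {s t : S} (u : s ⟶ t) {b a : A} (f : b ⟶ a) (y : F.obj (t, b))
    (x : F.obj (s, a)) :=
  (act F (sectR t f)).obj y ⟶ (act F (sectL u a)).obj x

variable {F} {s t r q : S} {a b c d : A} {u : s ⟶ t} {v : t ⟶ r} {w : r ⟶ q} {f : b ⟶ a}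
  {g : c ⟶ b} {h : d ⟶ c} {x : F.obj (s, a)} {y : F.obj (t, b)} {z : F.obj (r, c)}
  {z' : F.obj (q, d)}

namespace SquareOver

/-- The composition of squares. -/
def comp (ψ : SquareOver F v g z y) (φ : SquareOver F u f y x) :
    SquareOver F (u ≫ v) (g ≫ f) z x :=
  act₂ F (sectRComp r g f).hom z ≫ whiskerAct F ψ (sectR r f) ≫ act₂ F (exchangeIso v f).hom y ≫
    whiskerAct F φ (sectL v a) ≫ act₂ F (sectLComp u v a).inv x

/-- The composition of invertible squares. -/
def compIso (ψ : (act F (sectR r g)).obj z ≅ (act F (sectL v b)).obj y)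
    (φ : (act F (sectR t f)).obj y ≅ (act F (sectL u a)).obj x) :
    (act F (sectR r (g ≫ f))).obj z ≅ (act F (sectL (u ≫ v) a)).obj x :=
  act₂Iso F (sectRComp r g f) z ≪≫ whiskerActIso ψ (sectR r f) ≪≫ act₂Iso F (exchangeIso v f) y ≪≫
    whiskerActIso φ (sectL v a) ≪≫ act₂Iso F (sectLComp u v a).symm x

theorem compIso_hom (ψ : (act F (sectR r g)).obj z ≅ (act F (sectL v b)).obj y)
    (φ : (act F (sectR t f)).obj y ≅ (act F (sectL u a)).obj x) :
    (compIso ψ φ).hom = comp ψ.hom φ.hom := rfl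

theorem comp_whiskerRight {g' : c ⟶ b} (γ : g' ⟶ g) (ψ : SquareOver F v g z y)
    (φ : SquareOver F u f y x) :
    comp (act₂ F (sectR₂ r γ) z ≫ ψ) φ = act₂ F (sectR₂ r (γ ▷ f)) z ≫ comp ψ φ := by
  rw [comp, comp, whiskerAct_comp, whiskerAct_act₂, Category.assoc,
    ← reassoc_of% @act₂_comp, ← reassoc_of% @act₂_comp]
  congr 2
  refine Prod.ext ?_ ?_ <;> simp [sectRComp]

theorem comp_whiskerLeft {f' : b ⟶ a} (β : f' ⟶ f) (ψ : SquareOver F v g z y)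
    (φ : SquareOver F u f y x) :
    comp ψ (act₂ F (sectR₂ t β) y ≫ φ) = act₂ F (sectR₂ r (g ◁ β)) z ≫ comp ψ φ := by
  rw [comp, comp, whiskerAct_comp, whiskerAct_act₂, Category.assoc,
    ← reassoc_of% @act₂_comp, ← reassoc_of% @act₂_comp]
  have e₁ : sectR₂ r (g ◁ β) ≫ (sectRComp r g f).hom =
      (sectRComp r g f').hom ≫ sectR r g ◁ sectR₂ r β := by
    refine Prod.ext ?_ ?_ <;> simp [sectRComp]
  have e₂ : (exchangeIso v f').hom ≫ sectR₂ t β ▷ sectL v a =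
      sectL v b ◁ sectR₂ r β ≫ (exchangeIso v f).hom := by
    refine Prod.ext ?_ ?_ <;> simp [exchangeIso]
  rw [e₁, e₂, reassoc_of% @act₂_comp, reassoc_of% @act₂_comp, reassoc_of% @whiskerAct_naturality]

theorem comp_whiskerLeft₂ {v' : t ⟶ r} (θ : v ⟶ v') (ψ : SquareOver F v g z y)
    (φ : SquareOver F u f y x) :
    comp (ψ ≫ act₂ F (sectL₂ θ b) y) φ = comp ψ φ ≫ act₂ F (sectL₂ (u ◁ θ) a) x := by
  rw [comp, comp, whiskerAct_comp, whiskerAct_act₂]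
  simp only [Category.assoc]
  rw [← reassoc_of% @act₂_comp, ← act₂_comp]
  have e₁ : sectL₂ θ b ▷ sectR r f ≫ (exchangeIso v' f).hom =
      (exchangeIso v f).hom ≫ sectR t f ◁ sectL₂ θ a := by
    refine Prod.ext ?_ ?_ <;> simp [exchangeIso]
  have e₂ : (sectLComp u v a).inv ≫ sectL₂ (u ◁ θ) a =
      sectL u a ◁ sectL₂ θ a ≫ (sectLComp u v' a).inv := by
    refine Prod.ext ?_ ?_ <;> simp [sectLComp]
  rw [e₁, e₂, reassoc_of% @act₂_comp, act₂_comp, reassoc_of% @whiskerAct_naturality]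

theorem comp_whiskerRight₂ {u' : s ⟶ t} (θ : u ⟶ u') (ψ : SquareOver F v g z y)
    (φ : SquareOver F u f y x) :
    comp ψ (φ ≫ act₂ F (sectL₂ θ a) x) = comp ψ φ ≫ act₂ F (sectL₂ (θ ▷ v) a) x := by
  rw [comp, comp, whiskerAct_comp, whiskerAct_act₂]
  simp only [Category.assoc]
  rw [← act₂_comp, ← act₂_comp]
  congr 5
  refine Prod.ext ?_ ?_ <;> simp [sectLComp]

theorem comp_id_left (φ : SquareOver F u f y x) :
    comp (g := 𝟙 b) (v := 𝟙 t) (z := y) (𝟙 _) φ =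
      act₂ F (sectR₂ t (λ_ f).hom) y ≫ φ ≫ act₂ F (sectL₂ (ρ_ u).inv a) x := by
  rw [comp, ← act₂_id, whiskerAct_act₂]
  have e := whiskerAct_id φ
  change whiskerAct F φ (sectL (𝟙 t) a) = _ at e
  rw [e]
  simp only [Category.assoc]
  rw [← reassoc_of% @act₂_comp, ← reassoc_of% @act₂_comp, ← reassoc_of% @act₂_comp, ← act₂_comp]
  congr 2
  · refine Prod.ext ?_ ?_ <;> simp [sectRComp, exchangeIso]
  · congr 2
    refine Prod.ext ?_ ?_ <;> simp [sectLComp]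

theorem comp_id_right (ψ : SquareOver F v g z y) :
    comp (u := 𝟙 t) (f := 𝟙 b) (x := y) ψ (𝟙 _) =
      act₂ F (sectR₂ r (ρ_ g).hom) z ≫ ψ ≫ act₂ F (sectL₂ (λ_ v).inv b) y := by
  have e := whiskerAct_id ψ
  change whiskerAct F ψ (sectR r (𝟙 b)) = _ at e
  rw [comp, e, ← act₂_id, whiskerAct_act₂]
  simp only [Category.assoc]
  rw [← reassoc_of% @act₂_comp, ← reassoc_of% @act₂_comp, ← reassoc_of% @act₂_comp, ← act₂_comp]
  congr 2
  · refine Prod.ext ?_ ?_ <;> simp [sectRComp]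
  · congr 2
    refine Prod.ext ?_ ?_ <;> simp [sectLComp, exchangeIso]

theorem comp_assoc (χ : SquareOver F w h z' z) (ψ : SquareOver F v g z y)
    (φ : SquareOver F u f y x) :
    comp (comp χ ψ) φ =
      act₂ F (sectR₂ q (α_ h g f).hom) z' ≫ comp χ (comp ψ φ) ≫
        act₂ F (sectL₂ (α_ u v w).hom a) x := by
  rw [comp, comp, comp, comp]
  simp only [whiskerAct_comp, whiskerAct_act₂, whiskerAct_whiskerAct, Category.assoc]
  rw [whiskerAct_congr χ (sectRComp q g f), whiskerAct_congr φ (sectLComp v w a),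
    whiskerAct_congr ψ (exchangeIso w f)]
  simp only [Category.assoc]
  simp only [← reassoc_of% @act₂_comp]
  rw [← act₂_comp, ← act₂_comp]
  refine congrArg₂ (· ≫ ·) (congrArg (act₂ F · z') ?_) (congrArg (_ ≫ ·) (congrArg₂ (· ≫ ·)
    (congrArg (act₂ F · z) ?_) (congrArg (_ ≫ ·) (congrArg₂ (· ≫ ·) (congrArg (act₂ F · y) ?_)
    (congrArg (_ ≫ ·) (congrArg (act₂ F · x) ?_))))))
  all_goals refine Prod.ext ?_ ?_ <;> simp [sectRComp, sectLComp, exchangeIso]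

end SquareOver

end Squares

section Sections

variable {S : Type u₁} [Bicategory.{w₁, v₁} S] {A : Type u₂} [Bicategory.{w₂, v₂} A]

/-- The pseudofunctor `(s, -) : A → S × A`. -/
def sectRightPF (s : S) (A : Type u₂) [Bicategory.{w₂, v₂} A] : A ⥤ᵖ (S × A) where
  obj a := (s, a)
  map f := sectR s f
  map₂ α := sectR₂ s α
  mapId _ := Iso.refl _
  mapComp f g := Iso.prod (λ_ (𝟙 s)).symm (Iso.refl (f ≫ g))

variable {F : (S × A) ⥤ᵖ Cat.{v, u}}

theorem act₂_sectR₂_comp {s : S} {a b : A} (x : F.obj (s, a)) {f g h : a ⟶ b} (α : f ⟶ g)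
    (β : g ⟶ h) :
    act₂ F (sectR₂ s (α ≫ β)) x = act₂ F (sectR₂ s α) x ≫ act₂ F (sectR₂ s β) x := by
  rw [← act₂_comp]
  exact congrArg (act₂ F · x) (Prod.ext (Category.comp_id (𝟙 (𝟙 s))).symm rfl)

theorem act₂_sectL₂_comp {s t : S} {a : A} (x : F.obj (s, a)) {u v w : s ⟶ t} (α : u ⟶ v)
    (β : v ⟶ w) :
    act₂ F (sectL₂ (α ≫ β) a) x = act₂ F (sectL₂ α a) x ≫ act₂ F (sectL₂ β a) x := by
  rw [← act₂_comp]
  exact congrArg (act₂ F · x) (Prod.ext rfl (Category.comp_id (𝟙 (𝟙 a))).symm)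

theorem act₂_sectL₂_id {s t : S} {a : A} (x : F.obj (s, a)) (u : s ⟶ t) :
    act₂ F (sectL₂ (𝟙 u) a) x = 𝟙 _ := act₂_id F (sectL u a) x

end Sections

section Parametrized

variable {S : Type u₁} [Bicategory.{w₁, v₁} S] {A : Type u₂} [Bicategory.{w₂, v₂} A]
  {F : (S × A) ⥤ᵖ Cat.{v, u}} {L : S → A} {x : ∀ s, F.obj (s, L s)}
  (h : ∀ s, IsUniversalElement ((sectRightPF s A).comp F) (x s))

namespace birepresenting

include h in
theorem hom_ext {s : S} {a : A} {f g : L s ⟶ a} {α β : f ⟶ g}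
    (e : act₂ F (sectR₂ s α) (x s) = act₂ F (sectR₂ s β) (x s)) : α = β :=
  (h s).hom_ext e

/-- The 1-cell `L t ⟶ L s` induced by `u : s ⟶ t` on birepresenting objects. -/
noncomputable def map {s t : S} (u : s ⟶ t) : L t ⟶ L s :=
  (h t).desc ((act F (sectL u (L s))).obj (x s))

/-- The invertible square that characterizes `birepresenting.map`. -/
noncomputable def square {s t : S} (u : s ⟶ t) :
    (act F (sectR t (map h u))).obj (x t) ≅ (act F (sectL u (L s))).obj (x s) :=
  (h t).fac ((act F (sectL u (L s))).obj (x s))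

/-- The 2-cell induced on birepresenting objects by a 2-cell of `S`. -/
noncomputable def map₂ {s t : S} {u u' : s ⟶ t} (θ : u ⟶ u') : map h u ⟶ map h u' :=
  (h t).lift ((square h u).hom ≫ act₂ F (sectL₂ θ (L s)) (x s) ≫ (square h u').inv)

theorem map₂_fac {s t : S} {u u' : s ⟶ t} (θ : u ⟶ u') :
    act₂ F (sectR₂ t (map₂ h θ)) (x t) ≫ (square h u').hom =
      (square h u).hom ≫ act₂ F (sectL₂ θ (L s)) (x s) := by
  rw [← Iso.eq_comp_inv, Category.assoc]
  exact (h t).act₂_lift _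

/-- The unit constraint of `birepresenting`. -/
noncomputable def mapId (s : S) : map h (𝟙 s) ≅ 𝟙 (L s) :=
  (h s).liftIso (square h (𝟙 s))

theorem mapId_fac (s : S) :
    act₂ F (sectR₂ s (mapId h s).hom) (x s) = (square h (𝟙 s)).hom :=
  (h s).act₂_liftIso_hom (square h (𝟙 s))

/-- The composition constraint of `birepresenting`. -/
noncomputable def mapComp {s t r : S} (u : s ⟶ t) (v : t ⟶ r) :
    map h (u ≫ v) ≅ map h v ≫ map h u :=
  (h r).liftIso (square h (u ≫ v) ≪≫ (SquareOver.compIso (square h v) (square h u)).symm)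

theorem mapComp_fac {s t r : S} (u : s ⟶ t) (v : t ⟶ r) :
    act₂ F (sectR₂ r (mapComp h u v).hom) (x r) ≫
        SquareOver.comp (square h v).hom (square h u).hom =
      (square h (u ≫ v)).hom := by
  rw [← SquareOver.compIso_hom, ← Iso.eq_comp_inv]
  exact (h r).act₂_liftIso_hom _

theorem map₂_id {s t : S} (u : s ⟶ t) : map₂ h (𝟙 u) = 𝟙 _ := by
  apply hom_ext h
  rw [← cancel_mono (square h u).hom, map₂_fac, act₂_sectL₂_id, Category.comp_id]
  have e : act₂ F (sectR₂ t (𝟙 (map h u))) (x t) = 𝟙 _ := act₂_id _ _ _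
  rw [e, Category.id_comp]

theorem map₂_comp {s t : S} {u u' u'' : s ⟶ t} (θ : u ⟶ u') (θ' : u' ⟶ u'') :
    map₂ h (θ ≫ θ') = map₂ h θ ≫ map₂ h θ' := by
  apply hom_ext h
  rw [← cancel_mono (square h u'').hom, map₂_fac, act₂_sectR₂_comp, Category.assoc, map₂_fac,
    reassoc_of% @map₂_fac, act₂_sectL₂_comp]

theorem map₂_whiskerRight {s t r : S} {u u' : s ⟶ t} (θ : u ⟶ u') (v : t ⟶ r) :
    map₂ h (θ ▷ v) ≫ (mapComp h u' v).hom =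
      (mapComp h u v).hom ≫ map h v ◁ map₂ h θ := by
  apply hom_ext h
  rw [← cancel_mono (SquareOver.compIso (square h v) (square h u')).hom, SquareOver.compIso_hom,
    act₂_sectR₂_comp, act₂_sectR₂_comp, Category.assoc, Category.assoc, mapComp_fac, map₂_fac,
    ← SquareOver.comp_whiskerLeft, map₂_fac, SquareOver.comp_whiskerRight₂,
    reassoc_of% @mapComp_fac]

theorem map₂_whiskerLeft {s t r : S} (u : s ⟶ t) {v v' : t ⟶ r} (θ : v ⟶ v') :
    map₂ h (u ◁ θ) ≫ (mapComp h u v').hom =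
      (mapComp h u v).hom ≫ map₂ h θ ▷ map h u := by
  apply hom_ext h
  rw [← cancel_mono (SquareOver.compIso (square h v') (square h u)).hom, SquareOver.compIso_hom,
    act₂_sectR₂_comp, act₂_sectR₂_comp, Category.assoc, Category.assoc, mapComp_fac, map₂_fac,
    ← SquareOver.comp_whiskerRight, map₂_fac, SquareOver.comp_whiskerLeft₂,
    reassoc_of% @mapComp_fac]

theorem map₂_associator {s t r q : S} (u : s ⟶ t) (v : t ⟶ r) (w : r ⟶ q) :
    map₂ h (α_ u v w).inv ≫ (mapComp h (u ≫ v) w).hom ≫ map h w ◁ (mapComp h u v).hom =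
      (mapComp h u (v ≫ w)).hom ≫ (mapComp h v w).hom ▷ map h u ≫ (α_ _ _ _).hom := by
  apply hom_ext h
  rw [← cancel_mono
      (SquareOver.compIso (square h w) (SquareOver.compIso (square h v) (square h u))).hom,
    SquareOver.compIso_hom, SquareOver.compIso_hom]
  simp only [act₂_sectR₂_comp, Category.assoc]
  have e : act₂ F (sectR₂ q (α_ (map h w) (map h v) (map h u)).hom) (x q) ≫
      SquareOver.comp (square h w).hom (SquareOver.comp (square h v).hom (square h u).hom) =
      SquareOver.comp (SquareOver.comp (square h w).hom (square h v).hom) (square h u).hom ≫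
        act₂ F (sectL₂ (α_ u v w).inv (L s)) (x s) := by
    rw [SquareOver.comp_assoc, Category.assoc, Category.assoc, ← act₂_sectL₂_comp, Iso.hom_inv_id,
      act₂_sectL₂_id, Category.comp_id]
  rw [e, ← SquareOver.comp_whiskerLeft, mapComp_fac, mapComp_fac, map₂_fac,
    ← reassoc_of% @SquareOver.comp_whiskerRight,
    mapComp_fac, reassoc_of% @mapComp_fac]

theorem map₂_rightUnitor {s t : S} (u : s ⟶ t) :
    map₂ h (ρ_ u).hom =
      (mapComp h u (𝟙 t)).hom ≫ (mapId h t).hom ▷ map h u ≫ (λ_ _).hom := by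
  apply hom_ext h
  rw [← cancel_mono (square h u).hom, map₂_fac]
  simp only [act₂_sectR₂_comp, Category.assoc]
  have e : act₂ F (sectR₂ t (λ_ (map h u)).hom) (x t) ≫ (square h u).hom =
      SquareOver.comp (g := 𝟙 (L t)) (v := 𝟙 t) (z := x t) (𝟙 _) (square h u).hom ≫
        act₂ F (sectL₂ (ρ_ u).hom (L s)) (x s) := by
    rw [SquareOver.comp_id_left, Category.assoc, Category.assoc, ← act₂_sectL₂_comp, Iso.inv_hom_id,
      act₂_sectL₂_id, Category.comp_id]
  rw [e, ← reassoc_of% @SquareOver.comp_whiskerRight, Category.comp_id, mapId_fac,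
    reassoc_of% @mapComp_fac]

theorem map₂_leftUnitor {s t : S} (u : s ⟶ t) :
    map₂ h (λ_ u).hom =
      (mapComp h (𝟙 s) u).hom ≫ map h u ◁ (mapId h s).hom ≫ (ρ_ _).hom := by
  apply hom_ext h
  rw [← cancel_mono (square h u).hom, map₂_fac]
  simp only [act₂_sectR₂_comp, Category.assoc]
  have e : act₂ F (sectR₂ t (ρ_ (map h u)).hom) (x t) ≫ (square h u).hom =
      SquareOver.comp (u := 𝟙 s) (f := 𝟙 (L s)) (x := x s) (square h u).hom (𝟙 _) ≫
        act₂ F (sectL₂ (λ_ u).hom (L s)) (x s) := by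
    rw [SquareOver.comp_id_right, Category.assoc, Category.assoc, ← act₂_sectL₂_comp,
      Iso.inv_hom_id, act₂_sectL₂_id, Category.comp_id]
  rw [e, ← reassoc_of% @SquareOver.comp_whiskerLeft, Category.comp_id, mapId_fac,
    reassoc_of% @mapComp_fac]

end birepresenting

open birepresenting in
/-- The pseudofunctor `Sᵒᵖ ⥤ᵖ A` determined by universal elements of the `F (s, -)`. -/
noncomputable def birepresenting : Sᵒᵖ ⥤ᵖ A where
  obj s := L s.unop
  map u := map h u.unop
  map₂ θ := map₂ h θ.unop2
  map₂_id u := map₂_id h u.unop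
  map₂_comp θ θ' := map₂_comp h θ.unop2 θ'.unop2
  mapId s := mapId h s.unop
  mapComp v u := mapComp h u.unop v.unop
  map₂_whisker_left v u u' θ := by
    have e := map₂_whiskerRight h θ.unop2 v.unop
    change map₂ h (θ.unop2 ▷ v.unop) = _
    rw [← Category.assoc, Iso.eq_comp_inv]
    exact e
  map₂_whisker_right {_ _ _ v v'} θ u := by
    have e := map₂_whiskerLeft h u.unop θ.unop2
    change map₂ h (u.unop ◁ θ.unop2) = _
    rw [← Category.assoc, Iso.eq_comp_inv]
    exact e
  map₂_associator w v u := by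
    have e := map₂_associator h u.unop v.unop w.unop
    change map₂ h (α_ u.unop v.unop w.unop).inv = _
    rw [← cancel_mono (mapComp h (u.unop ≫ v.unop) w.unop).hom,
      ← cancel_mono (map h w.unop ◁ (mapComp h u.unop v.unop).hom), Category.assoc, e]
    simp
  map₂_left_unitor u := map₂_rightUnitor h u.unop
  map₂_right_unitor u := map₂_leftUnitor h u.unop

end Parametrized

section Comparison

variable {S : Type v} [Bicategory.{v, v} S] {A : Type u₂} [Bicategory.{v, v} A]
  {F : (S × A) ⥤ᵖ Cat.{v, v}} {L : S → A} {x : ∀ s, F.obj (s, L s)}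
  (h : ∀ s, IsUniversalElement ((sectRightPF s A).comp F) (x s))

namespace birepresenting

/-- The exchange `(u, 𝟙) ≫ (𝟙, k ≫ f) ≅ (𝟙, k) ≫ (u, f)` in `S × A`. -/
def exchangeCompIso {s t : S} (u : s ⟶ t) {l a b : A} (k : l ⟶ a) (f : a ⟶ b) :
    sectL u l ≫ sectR t (k ≫ f) ≅ sectR s k ≫ ((u, f) : (s, a) ⟶ (t, b)) :=
  Iso.prod (ρ_ u ≪≫ (λ_ u).symm) (λ_ (k ≫ f))

/-- The comparison of the actions of `(u, f)` on `A(L s, a)` and on `F (s, a)`, before the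
composite `(𝟙, k) ≫ (u, f)` is split by the composition constraint of `F`. -/
noncomputable def actionIso {s t : S} (u : s ⟶ t) {a b : A} (f : a ⟶ b) (k : L s ⟶ a) :
    (act F (sectR t (map h u ≫ k ≫ f))).obj (x t) ≅
      (act F (sectR s k ≫ ((u, f) : (s, a) ⟶ (t, b)))).obj (x s) :=
  act₂Iso F (sectRComp t (map h u) (k ≫ f)) (x t) ≪≫
    whiskerActIso (square h u) (sectR t (k ≫ f)) ≪≫ act₂Iso F (exchangeCompIso u k f) (x s)

theorem actionIso_hom {s t : S} (u : s ⟶ t) {a b : A} (f : a ⟶ b) (k : L s ⟶ a) :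
    (actionIso h u f k).hom = act₂ F (sectRComp t (map h u) (k ≫ f)).hom (x t) ≫
      whiskerAct F (square h u).hom (sectR t (k ≫ f)) ≫
        act₂ F (exchangeCompIso u k f).hom (x s) := rfl

theorem actionIso_naturality {s t : S} (u : s ⟶ t) {a b : A} (f : a ⟶ b) {k k' : L s ⟶ a}
    (φ : k ⟶ k') :
    act₂ F (sectR₂ t (map h u ◁ φ ▷ f)) (x t) ≫ (actionIso h u f k').hom =
      (actionIso h u f k).hom ≫ act₂ F (sectR₂ s φ ▷ ((u, f) : (s, a) ⟶ (t, b))) (x s) := by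
  simp only [actionIso_hom, Category.assoc]
  rw [← reassoc_of% @act₂_comp, ← act₂_comp]
  have e₁ : sectR₂ t (map h u ◁ φ ▷ f) ≫ (sectRComp t (map h u) (k' ≫ f)).hom =
      (sectRComp t (map h u) (k ≫ f)).hom ≫ sectR t (map h u) ◁ sectR₂ t (φ ▷ f) := by
    refine Prod.ext ?_ ?_ <;> simp [sectRComp]
  have e₂ : (exchangeCompIso u k f).hom ≫ sectR₂ s φ ▷ ((u, f) : (s, a) ⟶ (t, b)) =
      sectL u (L s) ◁ sectR₂ t (φ ▷ f) ≫ (exchangeCompIso u k' f).hom := by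
    refine Prod.ext ?_ ?_ <;> simp [exchangeCompIso]
  rw [e₁, e₂, reassoc_of% @act₂_comp, act₂_comp, reassoc_of% @whiskerAct_naturality]

theorem actionIso_map₂ {s t : S} {u u' : s ⟶ t} (θ : u ⟶ u') {a b : A} {f f' : a ⟶ b}
    (β : f ⟶ f') (k : L s ⟶ a) :
    act₂ F (sectR₂ t (map₂ h θ ▷ (k ≫ f) ≫ map h u' ◁ k ◁ β)) (x t) ≫
        (actionIso h u' f' k).hom =
      (actionIso h u f k).hom ≫
        act₂ F (sectR s k ◁ ((θ, β) : ((u, f) : (s, a) ⟶ (t, b)) ⟶ (u', f'))) (x s) := by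
  simp only [actionIso_hom, Category.assoc]
  rw [← reassoc_of% @act₂_comp, ← act₂_comp]
  have e₁ : sectR₂ t (map₂ h θ ▷ (k ≫ f) ≫ map h u' ◁ k ◁ β) ≫
      (sectRComp t (map h u') (k ≫ f')).hom =
      (sectRComp t (map h u) (k ≫ f)).hom ≫ sectR₂ t (map₂ h θ) ▷ sectR t (k ≫ f) ≫
        sectR t (map h u') ◁ sectR₂ t (k ◁ β) := by
    refine Prod.ext ?_ ?_ <;> simp [sectRComp]
  have e₂ : (exchangeCompIso u k f).hom ≫
      sectR s k ◁ ((θ, β) : ((u, f) : (s, a) ⟶ (t, b)) ⟶ (u', f')) =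
      sectL₂ θ (L s) ▷ sectR t (k ≫ f) ≫ sectL u' (L s) ◁ sectR₂ t (k ◁ β) ≫
        (exchangeCompIso u' k f').hom := by
    refine Prod.ext ?_ ?_ <;> simp [exchangeCompIso]
  rw [e₁, e₂, reassoc_of% @act₂_comp, reassoc_of% @act₂_comp, act₂_comp, act₂_comp,
    reassoc_of% @whiskerAct_naturality,
    ← whiskerAct_act₂, ← whiskerAct_act₂, ← reassoc_of% @whiskerAct_comp, map₂_fac,
    reassoc_of% @whiskerAct_comp]

theorem actionIso_id (s : S) {a : A} (k : L s ⟶ a) :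
    (actionIso h (𝟙 s) (𝟙 a) k).hom ≫ act₂ F (ρ_ (sectR s k)).hom (x s) =
      act₂ F (sectR₂ s ((mapId h s).hom ▷ (k ≫ 𝟙 a) ≫ (λ_ _).hom ≫ (ρ_ k).hom)) (x s) := by
  have e : (square h (𝟙 s)).hom = act₂ F (sectR₂ s (mapId h s).hom) (x s) :=
    (mapId_fac h s).symm
  rw [actionIso_hom, e, whiskerAct_act₂, Category.assoc, Category.assoc, ← act₂_comp, ← act₂_comp,
    ← act₂_comp]
  refine congrArg (act₂ F · (x s)) (Prod.ext ?_ ?_)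
  · simp [sectRComp, exchangeCompIso]
  · simp [sectRComp, exchangeCompIso]

theorem actionIso_comp {s t r : S} (u : s ⟶ t) (v : t ⟶ r) {a b c : A} (f : a ⟶ b) (g : b ⟶ c)
    (k : L s ⟶ a) :
    (actionIso h (u ≫ v) (f ≫ g) k).hom =
      act₂ F (sectR₂ r ((mapComp h u v).hom ▷ (k ≫ f ≫ g) ≫
        (α_ (map h v) (map h u) (k ≫ f ≫ g)).hom ≫
        map h v ◁ (map h u ◁ (α_ k f g).inv ≫ (α_ (map h u) (k ≫ f) g).inv))) (x r) ≫
      (actionIso h v g (map h u ≫ k ≫ f)).hom ≫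
      whiskerAct F (actionIso h u f k).hom ((v, g) : (t, b) ⟶ (r, c)) ≫
      act₂ F (α_ (sectR s k) ((u, f) : (s, a) ⟶ (t, b)) ((v, g) : (t, b) ⟶ (r, c))).hom (x s) := by
  rw [actionIso_hom, actionIso_hom, actionIso_hom, ← mapComp_fac, SquareOver.comp]
  simp only [whiskerAct_comp, whiskerAct_act₂, whiskerAct_whiskerAct, Category.assoc]
  let β : sectR r (map h u) ≫ sectR r (k ≫ f ≫ g) ≅ sectR r ((map h u ≫ k ≫ f) ≫ g) :=
    Iso.prod (λ_ _) (whiskerLeftIso _ (α_ k f g).symm ≪≫ (α_ _ _ _).symm)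
  let γ : sectL v (L s) ≫ sectR r (k ≫ f ≫ g) ≅ sectR t (k ≫ f) ≫ ((v, g) : (t, b) ⟶ (r, c)) :=
    Iso.prod (ρ_ v ≪≫ (λ_ v).symm) (λ_ _ ≪≫ (α_ k f g).symm)
  rw [whiskerAct_congr (square h v).hom β, whiskerAct_congr (square h u).hom γ]
  simp only [Category.assoc, ← reassoc_of% @act₂_comp]
  rw [← act₂_comp, ← act₂_comp]
  refine congrArg₂ (· ≫ ·) (congrArg (act₂ F · (x r)) ?_) (congrArg (_ ≫ ·) (congrArg₂ (· ≫ ·)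
    (congrArg (act₂ F · (x t)) ?_) (congrArg (_ ≫ ·) (congrArg (act₂ F · (x s)) ?_))))
  all_goals
    refine Prod.ext ?_ ?_
    all_goals
      simp only [prod_comp, CategoryTheory.prod_Hom, Iso.prod_hom, Iso.prod_inv, Iso.symm_hom,
        Iso.symm_inv, Iso.trans_hom, Iso.trans_inv, Iso.refl_hom, Iso.refl_inv, whiskerLeftIso_hom,
        whiskerLeftIso_inv, prod_associator_hom_fst, prod_associator_hom_snd,
        prod_associator_inv_fst, prod_associator_inv_snd, prod_whiskerLeft_fst,
        prod_whiskerLeft_snd, prod_whiskerRight_fst, prod_whiskerRight_snd, sectRComp, sectLComp,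
        exchangeIso, exchangeCompIso, β, γ]
      bicategory

/-- The naturality constraint at `f` of the comparison of `A(L -, -)` with `F`. -/
noncomputable def transNatIso {p q : S × A} (f : p ⟶ q) (k : L p.1 ⟶ p.2) :
    (act F (sectR q.1 (map h f.1 ≫ k ≫ f.2))).obj (x q.1) ≅
      (act F f).obj ((act F (sectR p.1 k)).obj (x p.1)) :=
  actionIso h f.1 f.2 k ≪≫ actComp F (sectR p.1 k) f (x p.1)

theorem transNatIso_hom {p q : S × A} (f : p ⟶ q) (k : L p.1 ⟶ p.2) :
    (transNatIso h f k).hom =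
      (actionIso h f.1 f.2 k).hom ≫ (actComp F (sectR p.1 k) f (x p.1)).hom := rfl

theorem transNatIso_naturality {p q : S × A} (f : p ⟶ q) {k k' : L p.1 ⟶ p.2} (φ : k ⟶ k') :
    act₂ F (sectR₂ q.1 (map h f.1 ◁ φ ▷ f.2)) (x q.1) ≫ (transNatIso h f k').hom =
      (transNatIso h f k).hom ≫ (act F f).map (act₂ F (sectR₂ p.1 φ) (x p.1)) := by
  rw [transNatIso_hom, transNatIso_hom, reassoc_of% @actionIso_naturality, Category.assoc,
    ← actComp_whiskerRight]
  rfl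

theorem transNatIso_map₂ {p q : S × A} {f f' : p ⟶ q} (θ : f ⟶ f') (k : L p.1 ⟶ p.2) :
    act₂ F (sectR₂ q.1 (map₂ h θ.1 ▷ (k ≫ f.2) ≫ map h f'.1 ◁ k ◁ θ.2)) (x q.1) ≫
        (transNatIso h f' k).hom =
      (transNatIso h f k).hom ≫ act₂ F θ ((act F (sectR p.1 k)).obj (x p.1)) := by
  rw [transNatIso_hom, transNatIso_hom, Category.assoc, ← actComp_whiskerLeft, ← Category.assoc,
    actionIso_map₂, Category.assoc]
  rfl

theorem transNatIso_id (p : S × A) (k : L p.1 ⟶ p.2) :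
    (transNatIso h (𝟙 p) k).hom ≫ (actId F p ((act F (sectR p.1 k)).obj (x p.1))).hom =
      act₂ F (sectR₂ p.1 (((mapId h p.1).hom ▷ (k ≫ 𝟙 p.2) ≫ 𝟙 (L p.1) ◁ k ◁ 𝟙 (𝟙 p.2)) ≫
        (λ_ (k ≫ 𝟙 p.2)).hom ≫ (ρ_ k).hom)) (x p.1) := by
  rw [transNatIso_hom, Category.assoc, actComp_rightUnitor, whiskerLeft_id, whiskerLeft_id,
    Category.comp_id]
  exact actionIso_id h p.1 k

theorem transNatIso_comp {p q r : S × A} (f : p ⟶ q) (g : q ⟶ r) (k : L p.1 ⟶ p.2) :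
    (transNatIso h (f ≫ g) k).hom ≫
        (actComp F f g ((act F (sectR p.1 k)).obj (x p.1))).hom =
      act₂ F (sectR₂ r.1 (((mapComp h f.1 g.1).hom ▷ (k ≫ f.2 ≫ g.2) ≫
          (map h g.1 ≫ map h f.1) ◁ k ◁ 𝟙 (f.2 ≫ g.2)) ≫
          (α_ (map h g.1) (map h f.1) (k ≫ f.2 ≫ g.2)).hom ≫
          map h g.1 ◁ (map h f.1 ◁ (α_ k f.2 g.2).inv ≫
            (α_ (map h f.1) (k ≫ f.2) g.2).inv))) (x r.1) ≫
        (transNatIso h g (map h f.1 ≫ k ≫ f.2)).hom ≫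
          (act F g).map (transNatIso h f k).hom := by
  have assoc := actComp_associator F (sectR p.1 k) f g (x p.1)
  have naturality := whiskerAct_actComp (actionIso h f.1 f.2 k).hom g
  simp only [transNatIso_hom]
  rw [show (actionIso h (f ≫ g).1 (f ≫ g).2 k).hom = _ from actionIso_comp h f.1 g.1 f.2 g.2 k,
    whiskerLeft_id, whiskerLeft_id, Category.comp_id, Functor.map_comp]
  simp only [Category.assoc]
  rw [← reassoc_of% naturality]
  exact congrArg (_ ≫ ·) (congrArg (_ ≫ ·) (congrArg (_ ≫ ·) assoc))

/-- The comparison of `A(L -, -)` with `F`. -/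
noncomputable def trans : homOut (birepresenting h) ⟶ F :=
  transOfElements (fun p => evalAt ((sectRightPF p.1 A).comp F) (x p.1) p.2)
    (fun f k => transNatIso h f k) (fun f _ _ φ => transNatIso_naturality h f φ)
    (fun θ k => transNatIso_map₂ h θ k) (fun p k => transNatIso_id h p k)
    (fun f g k => transNatIso_comp h f g k)

end birepresenting

theorem exists_pseudonaturalEquiv_homOut (F : (S × A) ⥤ᵖ Cat.{v, v})
    (h : ∀ s, ∃ (l : A) (x : F.obj (s, l)), IsUniversalElement ((sectRightPF s A).comp F) x) :
    ∃ 𝒜 : Sᵒᵖ ⥤ᵖ A, PseudonaturalEquiv F (homOut 𝒜) := by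
  choose L x h using h
  exact ⟨birepresenting h, inverseTrans (birepresenting.trans h) fun p => h p.1 p.2,
    inverseTrans_isEquivalence (birepresenting.trans h) fun p => h p.1 p.2⟩

end Comparison

section BiuniversalArrows

variable {A : Type u₁} [Bicategory.{w₁, v₁} A] {C : Type u₂} [Bicategory.{w₂, v₂} C]

/-- A 1-cell `η : y ⟶ H l` is a biuniversal arrow from `y` to `H` if `f ↦ η ≫ H f` is an equivalence
`A(l, a) ≃ C(y, H a)` for each `a`, that is, if it is a universal element of `C(y, H -)`. -/
def IsBiuniversal (H : A ⥤ᵖ C) {y : C} {l : A} (η : y ⟶ H.obj l) : Prop :=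
  IsUniversalElement (H.comp (homFrom y)) η

namespace IsBiuniversal

variable {H : A ⥤ᵖ C} {y : C} {l : A} {η : y ⟶ H.obj l} (h : IsBiuniversal H η) {a : A}
include h

theorem hom_ext {f g : l ⟶ a} {α β : f ⟶ g} (e : η ◁ H.map₂ α = η ◁ H.map₂ β) : α = β :=
  IsUniversalElement.hom_ext h e

/-- The 1-cell that factors a given one through a biuniversal arrow. -/
noncomputable def desc (k : y ⟶ H.obj a) : l ⟶ a := IsUniversalElement.desc h k

/-- The factorization of a 1-cell through a biuniversal arrow. -/
noncomputable def fac (k : y ⟶ H.obj a) : k ≅ η ≫ H.map (h.desc k) :=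
  (IsUniversalElement.fac h k).symm

/-- The 2-cell that corresponds to one between composites with a biuniversal arrow. -/
noncomputable def lift {f g : l ⟶ a} (θ : η ≫ H.map f ⟶ η ≫ H.map g) : f ⟶ g :=
  IsUniversalElement.lift h θ

theorem whiskerLeft_map₂_lift {f g : l ⟶ a} (θ : η ≫ H.map f ⟶ η ≫ H.map g) :
    η ◁ H.map₂ (h.lift θ) = θ :=
  IsUniversalElement.act₂_lift h θ

/-- The invertible 2-cell that corresponds to one between composites with a biuniversal arrow. -/
noncomputable def liftIso {f g : l ⟶ a} (θ : η ≫ H.map f ≅ η ≫ H.map g) : f ≅ g :=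
  IsUniversalElement.liftIso h θ

theorem whiskerLeft_map₂_liftIso_hom {f g : l ⟶ a} (θ : η ≫ H.map f ≅ η ≫ H.map g) :
    η ◁ H.map₂ (h.liftIso θ).hom = θ.hom :=
  IsUniversalElement.act₂_liftIso_hom h θ

end IsBiuniversal

variable {H : A ⥤ᵖ C} {L : C → A} {η : ∀ y, y ⟶ H.obj (L y)} (h : ∀ y, IsBiuniversal H (η y))

namespace leftBiadjoint

/-- The action on 1-cells of the left biadjoint. -/
noncomputable def map {x y : C} (u : x ⟶ y) : L x ⟶ L y := (h x).desc (u ≫ η y)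

/-- The naturality 2-cell of the unit. -/
noncomputable def unitIso {x y : C} (u : x ⟶ y) : u ≫ η y ≅ η x ≫ H.map (map h u) :=
  (h x).fac (u ≫ η y)

/-- The action on 2-cells of the left biadjoint. -/
noncomputable def map₂ {x y : C} {u u' : x ⟶ y} (θ : u ⟶ u') : map h u ⟶ map h u' :=
  (h x).lift ((unitIso h u).inv ≫ θ ▷ η y ≫ (unitIso h u').hom)

/-- The identity constraint of the left biadjoint. -/
noncomputable def mapId (x : C) : map h (𝟙 x) ≅ 𝟙 (L x) :=
  (h x).liftIso ((unitIso h (𝟙 x)).symm ≪≫ λ_ _ ≪≫ (ρ_ _).symm ≪≫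
    whiskerLeftIso (η x) (H.mapId (L x)).symm)

/-- The composition constraint of the left biadjoint. -/
noncomputable def mapComp {x y z : C} (u : x ⟶ y) (v : y ⟶ z) :
    map h (u ≫ v) ≅ map h u ≫ map h v :=
  (h x).liftIso ((unitIso h (u ≫ v)).symm ≪≫ α_ _ _ _ ≪≫ whiskerLeftIso u (unitIso h v) ≪≫
    (α_ _ _ _).symm ≪≫ whiskerRightIso (unitIso h u) (H.map (map h v)) ≪≫ α_ _ _ _ ≪≫
    whiskerLeftIso (η x) (H.mapComp (map h u) (map h v)).symm)

theorem map₂_fac {x y : C} {u u' : x ⟶ y} (θ : u ⟶ u') :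
    (unitIso h u).hom ≫ η x ◁ H.map₂ (map₂ h θ) = θ ▷ η y ≫ (unitIso h u').hom := by
  simp [map₂, IsBiuniversal.whiskerLeft_map₂_lift]

theorem mapId_fac (x : C) :
    (unitIso h (𝟙 x)).hom ≫ η x ◁ H.map₂ (mapId h x).hom =
      (λ_ _).hom ≫ (ρ_ _).inv ≫ η x ◁ (H.mapId (L x)).inv := by
  simp [mapId, IsBiuniversal.whiskerLeft_map₂_liftIso_hom]

theorem mapComp_fac {x y z : C} (u : x ⟶ y) (v : y ⟶ z) :
    (unitIso h (u ≫ v)).hom ≫ η x ◁ H.map₂ (mapComp h u v).hom =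
      (α_ _ _ _).hom ≫ u ◁ (unitIso h v).hom ≫ (α_ _ _ _).inv ≫
        (unitIso h u).hom ▷ H.map (map h v) ≫ (α_ _ _ _).hom ≫
        η x ◁ (H.mapComp (map h u) (map h v)).inv := by
  simp [mapComp, IsBiuniversal.whiskerLeft_map₂_liftIso_hom]

theorem hom_ext {x y : C} {u : x ⟶ y} {f : L x ⟶ L y} {α β : map h u ⟶ f}
    (e : (unitIso h u).hom ≫ η x ◁ H.map₂ α = (unitIso h u).hom ≫ η x ◁ H.map₂ β) : α = β :=
  (h x).hom_ext ((cancel_epi _).1 e)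

theorem map₂_whiskerLeft {x y z : C} (u : x ⟶ y) {v v' : y ⟶ z} (θ : v ⟶ v') :
    map₂ h (u ◁ θ) ≫ (mapComp h u v').hom =
      (mapComp h u v).hom ≫ map h u ◁ map₂ h θ := by
  apply hom_ext h
  have e := map₂_fac h θ
  simp only [H.map₂_comp, whiskerLeft_comp, reassoc_of% map₂_fac h (u ◁ θ),
    reassoc_of% mapComp_fac h u v, mapComp_fac, H.map₂_whisker_left]
  simp only [whiskerLeft_inv_hom_assoc]
  rw [← cancel_mono (η x ◁ (H.mapComp (map h u) (map h v')).hom)]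
  simp only [Category.assoc, whiskerLeft_inv_hom, Category.comp_id]
  rw [associator_naturality_middle_assoc, ← whiskerLeft_comp_assoc, ← e, whiskerLeft_comp_assoc,
    associator_inv_naturality_right_assoc, whisker_exchange_assoc]
  simp

theorem map₂_whiskerRight {x y z : C} {u u' : x ⟶ y} (θ : u ⟶ u') (v : y ⟶ z) :
    map₂ h (θ ▷ v) ≫ (mapComp h u' v).hom =
      (mapComp h u v).hom ≫ map₂ h θ ▷ map h v := by
  apply hom_ext h
  have e := map₂_fac h θ
  simp only [H.map₂_comp, whiskerLeft_comp, reassoc_of% map₂_fac h (θ ▷ v),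
    reassoc_of% mapComp_fac h u v, mapComp_fac, H.map₂_whisker_right]
  simp only [whiskerLeft_inv_hom_assoc]
  rw [← cancel_mono (η x ◁ (H.mapComp (map h u') (map h v)).hom)]
  simp only [Category.assoc, whiskerLeft_inv_hom, Category.comp_id]
  rw [associator_naturality_left_assoc, ← whisker_exchange_assoc,
    associator_inv_naturality_left_assoc, ← comp_whiskerRight_assoc, ← e]
  simp

theorem map₂_leftUnitor {x y : C} (u : x ⟶ y) :
    map₂ h (λ_ u).hom =
      (mapComp h (𝟙 x) u).hom ≫ (mapId h x).hom ▷ map h u ≫ (λ_ (map h u)).hom := by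
  apply hom_ext h
  have e := mapId_fac h x
  simp only [H.map₂_comp, whiskerLeft_comp, map₂_fac h (λ_ u).hom,
    reassoc_of% mapComp_fac h (𝟙 x) u, H.map₂_whisker_right, H.map₂_left_unitor, Category.assoc,
    whiskerLeft_inv_hom_assoc]
  rw [← associator_naturality_middle_assoc, ← comp_whiskerRight_assoc, e]
  simp

theorem map₂_rightUnitor {x y : C} (u : x ⟶ y) :
    map₂ h (ρ_ u).hom =
      (mapComp h u (𝟙 y)).hom ≫ map h u ◁ (mapId h y).hom ≫ (ρ_ (map h u)).hom := by
  apply hom_ext h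
  have e := mapId_fac h y
  simp only [H.map₂_comp, whiskerLeft_comp, map₂_fac h (ρ_ u).hom,
    reassoc_of% mapComp_fac h u (𝟙 y), H.map₂_whisker_left, H.map₂_right_unitor, Category.assoc,
    whiskerLeft_inv_hom_assoc]
  rw [← associator_naturality_right_assoc, ← whisker_exchange_assoc,
    ← associator_inv_naturality_right_assoc, ← whiskerLeft_comp_assoc u, e]
  simp only [whiskerLeft_comp, Category.assoc]
  rw [associator_inv_naturality_right_assoc, whisker_exchange_assoc]
  simp

theorem map₂_associator {x y z t : C} (u : x ⟶ y) (v : y ⟶ z) (w : z ⟶ t) :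
    map₂ h (α_ u v w).hom ≫ (mapComp h u (v ≫ w)).hom ≫ map h u ◁ (mapComp h v w).hom =
      (mapComp h (u ≫ v) w).hom ≫ (mapComp h u v).hom ▷ map h w ≫ (α_ _ _ _).hom := by
  apply hom_ext h
  have e₁ := mapComp_fac h u v
  have e₂ := mapComp_fac h v w
  simp only [H.map₂_comp, whiskerLeft_comp, reassoc_of% map₂_fac h (α_ u v w).hom,
    reassoc_of% mapComp_fac h (u ≫ v) w, reassoc_of% mapComp_fac h u (v ≫ w),
    H.map₂_whisker_right, H.map₂_whisker_left, H.map₂_associator, Category.assoc,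
    whiskerLeft_inv_hom_assoc]
  rw [← associator_naturality_middle_assoc, ← comp_whiskerRight_assoc, e₁]
  rw [← associator_naturality_right_assoc, ← whisker_exchange_assoc,
    ← associator_inv_naturality_right_assoc, ← whiskerLeft_comp_assoc u, e₂]
  rw [← cancel_mono (η x ◁ (H.mapComp (map h u) (map h v ≫ map h w)).hom)]
  rw [← cancel_mono (η x ◁ _ ◁ (H.mapComp (map h v) (map h w)).hom)]
  simp only [comp_whiskerRight, whiskerLeft_comp, Category.assoc, pentagon_assoc,
    comp_whiskerLeft, whisker_assoc, Iso.inv_hom_id_assoc]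
  rw [associator_inv_naturality_right_assoc, whisker_exchange_assoc]
  simp

end leftBiadjoint

open leftBiadjoint in
/-- The left biadjoint determined by a biuniversal arrow for each object. -/
noncomputable def leftBiadjoint : C ⥤ᵖ A where
  obj := L
  map := map h
  map₂ := map₂ h
  map₂_id u := by
    apply hom_ext h
    simp [map₂_fac h]
  map₂_comp θ θ' := by
    apply hom_ext h
    simp [map₂_fac h, reassoc_of% map₂_fac h]
  mapId := mapId h
  mapComp := mapComp h
  map₂_whisker_left u _ _ θ := by
    rw [← reassoc_of% map₂_whiskerLeft h u θ, Iso.hom_inv_id, Category.comp_id]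
  map₂_whisker_right θ v := by
    rw [← reassoc_of% map₂_whiskerRight h θ v, Iso.hom_inv_id, Category.comp_id]
  map₂_associator u v w := by
    rw [← reassoc_of% map₂_associator h u v w]
    simp
  map₂_left_unitor := map₂_leftUnitor h
  map₂_right_unitor := map₂_rightUnitor h

open leftBiadjoint in
/-- The unit of the left biadjoint determined by a biuniversal arrow for each object. -/
noncomputable def leftBiadjoint.unit : Pseudofunctor.id C ⟶ (leftBiadjoint h).comp H where
  app := η
  naturality := unitIso h
  naturality_naturality θ := (map₂_fac h θ).symm
  naturality_id x := by
    change (unitIso h (𝟙 x)).hom ≫ η x ◁ (H.map₂ (mapId h x).hom ≫ (H.mapId (L x)).hom) =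
      𝟙 (𝟙 x) ▷ η x ≫ (λ_ _).hom ≫ (ρ_ _).inv
    simp [reassoc_of% mapId_fac h x]
  naturality_comp {x y z} u v := by
    change (unitIso h (u ≫ v)).hom ≫ η x ◁ (H.map₂ (mapComp h u v).hom ≫ (H.mapComp _ _).hom) =
      𝟙 (u ≫ v) ▷ η z ≫ (α_ _ _ _).hom ≫ u ◁ (unitIso h v).hom ≫ (α_ _ _ _).inv ≫
        (unitIso h u).hom ▷ H.map (map h v) ≫ (α_ _ _ _).hom
    simp [reassoc_of% mapComp_fac h u v]

end BiuniversalArrows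

section Transpose

variable {A : Type u₁} [Bicategory.{w₁, v₁} A] {C : Type u₂} [Bicategory.{w₂, v₂} C]
  {G : C ⥤ᵖ A} {H : A ⥤ᵖ C} (η : Pseudofunctor.id C ⟶ G.comp H)

theorem unitNat_map₂ {x y : C} {u u' : x ⟶ y} (θ : u ⟶ u') :
    (unitNat η u).hom ≫ unitApp η x ◁ H.map₂ (G.map₂ θ) =
      θ ▷ unitApp η y ≫ (unitNat η u').hom :=
  (η.naturality_naturality θ).symm

theorem unitNat_mapId (x : C) :
    (unitNat η (𝟙 x)).hom ≫ unitApp η x ◁ H.map₂ (G.mapId x).hom =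
      (λ_ _).hom ≫ (ρ_ _).inv ≫ unitApp η x ◁ (H.mapId (G.obj x)).inv := by
  have e : (unitNat η (𝟙 x)).hom ≫
      unitApp η x ◁ (H.map₂ (G.mapId x).hom ≫ (H.mapId (G.obj x)).hom) =
      𝟙 (𝟙 x) ▷ unitApp η x ≫ (λ_ _).hom ≫ (ρ_ _).inv := η.naturality_id x
  rw [← cancel_mono (unitApp η x ◁ (H.mapId (G.obj x)).hom)]
  simpa using e

theorem unitNat_mapComp {x y z : C} (u : x ⟶ y) (v : y ⟶ z) :
    (unitNat η (u ≫ v)).hom ≫ unitApp η x ◁ H.map₂ (G.mapComp u v).hom =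
      (α_ _ _ _).hom ≫ u ◁ (unitNat η v).hom ≫ (α_ _ _ _).inv ≫
        (unitNat η u).hom ▷ H.map (G.map v) ≫ (α_ _ _ _).hom ≫
        unitApp η x ◁ (H.mapComp (G.map u) (G.map v)).inv := by
  have e : (unitNat η (u ≫ v)).hom ≫
      unitApp η x ◁ (H.map₂ (G.mapComp u v).hom ≫ (H.mapComp (G.map u) (G.map v)).hom) =
      𝟙 (u ≫ v) ▷ unitApp η z ≫ (α_ _ _ _).hom ≫ u ◁ (unitNat η v).hom ≫ (α_ _ _ _).inv ≫
        (unitNat η u).hom ▷ H.map (G.map v) ≫ (α_ _ _ _).hom := η.naturality_comp u v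
  rw [← cancel_mono (unitApp η x ◁ (H.mapComp (G.map u) (G.map v)).hom)]
  simpa using e

/-- The naturality constraint of `k ↦ η_y ≫ H k`, as a comparison of `u ≫ (η_y ≫ H k)` and
`η_x ≫ H (G u ≫ k)`. -/
def transposeIso {x y : C} (u : x ⟶ y) {a : A} (k : G.obj y ⟶ a) :
    u ≫ unitApp η y ≫ H.map k ≅ unitApp η x ≫ H.map (G.map u ≫ k) :=
  (α_ _ _ _).symm ≪≫ whiskerRightIso (unitNat η u) (H.map k) ≪≫ α_ _ _ _ ≪≫
    whiskerLeftIso (unitApp η x) (H.mapComp (G.map u) k).symm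

/-- The transpose `u ≫ (η_y ≫ H k) ⟶ η_x ≫ H f` of a 2-cell `G u ≫ k ⟶ f`. When `η_x` is a
biuniversal arrow, equations of 2-cells can be checked on transposes. -/
def transpose {x y : C} {u : x ⟶ y} {a : A} {k : G.obj y ⟶ a} {f : G.obj x ⟶ a}
    (α : G.map u ≫ k ⟶ f) : u ≫ unitApp η y ≫ H.map k ⟶ unitApp η x ≫ H.map f :=
  (transposeIso η u k).hom ≫ unitApp η x ◁ H.map₂ α

section

variable {η} {x y : C} {u : x ⟶ y} {a : A} {k : G.obj y ⟶ a} {f : G.obj x ⟶ a}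

theorem transpose_ext (h : IsBiuniversal H (unitApp η x)) {α β : G.map u ≫ k ⟶ f}
    (e : transpose η α = transpose η β) : α = β :=
  h.hom_ext ((cancel_epi _).1 e)

theorem transpose_comp (α : G.map u ≫ k ⟶ f) {f' : G.obj x ⟶ a} (γ : f ⟶ f') :
    transpose η (α ≫ γ) = transpose η α ≫ unitApp η x ◁ H.map₂ γ := by
  simp [transpose]

theorem transpose_map₂_whiskerRight {u' : x ⟶ y} (θ : u' ⟶ u) (α : G.map u ≫ k ⟶ f) :
    transpose η (G.map₂ θ ▷ k ≫ α) = θ ▷ (unitApp η y ≫ H.map k) ≫ transpose η α := by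
  have e := unitNat_map₂ η θ
  simp only [transpose, transposeIso, Iso.trans_hom, Iso.symm_hom, whiskerRightIso_hom,
    whiskerLeftIso_hom, Category.assoc, H.map₂_comp, H.map₂_whisker_right, whiskerLeft_comp,
    whiskerLeft_inv_hom_assoc]
  rw [← associator_naturality_middle_assoc, ← comp_whiskerRight_assoc, e]
  simp

theorem transpose_whiskerRight {b : A} (α : G.map u ≫ k ⟶ f) (g : a ⟶ b) :
    transpose η ((α_ _ _ _).inv ≫ α ▷ g) =
      u ◁ (unitApp η y ◁ (H.mapComp k g).hom ≫ (α_ _ _ _).inv) ≫ (α_ _ _ _).inv ≫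
        transpose η α ▷ H.map g ≫ (α_ _ _ _).hom ≫ unitApp η x ◁ (H.mapComp f g).inv := by
  simp only [transpose, transposeIso, Iso.trans_hom, Iso.symm_hom, whiskerRightIso_hom,
    whiskerLeftIso_hom, Category.assoc, H.map₂_comp, H.map₂_whisker_right, whiskerLeft_comp,
    comp_whiskerRight, map₂_α_inv, whiskerLeft_inv_hom_assoc]
  rw [← associator_naturality_right_assoc, ← whisker_exchange_assoc]
  simp

end

theorem transpose_mapId {x : C} {a : A} (k : G.obj x ⟶ a) :
    transpose η ((G.mapId x).hom ▷ k ≫ (λ_ k).hom) = (λ_ _).hom := by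
  have e := unitNat_mapId η x
  simp only [transpose, transposeIso, Iso.trans_hom, Iso.symm_hom, whiskerRightIso_hom,
    whiskerLeftIso_hom, Category.assoc, H.map₂_comp, H.map₂_whisker_right, whiskerLeft_comp,
    H.map₂_left_unitor, whiskerLeft_inv_hom_assoc]
  rw [← associator_naturality_middle_assoc, ← comp_whiskerRight_assoc, e]
  simp

theorem transpose_mapComp {x y z : C} (u : x ⟶ y) (v : y ⟶ z) {a : A} {k : G.obj z ⟶ a}
    {l : G.obj y ⟶ a} {f : G.obj x ⟶ a} (α : G.map v ≫ k ⟶ l) (β : G.map u ≫ l ⟶ f) :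
    transpose η ((G.mapComp u v).hom ▷ k ≫ (α_ _ _ _).hom ≫ G.map u ◁ α ≫ β) =
      (α_ _ _ _).hom ≫ u ◁ transpose η α ≫ transpose η β := by
  have e := unitNat_mapComp η u v
  simp only [transpose, transposeIso, Iso.trans_hom, Iso.symm_hom, whiskerRightIso_hom,
    whiskerLeftIso_hom, Category.assoc, H.map₂_comp, H.map₂_whisker_right, H.map₂_whisker_left,
    whiskerLeft_comp, H.map₂_associator, whiskerLeft_inv_hom_assoc]
  rw [← associator_naturality_middle_assoc, ← comp_whiskerRight_assoc, e]
  rw [associator_inv_naturality_right_assoc u, whisker_exchange_assoc]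
  rw [associator_inv_naturality_right_assoc u, whisker_exchange_assoc]
  simp

theorem transpose_unitor {x y : C} (u : x ⟶ y) :
    transpose η ((ρ_ (G.map u)).hom ≫ (λ_ _).inv) =
      u ◁ (unitApp η y ◁ (H.mapId _).hom ≫ (ρ_ _).hom) ≫ (unitNat η u).hom ≫
        unitApp η x ◁ H.map₂ (λ_ (G.map u)).inv := by
  simp only [transpose, transposeIso, Iso.trans_hom, Iso.symm_hom, whiskerRightIso_hom,
    whiskerLeftIso_hom, Category.assoc, H.map₂_comp, H.map₂_right_unitor, whiskerLeft_comp,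
    whiskerLeft_inv_hom_assoc]
  rw [← associator_naturality_right_assoc, ← whisker_exchange_assoc]
  simp

end Transpose

section InducedCounit

variable {A : Type u₁} [Bicategory.{w₁, v₁} A] {C : Type u₂} [Bicategory.{w₂, v₂} C]

theorem map₂_leftUnitor_inv (D : A ⥤ᵖ C) {a b : A} (f : a ⟶ b) :
    D.map₂ (λ_ f).inv = (λ_ (D.map f)).inv ≫ (D.mapId a).inv ▷ D.map f ≫
      (D.mapComp (𝟙 a) f).inv := by
  rw [← cancel_epi (D.map₂ (λ_ f).hom), ← D.map₂_comp]
  simp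

theorem whiskerRight_comp_leftUnitor {a : A} {x : a ⟶ a} (w : x ≅ 𝟙 a) :
    w.hom ▷ x ≫ (λ_ x).hom = x ◁ w.hom ≫ (ρ_ x).hom := by
  have e := whisker_exchange w.hom w.hom
  simp only [id_whiskerLeft, whiskerRight_id] at e
  rw [← cancel_mono w.hom, ← cancel_mono (λ_ (𝟙 a)).inv]
  simpa [unitors_equal] using e.symm

variable {G : C ⥤ᵖ A} {H : A ⥤ᵖ C} {η : Pseudofunctor.id C ⟶ G.comp H}
  (h : ∀ x, IsBiuniversal H (unitApp η x))

namespace inducedCounit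

/-- The components `ε_a` of the counit: `η_{H a} ≫ H ε_a ≅ 𝟙`. -/
noncomputable def app (a : A) : G.obj (H.obj a) ⟶ a := (h (H.obj a)).desc (𝟙 (H.obj a))

/-- The invertible 2-cell that defines `ε_a`; it is the second triangle constraint. -/
noncomputable def rightTriangle (a : A) : unitApp η (H.obj a) ≫ H.map (app h a) ≅ 𝟙 (H.obj a) :=
  ((h (H.obj a)).fac (𝟙 (H.obj a))).symm

/-- The transpose of the naturality constraint of the counit. -/
noncomputable def transposedNat {a b : A} (g : a ⟶ b) :
    H.map g ≫ unitApp η (H.obj b) ≫ H.map (app h b) ≅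
      unitApp η (H.obj a) ≫ H.map (app h a ≫ g) :=
  whiskerLeftIso (H.map g) (rightTriangle h b) ≪≫ ρ_ _ ≪≫ (λ_ _).symm ≪≫
    whiskerRightIso (rightTriangle h a).symm (H.map g) ≪≫ α_ _ _ _ ≪≫
    whiskerLeftIso _ (H.mapComp _ _).symm

/-- The naturality constraint of the counit. -/
noncomputable def natIso {a b : A} (g : a ⟶ b) :
    G.map (H.map g) ≫ app h b ≅ app h a ≫ g :=
  (h (H.obj a)).liftIso ((transposeIso η (H.map g) (app h b)).symm ≪≫ transposedNat h g)

theorem transpose_natIso {a b : A} (g : a ⟶ b) :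
    transpose η (natIso h g).hom = (transposedNat h g).hom := by
  simp [transpose, natIso, IsBiuniversal.whiskerLeft_map₂_liftIso_hom]

theorem natIso_naturality {a b : A} {f g : a ⟶ b} (θ : f ⟶ g) :
    G.map₂ (H.map₂ θ) ▷ app h b ≫ (natIso h g).hom = (natIso h f).hom ≫ app h a ◁ θ := by
  apply transpose_ext (h _)
  rw [transpose_map₂_whiskerRight, transpose_comp, transpose_natIso, transpose_natIso]
  simp only [transposedNat, Iso.trans_hom, Iso.symm_hom, whiskerRightIso_hom, whiskerLeftIso_hom,
    Category.assoc, H.map₂_whisker_left, whiskerLeft_comp, whiskerLeft_inv_hom_assoc]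
  rw [← whisker_exchange_assoc, rightUnitor_naturality_assoc, leftUnitor_inv_naturality_assoc,
    whisker_exchange_assoc]
  simp

theorem natIso_id (a : A) :
    (natIso h (𝟙 a)).hom =
      (G.map₂ (H.mapId a).hom ≫ (G.mapId (H.obj a)).hom) ▷ app h a ≫ (λ_ _).hom ≫
        (ρ_ _).inv := by
  apply transpose_ext (h _)
  rw [comp_whiskerRight, Category.assoc, transpose_map₂_whiskerRight,
    ← Category.assoc (_ ▷ _) (λ_ _).hom, transpose_comp, transpose_mapId, transpose_natIso]
  simp only [transposedNat, Iso.trans_hom, Iso.symm_hom, whiskerRightIso_hom, whiskerLeftIso_hom,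
    map₂_ρ_inv, whiskerLeft_comp]
  rw [← cancel_mono (unitApp η (H.obj a) ◁ (H.mapComp (app h a) (𝟙 a)).hom),
    ← cancel_mono (unitApp η (H.obj a) ◁ H.map (app h a) ◁ (H.mapId a).hom)]
  simp only [Category.assoc, whiskerLeft_inv_hom, Category.comp_id]
  rw [← associator_naturality_right, ← whisker_exchange_assoc, ← leftUnitor_inv_naturality_assoc,
    ← rightUnitor_naturality_assoc, whisker_exchange_assoc]
  simp

theorem natIso_comp {a b c : A} (f : a ⟶ b) (g : b ⟶ c) :
    (natIso h (f ≫ g)).hom =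
      (G.map₂ (H.mapComp f g).hom ≫ (G.mapComp (H.map f) (H.map g)).hom) ▷ app h c ≫
        (α_ _ _ _).hom ≫ G.map (H.map f) ◁ (natIso h g).hom ≫ (α_ _ _ _).inv ≫
        (natIso h f).hom ▷ g ≫ (α_ _ _ _).hom := by
  apply transpose_ext (h _)
  rw [comp_whiskerRight, Category.assoc, transpose_map₂_whiskerRight, transpose_mapComp,
    ← Category.assoc (α_ _ _ _).inv, transpose_comp, transpose_whiskerRight, transpose_natIso,
    transpose_natIso, transpose_natIso]
  simp only [transposedNat, Iso.trans_hom, Iso.symm_hom, whiskerRightIso_hom, whiskerLeftIso_hom,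
    Category.assoc, H.map₂_associator, whiskerLeft_comp, comp_whiskerRight]
  rw [← cancel_mono (unitApp η (H.obj a) ◁ (H.mapComp (app h a) (f ≫ g)).hom),
    ← cancel_mono (unitApp η (H.obj a) ◁ H.map (app h a) ◁ (H.mapComp f g).hom)]
  simp only [Category.assoc, whiskerLeft_inv_hom, Category.comp_id]
  rw [← associator_naturality_right, ← whisker_exchange_assoc, ← leftUnitor_inv_naturality_assoc,
    ← rightUnitor_naturality_assoc, whisker_exchange_assoc]
  simp

end inducedCounit

open inducedCounit

/-- The counit determined by a pseudonatural transformation `Id ⟶ HG` whose components are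
biuniversal arrows. -/
noncomputable def inducedCounit : H.comp G ⟶ Pseudofunctor.id A where
  app := app h
  naturality := natIso h
  naturality_naturality θ := natIso_naturality h θ
  naturality_id a := (congrArg (_ ≫ ·) (whiskerLeft_id _ _)).trans <|
    (Category.comp_id _).trans (natIso_id h a)
  naturality_comp f g := (congrArg (_ ≫ ·) (whiskerLeft_id _ _)).trans <|
    (Category.comp_id _).trans (natIso_comp h f g)

namespace inducedCounit

/-- The transpose of the inverse of the first triangle constraint. -/
noncomputable def transposedTriangle (x : C) :
    unitApp η x ≫ unitApp η (H.obj (G.obj x)) ≫ H.map (app h (G.obj x)) ≅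
      unitApp η x ≫ H.map (𝟙 (G.obj x)) :=
  whiskerLeftIso (unitApp η x) (rightTriangle h (G.obj x) ≪≫ (H.mapId (G.obj x)).symm)

/-- The inverse of the first triangle constraint. -/
noncomputable def leftTriangle (x : C) :
    G.map (unitApp η x) ≫ app h (G.obj x) ≅ 𝟙 (G.obj x) :=
  (h x).liftIso ((transposeIso η (unitApp η x) (app h (G.obj x))).symm ≪≫ transposedTriangle h x)

theorem transpose_leftTriangle (x : C) :
    transpose η (leftTriangle h x).hom = (transposedTriangle h x).hom := by
  simp [transpose, leftTriangle, IsBiuniversal.whiskerLeft_map₂_liftIso_hom]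

theorem leftTriangle_naturality {x y : C} (f : x ⟶ y) :
    G.map₂ (unitNat η f).hom ▷ app h (G.obj y) ≫
        (G.mapComp (unitApp η x) (H.map (G.map f))).hom ▷ app h (G.obj y) ≫
        (α_ _ _ _).hom ≫ G.map (unitApp η x) ◁ (natIso h (G.map f)).hom ≫ (α_ _ _ _).inv ≫
        (leftTriangle h x).hom ▷ G.map f =
      (G.mapComp f (unitApp η y)).hom ▷ app h (G.obj y) ≫ (α_ _ _ _).hom ≫
        G.map f ◁ (leftTriangle h y).hom ≫ (ρ_ (G.map f)).hom ≫ (λ_ (G.map f)).inv := by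
  apply transpose_ext (h _)
  rw [transpose_map₂_whiskerRight, transpose_mapComp, transpose_mapComp, transpose_whiskerRight,
    transpose_unitor, transpose_natIso, transpose_leftTriangle, transpose_leftTriangle]
  simp only [transposedNat, transposedTriangle, Iso.trans_hom, Iso.symm_hom, whiskerRightIso_hom,
    whiskerLeftIso_hom, Category.assoc, whiskerLeft_comp, comp_whiskerRight]
  have e := whisker_exchange (unitNat η f).hom (rightTriangle h (G.obj y)).hom
  simp only [comp_whiskerLeft, whiskerRight_comp, whiskerRight_id, Category.assoc] at e
  simp only [map₂_leftUnitor_inv, whiskerRight_comp, Category.assoc]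
  simp only [whiskerLeft_rightUnitor, whisker_assoc, Category.assoc, Iso.inv_hom_id_assoc,
    whiskerLeft_whiskerLeft_inv_hom_assoc, whiskerLeft_hom_inv_assoc,
    whiskerLeft_inv_hom_whiskerRight_assoc, whiskerLeft_comp]
  rw [← reassoc_of% e]
  simp

theorem natIso_app (a : A) :
    G.map₂ (rightTriangle h a).hom ▷ app h a ≫ (G.mapId (H.obj a)).hom ▷ app h a ≫
        (λ_ _).hom =
      (G.mapComp (unitApp η (H.obj a)) (H.map (app h a))).hom ▷ app h a ≫
        (α_ _ _ _).hom ≫ G.map (unitApp η (H.obj a)) ◁ (natIso h (app h a)).hom ≫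
        ((α_ _ _ _).inv ≫ (leftTriangle h (H.obj a)).hom ▷ app h a) ≫ (λ_ _).hom := by
  apply transpose_ext (h _)
  rw [transpose_map₂_whiskerRight, transpose_mapId, transpose_mapComp, transpose_comp,
    transpose_whiskerRight, transpose_natIso, transpose_leftTriangle]
  simp only [transposedNat, transposedTriangle, Iso.trans_hom, Iso.symm_hom, whiskerRightIso_hom,
    whiskerLeftIso_hom, Category.assoc, whiskerLeft_comp, comp_whiskerRight, H.map₂_left_unitor]
  have e := whiskerRight_comp_leftUnitor (rightTriangle h a)
  simp only [comp_whiskerLeft, whiskerRight_comp, Category.assoc] at e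
  simp [e]

theorem leftTriangle_inv_naturality {x y : C} (f : x ⟶ y) :
    G.map f ◁ (leftTriangle h y).inv ≫ (α_ _ _ _).inv ≫
        (G.mapComp f (unitApp η y)).inv ▷ app h (G.obj y) ≫
        G.map₂ (unitNat η f).hom ▷ app h (G.obj y) ≫
        (G.mapComp (unitApp η x) (H.map (G.map f))).hom ▷ app h (G.obj y) ≫
        (α_ _ _ _).hom ≫ G.map (unitApp η x) ◁ (natIso h (G.map f)).hom ≫ (α_ _ _ _).inv =
      (ρ_ (G.map f)).hom ≫ (λ_ (G.map f)).inv ≫ (leftTriangle h x).inv ▷ G.map f := by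
  rw [← cancel_mono ((leftTriangle h x).hom ▷ G.map f)]
  simp only [Category.assoc, leftTriangle_naturality]
  simp

theorem rightTriangle_naturality {a b : A} (g : a ⟶ b) :
    H.map g ◁ (rightTriangle h b).hom ≫ (ρ_ (H.map g)).hom ≫ (λ_ (H.map g)).inv =
      (α_ _ _ _).inv ≫ (unitNat η (H.map g)).hom ▷ H.map (app h b) ≫ (α_ _ _ _).hom ≫
        unitApp η (H.obj a) ◁ ((H.mapComp (G.map (H.map g)) (app h b)).inv ≫
          H.map₂ (natIso h g).hom ≫ (H.mapComp (app h a) g).hom) ≫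
        (α_ _ _ _).inv ≫ (rightTriangle h a).hom ▷ H.map g := by
  have e := transpose_natIso h g
  simp only [transpose, transposeIso, transposedNat, Iso.trans_hom, Iso.symm_hom,
    whiskerRightIso_hom, whiskerLeftIso_hom, Category.assoc] at e
  simp only [whiskerLeft_comp, Category.assoc]
  rw [reassoc_of% e]
  simp

theorem triangle_unit (x : C) :
    (ρ_ (unitApp η x)).inv ≫
        unitApp η x ◁ ((H.mapId (G.obj x)).inv ≫ H.map₂ (leftTriangle h x).inv ≫
          (H.mapComp (G.map (unitApp η x)) (app h (G.obj x))).hom) ≫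
        (α_ _ _ _).inv ≫
        (unitNat η (unitApp η x)).inv ▷ H.map (app h (G.obj x)) ≫
        (α_ _ _ _).hom ≫ unitApp η x ◁ (rightTriangle h (G.obj x)).hom ≫
        (ρ_ (unitApp η x)).hom =
      𝟙 (unitApp η x) := by
  have e : (transposedTriangle h x).hom ≫ unitApp η x ◁ H.map₂ (leftTriangle h x).inv =
      (transposeIso η _ _).hom := by
    rw [← transpose_leftTriangle h x, transpose, Category.assoc, ← whiskerLeft_comp,
      ← H.map₂_comp]
    simp
  have e' : unitApp η x ◁ H.map₂ (leftTriangle h x).inv =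
      (transposedTriangle h x).inv ≫ (transposeIso η _ _).hom := by
    rw [← e, Iso.inv_hom_id_assoc]
  simp only [whiskerLeft_comp, Category.assoc, reassoc_of% e']
  simp [transposeIso, transposedTriangle]

theorem triangle_counit (a : A) :
    (λ_ (app h a)).inv ≫ (leftTriangle h (H.obj a)).inv ▷ app h a ≫ (α_ _ _ _).hom ≫
        G.map (unitApp η (H.obj a)) ◁ (natIso h (app h a)).inv ≫ (α_ _ _ _).inv ≫
        ((G.mapComp (unitApp η (H.obj a)) (H.map (app h a))).inv ≫
          G.map₂ (rightTriangle h a).hom ≫ (G.mapId (H.obj a)).hom) ▷ app h a ≫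
        (λ_ (app h a)).hom =
      𝟙 (app h a) := by
  simp only [comp_whiskerRight, Category.assoc, natIso_app]
  simp

end inducedCounit

/-- The biadjunction `G ⊣ H` whose unit is a pseudonatural transformation `Id ⟶ HG` with biuniversal
components. -/
noncomputable def biadjunctionOfBiuniversal : Biadjunction G H where
  unit := η
  counit := inducedCounit h
  v x := (leftTriangle h x).symm
  v_naturality := leftTriangle_inv_naturality h
  w := rightTriangle h
  w_naturality := rightTriangle_naturality h
  coherence_unit := triangle_unit h
  coherence_counit := triangle_counit h

end InducedCounit

theorem exists_biadjunction_of_isBiuniversal {A : Type u₁} [Bicategory.{w₁, v₁} A] {C : Type u₂}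
    [Bicategory.{w₂, v₂} C] {H : A ⥤ᵖ C} {L : C → A} {η : ∀ y, y ⟶ H.obj (L y)}
    (h : ∀ y, IsBiuniversal H (η y)) :
    ∃ G : C ⥤ᵖ A, (∀ y, G.obj y = L y) ∧ Nonempty (Biadjunction G H) :=
  ⟨leftBiadjoint h, fun _ => rfl, ⟨biadjunctionOfBiuniversal (η := leftBiadjoint.unit h) h⟩⟩

section Elementwise

variable {A : Type u₁} [Bicategory.{w, v} A] {E : Type u₂} [Bicategory.{w, v} E]

/-- Equivalences of categories `F a ≃ G a` compatible with the evaluation functors at elements.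
Unlike a pseudonatural equivalence, this carries no coherence in `a`, but it suffices to transport
universal elements. -/
structure ElementwiseEquiv (F G : A ⥤ᵖ Cat.{w, v}) where
  /-- The functors. -/
  app (a : A) : F.obj a ⥤ G.obj a
  isEquivalence (a : A) : (app a).IsEquivalence
  /-- The compatibility with evaluation. -/
  iso {l : A} (x : F.obj l) (a : A) : evalAt F x a ⋙ app a ≅ evalAt G ((app l).obj x) a

namespace ElementwiseEquiv

variable {F G H : A ⥤ᵖ Cat.{w, v}}

/-- The elementwise equivalence underlying a pseudonatural equivalence. -/
def ofTrans (τ : F ⟶ G) (h : ∀ x, (τ.app x).toFunctor.IsEquivalence) : ElementwiseEquiv F G where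
  app a := (τ.app a).toFunctor
  isEquivalence := h
  iso x a := evalAtCompIso τ x a

/-- The composition of elementwise equivalences. -/
def trans (e : ElementwiseEquiv F G) (e' : ElementwiseEquiv G H) : ElementwiseEquiv F H where
  app a := e.app a ⋙ e'.app a
  isEquivalence a :=
    have := e.isEquivalence a
    have := e'.isEquivalence a
    inferInstance
  iso x a := (Functor.associator _ _ _).symm ≪≫ Functor.isoWhiskerRight (e.iso x a) (e'.app a) ≪≫
    e'.iso _ a

/-- The restriction of an elementwise equivalence along a pseudofunctor. -/
def restrict {F G : E ⥤ᵖ Cat.{w, v}} (e : ElementwiseEquiv F G) (I : A ⥤ᵖ E) :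
    ElementwiseEquiv (I.comp F) (I.comp G) where
  app a := e.app (I.obj a)
  isEquivalence a := e.isEquivalence (I.obj a)
  iso x a := NatIso.ofComponents (fun f => (e.iso x (I.obj a)).app (I.map f))
    (fun α => (e.iso x (I.obj a)).hom.naturality (I.map₂ α))

/-- An elementwise equivalence out of `F ∘ Id` is one out of `F`. -/
def ofIdComp (e : ElementwiseEquiv ((Pseudofunctor.id A).comp F) G) : ElementwiseEquiv F G where
  app := e.app
  isEquivalence := e.isEquivalence
  iso := e.iso

theorem isUniversalElement_iff (e : ElementwiseEquiv F G) {l : A} (x : F.obj l) :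
    IsUniversalElement F x ↔ IsUniversalElement G ((e.app l).obj x) :=
  forall_congr' fun a =>
    have := e.isEquivalence a
    isEquivalence_iff_of_comp_iso (e.iso x a)

theorem exists_isUniversalElement_iff (e : ElementwiseEquiv F G) (l : A) :
    (∃ x : F.obj l, IsUniversalElement F x) ↔ ∃ x : G.obj l, IsUniversalElement G x :=
  ⟨fun ⟨x, hx⟩ => ⟨_, (e.isUniversalElement_iff x).1 hx⟩, fun ⟨x, hx⟩ =>
    have := e.isEquivalence l
    ⟨(e.app l).objPreimage x,
      (e.isUniversalElement_iff _).2 (hx.of_iso ((e.app l).objObjPreimageIso x).symm)⟩⟩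

end ElementwiseEquiv

end Elementwise

section BiuniversalOfBiadjunction

variable {A : Type u₁} [Bicategory.{w₁, v₁} A] {B : Type u₂} [Bicategory.{w₂, v₂} B]
  {E : B ⥤ᵖ A} {R : A ⥤ᵖ B}

theorem counitNat_inv_map₂ (θ : R.comp E ⟶ Pseudofunctor.id A) {a b : A} {f g : a ⟶ b}
    (α : f ⟶ g) :
    (counitNat θ f).inv ≫ E.map₂ (R.map₂ α) ▷ counitApp θ b =
      counitApp θ a ◁ α ≫ (counitNat θ g).inv := by
  have e : E.map₂ (R.map₂ α) ▷ counitApp θ b ≫ (counitNat θ g).hom =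
      (counitNat θ f).hom ≫ counitApp θ a ◁ α := θ.naturality_naturality α
  rw [Iso.inv_comp_eq, ← reassoc_of% e, Iso.hom_inv_id, Category.comp_id]

theorem unitNat_inv_map₂ (η : Pseudofunctor.id B ⟶ E.comp R) {x y : B} {f g : x ⟶ y}
    (α : f ⟶ g) :
    unitApp η x ◁ R.map₂ (E.map₂ α) ≫ (unitNat η g).inv =
      (unitNat η f).inv ≫ α ▷ unitApp η y := by
  rw [Iso.eq_inv_comp, reassoc_of% unitNat_map₂ η α, Iso.hom_inv_id, Category.comp_id]

namespace Biadjunction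

variable (b : Biadjunction E R) (x : B) (a : A)

/-- The functor `g ↦ E g ≫ ε_a`, quasi-inverse to `f ↦ ρ_x ≫ R f`. -/
def transposition : (x ⟶ R.obj a) ⥤ (E.obj x ⟶ a) where
  obj g := E.map g ≫ counitApp b.counit a
  map α := E.map₂ α ▷ counitApp b.counit a

/-- The isomorphism `f ≅ E (ρ_x ≫ R f) ≫ ε_a` given by the first triangle constraint. -/
def transpositionUnitIso :
    𝟭 _ ≅ evalAt (R.comp (homFrom x)) (unitApp b.unit x) a ⋙ b.transposition x a :=
  NatIso.ofComponents (fun f => (λ_ f).symm ≪≫ whiskerRightIso (b.v x) f ≪≫ α_ _ _ _ ≪≫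
    whiskerLeftIso _ (counitNat b.counit f).symm ≪≫ (α_ _ _ _).symm ≪≫
    whiskerRightIso (E.mapComp (unitApp b.unit x) (R.map f)).symm (counitApp b.counit a)) (by
      intro f g α
      change α ≫ (λ_ g).inv ≫ (b.v x).hom ▷ g ≫ (α_ _ _ _).hom ≫
          E.map (unitApp b.unit x) ◁ (counitNat b.counit g).inv ≫ (α_ _ _ _).inv ≫
          (E.mapComp _ (R.map g)).inv ▷ counitApp b.counit a =
        ((λ_ f).inv ≫ (b.v x).hom ▷ f ≫ (α_ _ _ _).hom ≫
          E.map (unitApp b.unit x) ◁ (counitNat b.counit f).inv ≫ (α_ _ _ _).inv ≫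
          (E.mapComp _ (R.map f)).inv ▷ counitApp b.counit a) ≫
        E.map₂ (unitApp b.unit x ◁ R.map₂ α) ▷ counitApp b.counit a
      simp only [E.map₂_whisker_left, comp_whiskerRight, Category.assoc,
        inv_hom_whiskerRight_assoc]
      rw [← associator_inv_naturality_middle_assoc, ← whiskerLeft_comp_assoc (E.map _),
        counitNat_inv_map₂, leftUnitor_inv_naturality_assoc, whisker_exchange_assoc]
      simp)

/-- The isomorphism `ρ_x ≫ R (E g ≫ ε_a) ≅ g` given by the second triangle constraint. -/
def transpositionCounitIso :
    b.transposition x a ⋙ evalAt (R.comp (homFrom x)) (unitApp b.unit x) a ≅ 𝟭 _ :=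
  NatIso.ofComponents (fun g => whiskerLeftIso _ (R.mapComp _ _) ≪≫ (α_ _ _ _).symm ≪≫
    whiskerRightIso (unitNat b.unit g).symm _ ≪≫ α_ _ _ _ ≪≫ whiskerLeftIso g (b.w a) ≪≫ ρ_ g) (by
      intro f g α
      change unitApp b.unit x ◁ R.map₂ (E.map₂ α ▷ counitApp b.counit a) ≫
          unitApp b.unit x ◁ (R.mapComp _ _).hom ≫ (α_ _ _ _).inv ≫
          (unitNat b.unit g).inv ▷ R.map (counitApp b.counit a) ≫ (α_ _ _ _).hom ≫
          g ◁ (b.w a).hom ≫ (ρ_ g).hom =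
        (unitApp b.unit x ◁ (R.mapComp _ _).hom ≫ (α_ _ _ _).inv ≫
          (unitNat b.unit f).inv ▷ R.map (counitApp b.counit a) ≫ (α_ _ _ _).hom ≫
          f ◁ (b.w a).hom ≫ (ρ_ f).hom) ≫ α
      simp only [R.map₂_whisker_right, whiskerLeft_comp,
        Category.assoc, whiskerLeft_inv_hom_assoc]
      rw [associator_inv_naturality_middle_assoc, ← comp_whiskerRight_assoc (_ ◁ _),
        unitNat_inv_map₂]
      simp only [comp_whiskerRight, Category.assoc]
      rw [associator_naturality_left_assoc, ← whisker_exchange_assoc, rightUnitor_naturality])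

theorem isBiuniversal : IsBiuniversal R (unitApp b.unit x) := fun a =>
  (CategoryTheory.Equivalence.mk _ _ (b.transpositionUnitIso x a)
    (b.transpositionCounitIso x a)).isEquivalence_functor

end Biadjunction

end BiuniversalOfBiadjunction

section Factorization

/-- Each restriction of `U^* ∘ (D' × Id)` along `(s, -)` is elementwise equivalent to
`B(D' s, U -)`. -/
def upperStarEquiv {X : Type u} [Bicategory.{w₃, v₃} X] {B : Type u₂} [Bicategory.{v, v} B]
    {C : Type u₃} [Bicategory.{v, v} C] (D' : X ⥤ᵖ Bᵒᵖ) (U : C ⥤ᵖ B) (s : X) :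
    ElementwiseEquiv
      ((sectRightPF s C).comp ((prodPF D' (Pseudofunctor.id C)).comp (upperStar U)))
      (U.comp (homFrom (D'.obj s).unop)) where
  app c := 𝟭 _
  isEquivalence c := Functor.isEquivalence_refl
  iso {l} (η : (D'.obj s).unop ⟶ U.obj l) c :=
    NatIso.ofComponents
      (fun f => whiskerRightIso (D'.mapId s).unop2 (η ≫ U.map f) ≪≫ λ_ _)
      (fun {f g} α => by
        change ((D'.map₂ (𝟙 (𝟙 s))).unop2 ▷ (η ≫ U.map f) ≫
            (D'.map (𝟙 s)).unop ◁ η ◁ U.map₂ α) ≫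
            (D'.mapId s).unop2.hom ▷ (η ≫ U.map g) ≫ (λ_ _).hom =
          ((D'.mapId s).unop2.hom ▷ (η ≫ U.map f) ≫ (λ_ _).hom) ≫ η ◁ U.map₂ α
        rw [D'.map₂_id, unop2_id, id_whiskerRight, Category.id_comp, whisker_exchange_assoc,
          Category.assoc]
        exact congrArg (_ ≫ ·) (leftUnitor_naturality (η ◁ U.map₂ α)))

theorem FactorsThroughStar.exists_isUniversalElement {S : Type v} [Bicategory.{v, v} S]
    {A : Type u₁} [Bicategory.{v, v} A] {B : Type u₂} [Bicategory.{v, v} B] {C : Type u₃}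
    [Bicategory.{v, v} C] {J : A ⥤ᵖ C} {U : C ⥤ᵖ B} {D : (S × C) ⥤ᵖ Cat.{v, v}}
    (hD : FactorsThroughStar U D) (hR : IsRightBiadjoint (J.comp U)) (s : S) :
    ∃ (l : A) (x : ((prodPF (Pseudofunctor.id S) J).comp D).obj (s, l)),
      IsUniversalElement ((sectRightPF s A).comp ((prodPF (Pseudofunctor.id S) J).comp D)) x := by
  obtain ⟨D', τ, hτ⟩ := hD
  obtain ⟨E, ⟨adj⟩⟩ := hR
  let s' : LocallyDiscrete (Discrete S) := ⟨⟨s⟩⟩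
  let b : B := (D'.obj s').unop
  let e := (((ElementwiseEquiv.ofTrans τ hτ).restrict (sectRightPF s' C)).trans
    (upperStarEquiv D' U s')).restrict J
  obtain ⟨x, hx⟩ := (e.exists_isUniversalElement_iff (E.obj b)).2 ⟨_, adj.isBiuniversal b⟩
  exact ⟨E.obj b, x, hx⟩

end Factorization

section Weights

variable {S : Type v} [Bicategory.{v, v} S] {A : Type u₁} [Bicategory.{v, v} A]
  {E : Type u₂} [Bicategory.{v, v} E] (W : S ⥤ᵖ Cat.{v, v})

/-- Pseudonatural equivalences `F(-, I a) ≃ G(-, a)` compatible with the functoriality in `a` give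
equivalences between `[S, Cat](W, F(-, I a))` and `[S, Cat](W, G(-, a))`. The isomorphisms `μ` need
not be coherent with composition in `A`. -/
def psHomEquivOfCurry {F : (S × E) ⥤ᵖ Cat.{v, v}} {G : (S × A) ⥤ᵖ Cat.{v, v}} (I : A ⥤ᵖ E)
    (π : ∀ a, (curryPF F).obj (I.obj a) ⟶ (curryPF G).obj a)
    (hπ : ∀ a s, ((π a).app s).toFunctor.IsEquivalence)
    (μ : ∀ {l a : A} (f : l ⟶ a),
      (curryPF F).map (I.map f) ≫ π a ≅ π l ≫ (curryPF G).map f)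
    (hμ : ∀ {l a : A} {f g : l ⟶ a} (α : f ⟶ g),
      (curryPF F).map₂ (I.map₂ α) ▷ π a ≫ (μ g).hom = (μ f).hom ≫ π l ◁ (curryPF G).map₂ α) :
    ElementwiseEquiv (I.comp (psHom W F)) (psHom W G) where
  app a := postcomp W (π a)
  isEquivalence a := postcomp_isEquivalence W (π a) (hπ a)
  iso {l} (x : W ⟶ (curryPF F).obj (I.obj l)) a := NatIso.ofComponents
    (fun f => α_ x ((curryPF F).map (I.map f)) (π a) ≪≫ whiskerLeftIso x (μ f) ≪≫
      (α_ x (π l) ((curryPF G).map f)).symm)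
    (fun {f g} α => by
      change (x ◁ (curryPF F).map₂ (I.map₂ α)) ▷ π a ≫ (α_ _ _ _).hom ≫ x ◁ (μ g).hom ≫
          (α_ _ _ _).inv =
        ((α_ _ _ _).hom ≫ x ◁ (μ f).hom ≫ (α_ _ _ _).inv) ≫ (x ≫ π l) ◁ (curryPF G).map₂ α
      rw [associator_naturality_middle_assoc, ← whiskerLeft_comp_assoc, hμ]
      simp)

end Weights

section SectionTrans

variable {S : Type u₁} [Bicategory.{w₁, v₁} S] {E : Type u₂} [Bicategory.{w₂, v₂} E]
  {F G : (S × E) ⥤ᵖ Cat.{v, u}} (σ : F ⟶ G)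

/-- The restriction of a pseudonatural transformation to `S × {e}`. -/
def sectTrans (e : E) : (curryPF F).obj e ⟶ (curryPF G).obj e :=
  transOfElements (F := (sectPF S e).comp F) (G := (sectPF S e).comp G)
    (fun s => (σ.app (s, e)).toFunctor) (fun u x => natAt σ (sectL u e) x)
    (fun u _ _ φ => natAt_naturality σ (sectL u e) φ)
    (fun θ x => natAt_map₂ σ (sectL₂ θ e) x)
    (fun s (x : F.obj (s, e)) => by
      change (natAt σ (𝟙 (s, e)) x).hom ≫ act₂ G (𝟙 (𝟙 (s, e))) _ ≫ (actId G (s, e) _).hom =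
        (σ.app (s, e)).toFunctor.map (act₂ F (𝟙 (𝟙 (s, e))) x ≫ (actId F (s, e) x).hom)
      rw [act₂_id, act₂_id, Category.id_comp, Category.id_comp, natAt_id])
    (fun {s t r} u v (x : F.obj (s, e)) => by
      change (natAt σ (sectL (u ≫ v) e) x).hom ≫ act₂ G (sectLComp u v e).hom _ ≫
          (actComp G (sectL u e) (sectL v e) _).hom =
        (σ.app (r, e)).toFunctor.map (act₂ F (sectLComp u v e).hom x ≫
            (actComp F (sectL u e) (sectL v e) x).hom) ≫
          (natAt σ (sectL v e) ((act F (sectL u e)).obj x)).hom ≫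
            (act G (sectL v e)).map (natAt σ (sectL u e) x).hom
      rw [Functor.map_comp, Category.assoc]
      have e₁ := natAt_map₂ σ (sectLComp u v e).hom x
      have e₂ := natAt_comp σ (sectL u e) (sectL v e) x
      rw [← e₂, ← reassoc_of% e₁])

/-- The compatibility of `sectTrans` with the functoriality in `e`. -/
def sectTransIso {e e' : E} (k : e ⟶ e') :
    (curryPF F).map k ≫ sectTrans σ e' ≅ sectTrans σ e ≫ (curryPF G).map k :=
  compIsoOfElements (fun s (x : F.obj (s, e)) => natAt σ (sectR s k) x)
    (fun s _ _ φ => natAt_naturality σ (sectR s k) φ)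
    (fun {s t} u (x : F.obj (s, e)) => by
      change (natAt σ (sectR t k) ((act F (sectL u e)).obj x)).hom ≫
          (act G (sectR t k)).map (natAt σ (sectL u e) x).hom ≫
          ((actComp G (sectL u e) (sectR t k) _).inv ≫ act₂ G (exchangeIso u k).hom _ ≫
            (actComp G (sectR s k) (sectL u e') _).hom) =
        ((σ.app (t, e')).toFunctor.map ((actComp F (sectL u e) (sectR t k) x).inv ≫
          act₂ F (exchangeIso u k).hom x ≫ (actComp F (sectR s k) (sectL u e') x).hom) ≫
          (natAt σ (sectL u e') ((act F (sectR s k)).obj x)).hom) ≫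
          (act G (sectL u e')).map (natAt σ (sectR s k) x).hom
      have e₁ := natAt_map₂ σ (exchangeIso u k).hom x
      have e₂ := natAt_comp σ (sectL u e) (sectR t k) x
      have e₃ := natAt_comp σ (sectR s k) (sectL u e') x
      rw [← cancel_epi ((σ.app (t, e')).toFunctor.map (actComp F (sectL u e) (sectR t k) x).hom),
        ← reassoc_of% e₂]
      simp only [Functor.map_comp, Category.assoc, Iso.hom_inv_id_assoc]
      rw [← e₃, reassoc_of% e₁, ← Functor.map_comp_assoc, Iso.hom_inv_id,
        CategoryTheory.Functor.map_id, Category.id_comp])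

end SectionTrans

section BaseChange

variable {S : Type u₁} [Bicategory.{w₁, v₁} S] {E : Type u₂} [Bicategory.{w₂, v₂} E]
  {A : Type u₃} [Bicategory.{w₃, v₃} A]

/-- The 1-cell `(u, k)` of a product. -/
abbrev pairHom {s t : S} (u : s ⟶ t) {e e' : E} (k : e ⟶ e') : (s, e) ⟶ (t, e') := (u, k)

/-- The 2-cell `(θ, κ)` of a product. -/
abbrev pairHom₂ {s t : S} {u u' : s ⟶ t} (θ : u ⟶ u') {e e' : E} {k k' : e ⟶ e'} (κ : k ⟶ k') :
    pairHom u k ⟶ pairHom u' k' :=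
  (θ, κ)

variable (J : A ⥤ᵖ E)

/-- The isomorphism `(u, 𝟙) ≅ (u, J 𝟙)`. -/
def sectLMapId {s t : S} (u : s ⟶ t) (a : A) : sectL u (J.obj a) ≅ pairHom u (J.map (𝟙 a)) :=
  Iso.prod (Iso.refl u) (J.mapId a).symm

/-- The isomorphism `(u ≫ v, J (f ≫ g)) ≅ (u, J f) ≫ (v, J g)`. -/
def pairMapComp {s t r : S} (u : s ⟶ t) (v : t ⟶ r) {a b c : A} (f : a ⟶ b) (g : b ⟶ c) :
    pairHom (u ≫ v) (J.map (f ≫ g)) ≅ pairHom u (J.map f) ≫ pairHom v (J.map g) :=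
  Iso.prod (Iso.refl _) (J.mapComp f g)

theorem sectLMapId_naturality {s t : S} {u u' : s ⟶ t} (θ : u ⟶ u') (a : A) :
    sectL₂ θ (J.obj a) ≫ (sectLMapId J u' a).hom =
      (sectLMapId J u a).hom ≫ pairHom₂ θ (J.map₂ (𝟙 (𝟙 a))) := by
  refine Prod.ext ?_ ?_ <;> simp [sectLMapId]

theorem sectLMapId_mapId (s : S) (a : A) :
    ((sectLMapId J (𝟙 s) a).hom ≫ pairHom₂ (𝟙 (𝟙 s)) (J.map₂ (𝟙 (𝟙 a)))) ≫
      pairHom₂ (𝟙 (𝟙 s)) (J.mapId a).hom = 𝟙 (pairHom (𝟙 s) (𝟙 (J.obj a))) := by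
  refine Prod.ext ?_ ?_ <;> simp [sectLMapId]

theorem map₂_leftUnitor_inv_mapComp_hom (a : A) :
    J.map₂ (λ_ (𝟙 a)).inv ≫ (J.mapComp (𝟙 a) (𝟙 a)).hom =
      (λ_ (J.map (𝟙 a))).inv ≫ (J.mapId a).inv ▷ J.map (𝟙 a) := by
  rw [map₂_leftUnitor_inv]
  simp

theorem sectLMapId_comp {s t r : S} (u : s ⟶ t) (v : t ⟶ r) (a : A) :
    (sectLMapId J (u ≫ v) a).hom ≫ pairHom₂ (𝟙 (u ≫ v)) (J.map₂ (λ_ (𝟙 a)).inv) ≫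
        (pairMapComp J u v (𝟙 a) (𝟙 a)).hom =
      (sectLComp u v (J.obj a)).hom ≫ sectL u (J.obj a) ◁ (sectLMapId J v a).hom ≫
        (sectLMapId J u a).hom ▷ pairHom v (J.map (𝟙 a)) := by
  refine Prod.ext ?_ ?_
  · simp [sectLMapId, sectLComp, pairMapComp]
  · simpa [sectLMapId, sectLComp, pairMapComp] using map₂_leftUnitor_inv_mapComp_hom J a

theorem sectLMapId_exchangeIso {s t : S} (u : s ⟶ t) {a b : A} (f : a ⟶ b) :
    (sectLMapId J u a).hom ▷ sectR t (J.map f) ≫ (pairMapComp J u (𝟙 t) (𝟙 a) f).inv ≫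
        pairHom₂ (exchangeIso u f).hom.1 (J.map₂ (exchangeIso u f).hom.2) ≫
        (pairMapComp J (𝟙 s) u f (𝟙 b)).hom =
      (exchangeIso u (J.map f)).hom ≫ sectR s (J.map f) ◁ (sectLMapId J u b).hom := by
  refine Prod.ext ?_ ?_ <;> simp [sectLMapId, exchangeIso, pairMapComp, map₂_ρ_inv]

variable (F : (S × E) ⥤ᵖ Cat.{v, u})

/-- The comparison of `F(-, J a)` with the restriction of `F ∘ (Id × J)` to `S × {a}`. The two
differ because the latter sends `u` to `F(u, J 𝟙)`. -/
def baseChange (a : A) :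
    (curryPF F).obj (J.obj a) ⟶ (curryPF ((prodPF (Pseudofunctor.id S) J).comp F)).obj a :=
  transOfElements (F := (sectPF S (J.obj a)).comp F)
    (G := (sectPF S a).comp ((prodPF (Pseudofunctor.id S) J).comp F))
    (fun s => 𝟭 (F.obj (s, J.obj a))) (fun u x => act₂Iso F (sectLMapId J u a) x)
    (fun u x y φ => act₂_naturality F (sectLMapId J u a).hom φ)
    (fun {s t u u'} θ (x : F.obj (s, J.obj a)) => by
      change act₂ F (sectL₂ θ (J.obj a)) x ≫ act₂ F (sectLMapId J u' a).hom x =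
        act₂ F (sectLMapId J u a).hom x ≫ act₂ F (pairHom₂ θ (J.map₂ (𝟙 (𝟙 a)))) x
      rw [← act₂_comp, ← act₂_comp, sectLMapId_naturality])
    (fun s (x : F.obj (s, J.obj a)) => by
      change act₂ F (sectLMapId J (𝟙 s) a).hom x ≫
          act₂ F (pairHom₂ (𝟙 (𝟙 s)) (J.map₂ (𝟙 (𝟙 a)))) x ≫
          act₂ F (pairHom₂ (𝟙 (𝟙 s)) (J.mapId a).hom) x ≫ (actId F (s, J.obj a) x).hom =
        act₂ F (𝟙 (𝟙 (s, J.obj a))) x ≫ (actId F (s, J.obj a) x).hom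
      rw [← reassoc_of% @act₂_comp, ← reassoc_of% @act₂_comp, sectLMapId_mapId]
      rfl)
    (fun {s t r} u v (x : F.obj (s, J.obj a)) => by
      change act₂ F (sectLMapId J (u ≫ v) a).hom x ≫
          act₂ F (pairHom₂ (𝟙 (u ≫ v)) (J.map₂ (λ_ (𝟙 a)).inv)) x ≫
          act₂ F (pairMapComp J u v (𝟙 a) (𝟙 a)).hom x ≫
          (actComp F (pairHom u (J.map (𝟙 a))) (pairHom v (J.map (𝟙 a))) x).hom =
        (act₂ F (sectLComp u v (J.obj a)).hom x ≫
            (actComp F (sectL u (J.obj a)) (sectL v (J.obj a)) x).hom) ≫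
          act₂ F (sectLMapId J v a).hom ((act F (sectL u (J.obj a))).obj x) ≫
          (act F (pairHom v (J.map (𝟙 a)))).map (act₂ F (sectLMapId J u a).hom x)
      rw [Category.assoc, ← reassoc_of% @actComp_whiskerLeft, ← actComp_whiskerRight]
      simp only [← reassoc_of% @act₂_comp]
      rw [sectLMapId_comp])

/-- The compatibility of `baseChange` with the functoriality in `a`. -/
def baseChangeIso {a b : A} (f : a ⟶ b) :
    (curryPF F).map (J.map f) ≫ baseChange J F b ≅
      baseChange J F a ≫ (curryPF ((prodPF (Pseudofunctor.id S) J).comp F)).map f :=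
  compIsoOfElements (fun s (x : F.obj (s, J.obj a)) => Iso.refl ((act F (sectR s (J.map f))).obj x))
    (fun s x y φ => (Category.comp_id _).trans (Category.id_comp _).symm)
    (fun {s t} u (x : F.obj (s, J.obj a)) => by
      change 𝟙 _ ≫ (act F (sectR t (J.map f))).map (act₂ F (sectLMapId J u a).hom x) ≫
          ((actComp F (pairHom u (J.map (𝟙 a))) (sectR t (J.map f)) x).inv ≫
            act₂ F (pairMapComp J u (𝟙 t) (𝟙 a) f).inv x) ≫
          act₂ F (pairHom₂ (exchangeIso u f).hom.1 (J.map₂ (exchangeIso u f).hom.2)) x ≫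
          act₂ F (pairMapComp J (𝟙 s) u f (𝟙 b)).hom x ≫
          (actComp F (sectR s (J.map f)) (pairHom u (J.map (𝟙 b))) x).hom =
        (((actComp F (sectL u (J.obj a)) (sectR t (J.map f)) x).inv ≫
          act₂ F (exchangeIso u (J.map f)).hom x ≫
            (actComp F (sectR s (J.map f)) (sectL u (J.obj b)) x).hom) ≫
          act₂ F (sectLMapId J u b).hom ((act F (sectR s (J.map f))).obj x)) ≫
          (act F (pairHom u (J.map (𝟙 b)))).map (𝟙 _)
      rw [← cancel_epi (actComp F (sectL u (J.obj a)) (sectR t (J.map f)) x).hom, Category.id_comp,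
        ← reassoc_of% @actComp_whiskerRight, CategoryTheory.Functor.map_id, Category.comp_id]
      simp only [Category.assoc, Iso.hom_inv_id_assoc]
      rw [← actComp_whiskerLeft]
      simp only [← reassoc_of% @act₂_comp]
      rw [sectLMapId_exchangeIso])

end BaseChange

section Weights

variable {S : Type v} [Bicategory.{v, v} S] {A : Type u₁} [Bicategory.{v, v} A]
  {E : Type u₂} [Bicategory.{v, v} E] (W : S ⥤ᵖ Cat.{v, v})

/-- The pseudofunctor `[S, Cat](W, -)` preserves pseudonatural equivalences, elementwise. -/
def psHomEquivOfTrans {F G : (S × E) ⥤ᵖ Cat.{v, v}} (σ : F ⟶ G)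
    (h : ∀ x, (σ.app x).toFunctor.IsEquivalence) : ElementwiseEquiv (psHom W F) (psHom W G) :=
  (psHomEquivOfCurry W (Pseudofunctor.id E) (sectTrans σ) (fun e s => h (s, e)) (sectTransIso σ)
    (fun α => Pseudofunctor.StrongTrans.homCategory.ext fun s =>
      Cat.Hom₂.ext (NatTrans.ext (funext fun x => natAt_map₂ σ (sectR₂ s α) x)))).ofIdComp

/-- The pseudofunctor `[S, Cat](W, -)` is compatible with base change, elementwise. -/
def psHomEquivBaseChange (J : A ⥤ᵖ E) (F : (S × E) ⥤ᵖ Cat.{v, v}) :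
    ElementwiseEquiv (J.comp (psHom W F)) (psHom W ((prodPF (Pseudofunctor.id S) J).comp F)) :=
  psHomEquivOfCurry W J (baseChange J F)
    (fun a s => inferInstanceAs (𝟭 (F.obj (s, J.obj a))).IsEquivalence) (baseChangeIso J F)
    (fun _ => Pseudofunctor.StrongTrans.homCategory.ext fun _ =>
      Cat.Hom₂.ext (NatTrans.ext (funext fun _ =>
        (Category.comp_id _).trans (Category.id_comp _).symm)))

end Weights

section Evaluation

/-- The terminal category. -/
abbrev pt : Cat.{v, v} := Cat.of (Discrete PUnit.{v + 1})

/-- The object of the terminal category. -/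
abbrev pt.star : pt.{v} := ⟨PUnit.unit⟩

/-- The evaluation functor from `Cat(1, X)` to `X`. -/
def evalPt (X : Cat.{v, v}) : (pt.{v} ⟶ X) ⥤ X where
  obj z := z.toFunctor.obj pt.star
  map α := α.toNatTrans.app pt.star

theorem evalPt_isEquivalence (X : Cat.{v, v}) : (evalPt X).IsEquivalence where
  faithful := ⟨fun {z z'} α β e => by
    refine Cat.Hom₂.ext (NatTrans.ext (funext ?_))
    rintro ⟨⟨⟩⟩
    exact e⟩
  full := ⟨fun {z z'} p => ⟨⟨Discrete.natTrans (fun ⟨⟨⟩⟩ => p)⟩, rfl⟩⟩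
  essSurj := ⟨fun x => ⟨(Functor.fromPUnit x).toCatHom, ⟨Iso.refl _⟩⟩⟩

variable {E : Type u₁} [Bicategory.{v, v} E]

/-- The elementwise equivalence `Cat(1, P -) ≃ P`. -/
def evalPtEquiv (P : E ⥤ᵖ Cat.{v, v}) :
    ElementwiseEquiv ((sectRightPF (op pt.{v}) E).comp
      ((prodPF (Pseudofunctor.id Cat.{v, v}ᵒᵖ) P).comp (homPF Cat.{v, v}))) P where
  app e := evalPt (P.obj e)
  isEquivalence e := evalPt_isEquivalence (P.obj e)
  iso {l} (z : pt ⟶ P.obj l) a := NatIso.ofComponents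
    (fun f => Iso.refl ((act P f).obj (z.toFunctor.obj pt.star)))
    (fun {f g} θ => by
      change ((act P f).map (z.toFunctor.map (𝟙 pt.star)) ≫ act₂ P θ (z.toFunctor.obj pt.star)) ≫
        𝟙 _ = 𝟙 _ ≫ act₂ P θ (z.toFunctor.obj pt.star)
      simp only [CategoryTheory.Functor.map_id, Category.id_comp, Category.comp_id])

/-- The pseudonatural transformation `Cat(1, D(-, -)) ⟶ D`. -/
def evalPtTrans {S : Type v} [Bicategory.{v, v} S] (D : (S × E) ⥤ᵖ Cat.{v, v}) :
    (prodPF (Pseudofunctor.id S) (sectRightPF (op pt.{v}) E)).comp (homInto D) ⟶ D :=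
  transOfElements (fun p => evalPt (D.obj p))
    (fun {a b} f (z : pt ⟶ D.obj a) => Iso.refl ((act D f).obj (z.toFunctor.obj pt.star)))
    (fun {a b} f z z' α => (Category.comp_id _).trans (Category.id_comp _).symm)
    (fun {a b f g} θ (z : pt ⟶ D.obj a) => by
      change ((act D f).map (z.toFunctor.map (𝟙 pt.star)) ≫
        act₂ D θ (z.toFunctor.obj pt.star)) ≫ 𝟙 _ = 𝟙 _ ≫ act₂ D θ (z.toFunctor.obj pt.star)
      simp only [CategoryTheory.Functor.map_id, Category.id_comp, Category.comp_id])
    (fun a (z : pt ⟶ D.obj a) => by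
      change 𝟙 _ ≫ (actId D a (z.toFunctor.obj pt.star)).hom =
        ((act D (𝟙 a)).map (z.toFunctor.map (𝟙 pt.star)) ≫ act₂ D (𝟙 (𝟙 a)) _) ≫
          ((act D (𝟙 a)).map (z.toFunctor.map (𝟙 pt.star)) ≫ act₂ D (𝟙 (𝟙 a)) _) ≫
          ((act D (𝟙 a)).map (z.toFunctor.map (𝟙 pt.star)) ≫ (actId D a _).hom) ≫ 𝟙 _ ≫ 𝟙 _
      simp only [act₂_id, CategoryTheory.Functor.map_id, Category.id_comp, Category.comp_id])
    (fun {a b c} f g (z : pt ⟶ D.obj a) => by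
      change 𝟙 _ ≫ (actComp D f g (z.toFunctor.obj pt.star)).hom =
        (((act D (f ≫ g)).map (z.toFunctor.map (𝟙 pt.star)) ≫ act₂ D (𝟙 (f ≫ g)) _) ≫
          ((act D (f ≫ g)).map (z.toFunctor.map (𝟙 pt.star)) ≫ act₂ D (𝟙 (f ≫ g)) _) ≫
          ((act D (f ≫ g)).map (z.toFunctor.map (𝟙 pt.star)) ≫ (actComp D f g _).hom) ≫
            𝟙 _ ≫ 𝟙 _ ≫ 𝟙 _) ≫ 𝟙 _ ≫ (act D g).map (𝟙 _)
      simp only [act₂_id, CategoryTheory.Functor.map_id, Category.id_comp, Category.comp_id])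

end Evaluation

section Bicolimits

variable {S : Type v} [Bicategory.{v, v} S] {A : Type u₁} [Bicategory.{v, v} A]
  {C : Type u₃} [Bicategory.{v, v} C] {C' : Type u₄} [Bicategory.{v, v} C']
  {W : S ⥤ᵖ Cat.{v, v}}

theorem IsWeightedBilimit.exists_isUniversalElement_iff {D : (S × C') ⥤ᵖ Cat.{v, v}}
    {P : C' ⥤ᵖ Cat.{v, v}} (h : IsWeightedBilimit W D P) (J : A ⥤ᵖ C') (l : A) :
    (∃ x : (J.comp P).obj l, IsUniversalElement (J.comp P) x) ↔
      ∃ x : (psHom W ((prodPF (Pseudofunctor.id S) J).comp D)).obj l,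
        IsUniversalElement (psHom W ((prodPF (Pseudofunctor.id S) J).comp D)) x := by
  obtain ⟨τ, hτ⟩ := h
  let K := sectRightPF (op pt.{v}) C'
  let e := (((ElementwiseEquiv.ofTrans τ hτ).restrict K).trans
    (psHomEquivBaseChange W K (homInto D))).trans
    (psHomEquivOfTrans W (evalPtTrans D) fun p => evalPt_isEquivalence (D.obj p))
  exact (((evalPtEquiv P).restrict J).exists_isUniversalElement_iff l).symm.trans
    (((e.restrict J).trans (psHomEquivBaseChange W J D)).exists_isUniversalElement_iff l)

theorem IsWeightedBilimit.exists_isBiuniversal_iff {J : A ⥤ᵖ C'} {V : C' ⥤ᵖ C} {y : C}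
    {D : (S × C') ⥤ᵖ Cat.{v, v}} (h : IsWeightedBilimit W D (V.comp (homFrom y)))
    {𝒜 : Sᵒᵖ ⥤ᵖ A}
    (h𝒜 : PseudonaturalEquiv ((prodPF (Pseudofunctor.id S) J).comp D) (homOut 𝒜)) (l : A) :
    (∃ g : y ⟶ (J.comp V).obj l, IsBiuniversal (J.comp V) g) ↔ IsWeightedBicolimit W 𝒜 l := by
  obtain ⟨σ, hσ⟩ := h𝒜
  exact (h.exists_isUniversalElement_iff J l).trans
    (((psHomEquivOfTrans W σ hσ).exists_isUniversalElement_iff l).trans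
      (pseudonaturalEquiv_homFrom_iff l).symm)

variable {J : A ⥤ᵖ C'} {V : C' ⥤ᵖ C} {𝒟 : C → ((S × C') ⥤ᵖ Cat.{v, v})} {𝒜 : C → (Sᵒᵖ ⥤ᵖ A)}

theorem exists_biadjunction_of_isWeightedBicolimit
    (hlim : ∀ y, IsWeightedBilimit W (𝒟 y) (V.comp (homFrom y)))
    (h𝒜 : ∀ y, PseudonaturalEquiv ((prodPF (Pseudofunctor.id S) J).comp (𝒟 y)) (homOut (𝒜 y)))
    (L : C → A) (hL : ∀ y, IsWeightedBicolimit W (𝒜 y) (L y)) :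
    ∃ G : C ⥤ᵖ A, (∀ y, G.obj y = L y) ∧ Nonempty (Biadjunction G (J.comp V)) := by
  choose η hη using fun y => ((hlim y).exists_isBiuniversal_iff (h𝒜 y) (L y)).2 (hL y)
  exact exists_biadjunction_of_isBiuniversal hη

theorem isRightBiadjoint_iff_exists_isWeightedBicolimit
    (hlim : ∀ y, IsWeightedBilimit W (𝒟 y) (V.comp (homFrom y)))
    (h𝒜 : ∀ y, PseudonaturalEquiv ((prodPF (Pseudofunctor.id S) J).comp (𝒟 y))
      (homOut (𝒜 y))) :
    IsRightBiadjoint (J.comp V) ↔ ∀ y, ∃ L : A, IsWeightedBicolimit W (𝒜 y) L := by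
  refine ⟨fun ⟨G, ⟨adj⟩⟩ y => ⟨G.obj y, ?_⟩, fun h => ?_⟩
  · exact ((hlim y).exists_isBiuniversal_iff (h𝒜 y) _).1 ⟨_, adj.isBiuniversal y⟩
  · choose L hL using h
    obtain ⟨G, -, adj⟩ := exists_biadjunction_of_isWeightedBicolimit hlim h𝒜 L hL
    exact ⟨G, adj⟩

end Bicolimits

end BiTri

theorem mainTheorem4_general
    {S : Type v} [Bicategory.{v, v} S] {A : Type u₁} [Bicategory.{v, v} A]
    {B : Type u₂} [Bicategory.{v, v} B] {C : Type u₃} [Bicategory.{v, v} C]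
    {C' : Type u₄} [Bicategory.{v, v} C']
    (W : S ⥤ᵖ Cat.{v, v}) (J : A ⥤ᵖ C') (U : C' ⥤ᵖ B) (hR : IsRightBiadjoint (J.comp U))
    (V : C' ⥤ᵖ C) (𝒟 : C → ((S × C') ⥤ᵖ Cat.{v, v}))
    (hfac : ∀ y : C, FactorsThroughStar U (𝒟 y))
    (hlim : ∀ y : C, IsWeightedBilimit W (𝒟 y) (V.comp (homFrom y))) :
    (∀ y : C, ∃ 𝒜 : Sᵒᵖ ⥤ᵖ A,
      PseudonaturalEquiv ((prodPF (Pseudofunctor.id S) J).comp (𝒟 y)) (homOut 𝒜)) ∧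
    ∀ 𝒜 : C → (Sᵒᵖ ⥤ᵖ A),
      (∀ y : C,
        PseudonaturalEquiv ((prodPF (Pseudofunctor.id S) J).comp (𝒟 y)) (homOut (𝒜 y))) →
      (IsRightBiadjoint (J.comp V) ↔ ∀ y : C, ∃ L : A, IsWeightedBicolimit W (𝒜 y) L) ∧
      ∀ L : C → A, (∀ y : C, IsWeightedBicolimit W (𝒜 y) (L y)) →
        ∃ G : C ⥤ᵖ A, (∀ y : C, G.obj y = L y) ∧ Nonempty (Biadjunction G (J.comp V)) :=
  ⟨fun y => exists_pseudonaturalEquiv_homOut _ ((hfac y).exists_isUniversalElement hR), fun _ h𝒜 =>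
    ⟨isRightBiadjoint_iff_exists_isWeightedBicolimit hlim h𝒜,
      exists_biadjunction_of_isWeightedBicolimit hlim h𝒜⟩⟩

theorem mainTheorem4
    {S : Type v} [Bicategory.{v, v} S] [Bicategory.Strict S]
    {A : Type u₁} [Bicategory.{v, v} A] [Bicategory.Strict A]
    {B : Type u₂} [Bicategory.{v, v} B] [Bicategory.Strict B]
    {C : Type u₃} [Bicategory.{v, v} C] [Bicategory.Strict C]
    {C' : Type u₄} [Bicategory.{v, v} C'] [Bicategory.Strict C']
    (W : S ⥤ᵖ Cat.{v, v})
    (R : A ⥤ᵖ B) (hR : IsRightBiadjoint R)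
    (J : A ⥤ᵖ C') (U : C' ⥤ᵖ B) (hJ : J.comp U = R)
    (V : C' ⥤ᵖ C)
    (𝒟 : C → ((S × C') ⥤ᵖ Cat.{v, v}))
    (hfac : ∀ y : C, FactorsThroughStar U (𝒟 y))
    (hlim : ∀ y : C, IsWeightedBilimit W (𝒟 y) (V.comp (homFrom y))) :
    (∀ y : C, ∃ 𝒜 : Sᵒᵖ ⥤ᵖ A,
      PseudonaturalEquiv ((prodPF (Pseudofunctor.id S) J).comp (𝒟 y)) (homOut 𝒜)) ∧
    ∀ 𝒜 : C → (Sᵒᵖ ⥤ᵖ A),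
      (∀ y : C,
        PseudonaturalEquiv ((prodPF (Pseudofunctor.id S) J).comp (𝒟 y)) (homOut (𝒜 y))) →
      (IsRightBiadjoint (J.comp V) ↔ ∀ y : C, ∃ L : A, IsWeightedBicolimit W (𝒜 y) L) ∧
      ∀ L : C → A, (∀ y : C, IsWeightedBicolimit W (𝒜 y) (L y)) →
        ∃ G : C ⥤ᵖ A, (∀ y : C, G.obj y = L y) ∧ Nonempty (Biadjunction G (J.comp V)) := by
  subst hJ
  exact mainTheorem4_general W J U hR V 𝒟 hfac hlim
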